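/- Let $\mathsf{EHA}$ be extensional Heyting arithmetic in all finite types. Its finite types are generated from $N$ by $\sigma\times\tau$, $\sigma+\tau$, $\sigma\to\tau$. Its terms are built from typed variables and the constants $\mathsf{k},\mathsf{s},\mathsf{pair},\mathsf{fst},\mathsf{snd},\mathsf{inl},\mathsf{inr},\mathsf{case},\mathsf{0},\mathsf{succ},\mathsf{R}$ by application. Its logic is many-sorted intuitionistic predicate logic with equality at every type. Its axioms are the usual equations for the constants, surjective pairing, the statement that every element of $\sigma+\tau$ is of the form $\mathsf{inl}\,u$ or $\mathsf{inr}\,v$, $\mathsf{succ}\,n\neq \mathsf 0$, injectivity of $\mathsf{succ}$, induction for all formulas, and extensionality $\forall x\,(fx=gx)\to f=g$. With $0:=N$ and $n+1:=(n\to N)$, let \[ \mathsf{CE}_0:\quad \exists X^{2\to1\to1\to0}\,\forall \Phi^{2}\,\forall f^1,g^1\,\big(\Phi f\neq\Phi g\to f(X\Phi fg)\neq g(X\Phi fg)\big). \] By induction on $\sigma$ define types $\sigma^+,\sigma^-$ and formulas $\mathrm{dom}_\sigma(x)$, $\mathrm{app}_\sigma(x,y,z)$ with $x,y:\sigma^+$,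 $z:\sigma^-$: * $N^+=N^-=N$; $\mathrm{dom}_N(x)$ is $x=x$; $\mathrm{app}_N(x,y,z)$ is $x\neq y$. * $(\sigma\times\tau)^+=\sigma^+\times\tau^+$, $(\sigma\times\tau)^-=\sigma^-+\tau^-$; $\mathrm{dom}_{\sigma\times\tau}(x)$ is $\mathrm{dom}_\sigma(\mathsf{fst}\,x)\land\mathrm{dom}_\tau(\mathsf{snd}\,x)$; $\mathrm{app}_{\sigma\times\tau}(x,y,z)$ is $\big(\exists u\,(z=\mathsf{inl}\,u\land\mathrm{app}_\sigma(\mathsf{fst}\,x,\mathsf{fst}\,y,u))\lor\exists v\,(z=\mathsf{inr}\,v\land\mathrm{app}_\tau(\mathsf{snd}\,x,\mathsf{snd}\,y,v))\big)\land\mathrm{dom}_{\sigma\times\tau}(x)\land\mathrm{dom}_{\sigma\times\tau}(y)$. * $(\sigma+\tau)^+=\sigma^++\tau^+$, $(\sigma+\tau)^-=\sigma^-\times\tau^-$; $\mathrm{dom}_{\sigma+\tau}(x)$ is $\exists u\,(x=\mathsf{inl}\,u\land\mathrm{dom}_\sigma(u))\lor\exists v\,(x=\mathsf{inr}\,v\land\mathrm{dom}_\tau(v))$;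 $\mathrm{app}_{\sigma+\tau}(x,y,z)$ is $\big(\exists u,v\,((x=\mathsf{inl}\,u\land y=\mathsf{inr}\,v)\lor(x=\mathsf{inr}\,v\land y=\mathsf{inl}\,u))\lor\exists u,v\,(x=\mathsf{inl}\,u\land y=\mathsf{inl}\,v\land\mathrm{app}_\sigma(u,v,\mathsf{fst}\,z))\lor\exists u,v\,(x=\mathsf{inr}\,u\land y=\mathsf{inr}\,v\land\mathrm{app}_\tau(u,v,\mathsf{snd}\,z))\big)\land\mathrm{dom}_{\sigma+\tau}(x)\land\mathrm{dom}_{\sigma+\tau}(y)$. * $(\sigma\to\tau)^+=(\sigma^+\to\tau^+)\times(\sigma^+\to\sigma^+\to\tau^-\to\sigma^-)$, $(\sigma\to\tau)^-=\sigma^+\times\tau^-$; $\mathrm{dom}_{\sigma\to\tau}(x)$ is $\forall u\,(\mathrm{dom}_\sigma(u)\to\mathrm{dom}_\tau((\mathsf{fst}\,x)u))\land\forall u,v,w\,\big(\mathrm{dom}_\sigma(u)\to\mathrm{dom}_\sigma(v)\to\mathrm{app}_\tau((\mathsf{fst}\,x)u,(\mathsf{fst}\,x)v,w)\to\mathrm{app}_\sigma(u,v,(\mathsf{snd}\,x)uvw)\big)$;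 $\mathrm{app}_{\sigma\to\tau}(x,y,z)$ is $\mathrm{dom}_\sigma(\mathsf{fst}\,z)\land\mathrm{app}_\tau((\mathsf{fst}\,x)(\mathsf{fst}\,z),(\mathsf{fst}\,y)(\mathsf{fst}\,z),\mathsf{snd}\,z)\land\mathrm{dom}_{\sigma\to\tau}(x)\land\mathrm{dom}_{\sigma\to\tau}(y)$. For $f:(\sigma\to\tau)^+$ and $x:\sigma^+$ write $f\odot x:=(\mathsf{fst}\,f)\,x$ (associating to the left). Call an assignment $c\mapsto c^\alpha$ of closed terms $c^\alpha:\sigma^+$ to the constants $c:\sigma$ *correct* if $\mathsf{EHA}$ proves $\mathrm{dom}_\sigma(c^\alpha)$ for every $c$; proves $\mathsf{0}^\alpha=\mathsf 0$, $\mathsf{succ}^\alpha\odot n=\mathsf{succ}\,n$, $\mathsf{pair}^\alpha\odot x\odot y=\mathsf{pair}\,x\,y$, and likewise for $\mathsf{fst},\mathsf{snd},\mathsf{inl},\mathsf{inr}$; and proves the defining equations of $\mathsf{k},\mathsf{s},\mathsf{case},\mathsf{R}$ read with $\odot$: $\mathsf{k}^\alpha\odot x\odot y=x$, $\mathsf{s}^\alpha\odot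 x\odot y\odot z=x\odot z\odot(y\odot z)$, $\mathsf{case}^\alpha\odot f\odot g\odot\mathsf{inl}\,x=f\odot x$, $\mathsf{case}^\alpha\odot f\odot g\odot\mathsf{inr}\,y=g\odot y$, $\mathsf{R}^\alpha\odot a\odot f\odot\mathsf 0=a$, $\mathsf{R}^\alpha\odot a\odot f\odot\mathsf{succ}\,n=f\odot n\odot(\mathsf{R}^\alpha\odot a\odot f\odot n)$. Given such an assignment, terms are interpreted by sending variables of type $\sigma$ to variables of type $\sigma^+$, constants $c$ to $c^\alpha$, and $(ts)^\alpha=t^\alpha\odot s^\alpha$. The interpretation $\varphi\mapsto\varphi^\alpha$ of formulas commutes with the connectives, relativizes quantifiers over $\sigma$ to $\mathrm{dom}_\sigma$ on $\sigma^+$, and sends an equation $s=t$ at type $\sigma$ to $\neg\exists z^{\sigma^-}\mathrm{app}_\sigma(s^\alpha,t^\alpha,z)$. **Theorem.** A correct assignment of closed terms to the constants exists, and for every correct assignment $\alpha$ is an interpretation of $\mathsf{EHA}+\mathsf{CE}_0$ in $\mathsf{EHA}$: for every sentence $\varphi$, if $\mathsf{EHA}+\mathsf{CE}_0\vdash\varphi$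 then $\mathsf{EHA}\vdash\varphi^\alpha$. -/

import Mathlib

namespace EHA

/-! ## The language of extensional Heyting arithmetic in all finite types -/

/-- Finite types, with binary products and binary sums. -/
inductive Ty : Type
  | nat : Ty
  | prod : Ty → Ty → Ty
  | sum : Ty → Ty → Ty
  | arr : Ty → Ty → Ty

infixr:35 " ⇒ " => Ty.arr

/-- A context is the list of the types of the free variables (de Bruijn indices). -/
abbrev Ctx : Type := List Ty

/-- Variables of a given type in a context. -/
inductive Var : Ctx → Ty → Type
  | here {Γ : Ctx} {σ : Ty} : Var (σ :: Γ) σ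
  | there {Γ : Ctx} {σ τ : Ty} : Var Γ σ → Var (τ :: Γ) σ

/-- The constants. -/
inductive Con : Ty → Type
  | k (σ τ : Ty) : Con (σ ⇒ τ ⇒ σ)
  | s (σ τ ρ : Ty) : Con ((σ ⇒ τ ⇒ ρ) ⇒ (σ ⇒ τ) ⇒ σ ⇒ ρ)
  | pair (σ τ : Ty) : Con (σ ⇒ τ ⇒ Ty.prod σ τ)
  | fst (σ τ : Ty) : Con (Ty.prod σ τ ⇒ σ)
  | snd (σ τ : Ty) : Con (Ty.prod σ τ ⇒ τ)
  | inl (σ τ : Ty) : Con (σ ⇒ Ty.sum σ τ)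
  | inr (σ τ : Ty) : Con (τ ⇒ Ty.sum σ τ)
  | cases (σ τ ρ : Ty) : Con ((σ ⇒ ρ) ⇒ (τ ⇒ ρ) ⇒ Ty.sum σ τ ⇒ ρ)
  | zero : Con Ty.nat
  | succ : Con (Ty.nat ⇒ Ty.nat)
  | recur (σ : Ty) : Con (σ ⇒ (Ty.nat ⇒ σ ⇒ σ) ⇒ Ty.nat ⇒ σ)

/-- Terms: typed applicative terms built from variables and constants. -/
inductive Tm (Γ : Ctx) : Ty → Type
  | var {σ : Ty} : Var Γ σ → Tm Γ σ
  | con {σ : Ty} : Con σ → Tm Γ σ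
  | app {σ τ : Ty} : Tm Γ (σ ⇒ τ) → Tm Γ σ → Tm Γ τ

infixl:75 " ⬝ " => Tm.app

/-- Formulas with their free variables in a context; equality is primitive at every type. -/
inductive Fm : Ctx → Type
  | bot {Γ : Ctx} : Fm Γ
  | eq {Γ : Ctx} {σ : Ty} : Tm Γ σ → Tm Γ σ → Fm Γ
  | and {Γ : Ctx} : Fm Γ → Fm Γ → Fm Γ
  | or {Γ : Ctx} : Fm Γ → Fm Γ → Fm Γ
  | imp {Γ : Ctx} : Fm Γ → Fm Γ → Fm Γ
  | all {Γ : Ctx} (σ : Ty) : Fm (σ :: Γ) → Fm Γ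
  | ex {Γ : Ctx} (σ : Ty) : Fm (σ :: Γ) → Fm Γ

infix:50 " ≐ " => Fm.eq
infixr:35 " ⋏ " => Fm.and
infixr:30 " ⋎ " => Fm.or
infixr:25 " ⟹ " => Fm.imp

/-- Negation. -/
abbrev Fm.neg {Γ : Ctx} (φ : Fm Γ) : Fm Γ := φ ⟹ Fm.bot

/-! ### Substitution -/

/-- Simultaneous substitutions. -/
abbrev Sub (Γ Δ : Ctx) : Type := ∀ σ : Ty, Var Γ σ → Tm Δ σ

/-- The substitution on the empty context. -/
def Sub.nil {Δ : Ctx} : Sub [] Δ := fun _ v => nomatch v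

/-- Extend a substitution by a term for the newest variable. -/
def Sub.cons {Γ Δ : Ctx} {τ : Ty} (t : Tm Δ τ) (θ : Sub Γ Δ) : Sub (τ :: Γ) Δ
  | _, Var.here => t
  | _, Var.there v => θ _ v

/-- The identity substitution. -/
def Sub.id {Γ : Ctx} : Sub Γ Γ := fun _ v => Tm.var v

/-- Renaming away from a fresh variable. -/
def Sub.shift {Γ : Ctx} {τ : Ty} : Sub Γ (τ :: Γ) := fun _ v => Tm.var (Var.there v)

def Tm.subst {Γ Δ : Ctx} (θ : Sub Γ Δ) : {σ : Ty} → Tm Γ σ → Tm Δ σ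
  | _, Tm.var v => θ _ v
  | _, Tm.con c => Tm.con c
  | _, Tm.app t u => Tm.app (t.subst θ) (u.subst θ)

/-- Weakening of a term by a fresh variable. -/
def Tm.wk {Γ : Ctx} {σ τ : Ty} (t : Tm Γ σ) : Tm (τ :: Γ) σ := t.subst Sub.shift

/-- Extend a substitution under a binder. -/
def Sub.lift {Γ Δ : Ctx} {τ : Ty} (θ : Sub Γ Δ) : Sub (τ :: Γ) (τ :: Δ) :=
  Sub.cons (Tm.var Var.here) (fun σ v => (θ σ v).wk)

def Fm.subst : {Γ Δ : Ctx} → Sub Γ Δ → Fm Γ → Fm Δ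
  | _, _, _, Fm.bot => Fm.bot
  | _, _, θ, Fm.eq s t => Fm.eq (s.subst θ) (t.subst θ)
  | _, _, θ, Fm.and φ ψ => Fm.and (φ.subst θ) (ψ.subst θ)
  | _, _, θ, Fm.or φ ψ => Fm.or (φ.subst θ) (ψ.subst θ)
  | _, _, θ, Fm.imp φ ψ => Fm.imp (φ.subst θ) (ψ.subst θ)
  | _, _, θ, Fm.all σ φ => Fm.all σ (φ.subst θ.lift)
  | _, _, θ, Fm.ex σ φ => Fm.ex σ (φ.subst θ.lift)

/-- Weakening of a formula by a fresh variable. -/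
def Fm.wk {Γ : Ctx} {τ : Ty} (φ : Fm Γ) : Fm (τ :: Γ) := φ.subst Sub.shift

/-- Replace the newest variable by a term. -/
def Fm.inst {Γ : Ctx} {τ : Ty} (φ : Fm (τ :: Γ)) (t : Tm Γ τ) : Fm Γ :=
  φ.subst (Sub.cons t Sub.id)

/-! ### Abbreviations for terms -/

section
variable {Γ : Ctx} {σ τ ρ : Ty}

/-- The variables with de Bruijn index 0, 1, 2, 3, 4. -/
abbrev v0 {a : Ty} : Tm (a :: Γ) a := Tm.var Var.here
abbrev v1 {a b : Ty} : Tm (b :: a :: Γ) a := Tm.var (Var.there Var.here)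
abbrev v2 {a b c : Ty} : Tm (c :: b :: a :: Γ) a := Tm.var (Var.there (Var.there Var.here))
abbrev v3 {a b c d : Ty} : Tm (d :: c :: b :: a :: Γ) a :=
  Tm.var (Var.there (Var.there (Var.there Var.here)))
abbrev v4 {a b c d e : Ty} : Tm (e :: d :: c :: b :: a :: Γ) a :=
  Tm.var (Var.there (Var.there (Var.there (Var.there Var.here))))

abbrev K : Tm Γ (σ ⇒ τ ⇒ σ) := Tm.con (Con.k σ τ)
abbrev S : Tm Γ ((σ ⇒ τ ⇒ ρ) ⇒ (σ ⇒ τ) ⇒ σ ⇒ ρ) := Tm.con (Con.s σ τ ρ)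
abbrev pairT (t : Tm Γ σ) (u : Tm Γ τ) : Tm Γ (Ty.prod σ τ) := Tm.con (Con.pair σ τ) ⬝ t ⬝ u
abbrev fstT (t : Tm Γ (Ty.prod σ τ)) : Tm Γ σ := Tm.con (Con.fst σ τ) ⬝ t
abbrev sndT (t : Tm Γ (Ty.prod σ τ)) : Tm Γ τ := Tm.con (Con.snd σ τ) ⬝ t
abbrev inlT (t : Tm Γ σ) : Tm Γ (Ty.sum σ τ) := Tm.con (Con.inl σ τ) ⬝ t
abbrev inrT (t : Tm Γ τ) : Tm Γ (Ty.sum σ τ) := Tm.con (Con.inr σ τ) ⬝ t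
abbrev casesT (f : Tm Γ (σ ⇒ ρ)) (g : Tm Γ (τ ⇒ ρ)) (t : Tm Γ (Ty.sum σ τ)) : Tm Γ ρ :=
  Tm.con (Con.cases σ τ ρ) ⬝ f ⬝ g ⬝ t
abbrev zeroT : Tm Γ Ty.nat := Tm.con Con.zero
abbrev succT (t : Tm Γ Ty.nat) : Tm Γ Ty.nat := Tm.con Con.succ ⬝ t
abbrev recT (a : Tm Γ σ) (f : Tm Γ (Ty.nat ⇒ σ ⇒ σ)) (n : Tm Γ Ty.nat) : Tm Γ σ :=
  Tm.con (Con.recur σ) ⬝ a ⬝ f ⬝ n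
end

/-! ## Derivability -/

/-- A set of axioms (possibly with free variables). -/
abbrev Axioms : Type := ∀ Γ : Ctx, Fm Γ → Prop

/-- Natural deduction for many-sorted intuitionistic predicate logic with equality,
over a set of axioms `T`: `Prov T Δ φ` says that `φ` is derivable from the hypotheses `Δ`. -/
inductive Prov (T : Axioms) : {Γ : Ctx} → List (Fm Γ) → Fm Γ → Prop
  | ax {Γ : Ctx} {Δ : List (Fm Γ)} {φ : Fm Γ} : T Γ φ → Prov T Δ φ
  | hyp {Γ : Ctx} {Δ : List (Fm Γ)} {φ : Fm Γ} : φ ∈ Δ → Prov T Δ φ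
  | botE {Γ : Ctx} {Δ : List (Fm Γ)} {φ : Fm Γ} : Prov T Δ Fm.bot → Prov T Δ φ
  | andI {Γ : Ctx} {Δ : List (Fm Γ)} {φ ψ : Fm Γ} :
      Prov T Δ φ → Prov T Δ ψ → Prov T Δ (φ ⋏ ψ)
  | andE₁ {Γ : Ctx} {Δ : List (Fm Γ)} {φ ψ : Fm Γ} : Prov T Δ (φ ⋏ ψ) → Prov T Δ φ
  | andE₂ {Γ : Ctx} {Δ : List (Fm Γ)} {φ ψ : Fm Γ} : Prov T Δ (φ ⋏ ψ) → Prov T Δ ψ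
  | orI₁ {Γ : Ctx} {Δ : List (Fm Γ)} {φ ψ : Fm Γ} : Prov T Δ φ → Prov T Δ (φ ⋎ ψ)
  | orI₂ {Γ : Ctx} {Δ : List (Fm Γ)} {φ ψ : Fm Γ} : Prov T Δ ψ → Prov T Δ (φ ⋎ ψ)
  | orE {Γ : Ctx} {Δ : List (Fm Γ)} {φ ψ χ : Fm Γ} :
      Prov T Δ (φ ⋎ ψ) → Prov T (φ :: Δ) χ → Prov T (ψ :: Δ) χ → Prov T Δ χ
  | impI {Γ : Ctx} {Δ : List (Fm Γ)} {φ ψ : Fm Γ} :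
      Prov T (φ :: Δ) ψ → Prov T Δ (φ ⟹ ψ)
  | impE {Γ : Ctx} {Δ : List (Fm Γ)} {φ ψ : Fm Γ} :
      Prov T Δ (φ ⟹ ψ) → Prov T Δ φ → Prov T Δ ψ
  | allI {Γ : Ctx} {Δ : List (Fm Γ)} {σ : Ty} {φ : Fm (σ :: Γ)} :
      Prov T (Δ.map Fm.wk) φ → Prov T Δ (Fm.all σ φ)
  | allE {Γ : Ctx} {Δ : List (Fm Γ)} {σ : Ty} {φ : Fm (σ :: Γ)} (t : Tm Γ σ) :
      Prov T Δ (Fm.all σ φ) → Prov T Δ (φ.inst t)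
  | exI {Γ : Ctx} {Δ : List (Fm Γ)} {σ : Ty} {φ : Fm (σ :: Γ)} (t : Tm Γ σ) :
      Prov T Δ (φ.inst t) → Prov T Δ (Fm.ex σ φ)
  | exE {Γ : Ctx} {Δ : List (Fm Γ)} {σ : Ty} {φ : Fm (σ :: Γ)} {ψ : Fm Γ} :
      Prov T Δ (Fm.ex σ φ) → Prov T (φ :: Δ.map Fm.wk) ψ.wk → Prov T Δ ψ
  | eqI {Γ : Ctx} {Δ : List (Fm Γ)} {σ : Ty} (t : Tm Γ σ) : Prov T Δ (t ≐ t)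
  | eqE {Γ : Ctx} {Δ : List (Fm Γ)} {σ : Ty} {s t : Tm Γ σ} (φ : Fm (σ :: Γ)) :
      Prov T Δ (s ≐ t) → Prov T Δ (φ.inst s) → Prov T Δ (φ.inst t)

/-- Derivability from no hypotheses other than the axioms `T`. -/
abbrev Thm (T : Axioms) {Γ : Ctx} (φ : Fm Γ) : Prop := Prov T [] φ

/-- The non-logical axioms of extensional Heyting arithmetic in all finite types,
with product and sum types. -/
inductive HA : Axioms
  | k {Γ : Ctx} {σ τ : Ty} (a : Tm Γ σ) (b : Tm Γ τ) : HA Γ (K ⬝ a ⬝ b ≐ a)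
  | s {Γ : Ctx} {σ τ ρ : Ty} (a : Tm Γ (σ ⇒ τ ⇒ ρ)) (b : Tm Γ (σ ⇒ τ)) (c : Tm Γ σ) :
      HA Γ (S ⬝ a ⬝ b ⬝ c ≐ a ⬝ c ⬝ (b ⬝ c))
  | fstPair {Γ : Ctx} {σ τ : Ty} (a : Tm Γ σ) (b : Tm Γ τ) : HA Γ (fstT (pairT a b) ≐ a)
  | sndPair {Γ : Ctx} {σ τ : Ty} (a : Tm Γ σ) (b : Tm Γ τ) : HA Γ (sndT (pairT a b) ≐ b)
  | pairEta {Γ : Ctx} {σ τ : Ty} (p : Tm Γ (Ty.prod σ τ)) : HA Γ (pairT (fstT p) (sndT p) ≐ p)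
  | casesInl {Γ : Ctx} {σ τ ρ : Ty} (f : Tm Γ (σ ⇒ ρ)) (g : Tm Γ (τ ⇒ ρ)) (a : Tm Γ σ) :
      HA Γ (casesT f g (inlT a) ≐ f ⬝ a)
  | casesInr {Γ : Ctx} {σ τ ρ : Ty} (f : Tm Γ (σ ⇒ ρ)) (g : Tm Γ (τ ⇒ ρ)) (b : Tm Γ τ) :
      HA Γ (casesT f g (inrT b) ≐ g ⬝ b)
  | sumExhaust {Γ : Ctx} {σ τ : Ty} (p : Tm Γ (Ty.sum σ τ)) :
      HA Γ (Fm.ex σ (p.wk ≐ inlT v0) ⋎ Fm.ex τ (p.wk ≐ inrT v0))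
  | recZero {Γ : Ctx} {σ : Ty} (a : Tm Γ σ) (f : Tm Γ (Ty.nat ⇒ σ ⇒ σ)) :
      HA Γ (recT a f zeroT ≐ a)
  | recSucc {Γ : Ctx} {σ : Ty} (a : Tm Γ σ) (f : Tm Γ (Ty.nat ⇒ σ ⇒ σ)) (n : Tm Γ Ty.nat) :
      HA Γ (recT a f (succT n) ≐ f ⬝ n ⬝ recT a f n)
  | succNeZero {Γ : Ctx} (n : Tm Γ Ty.nat) : HA Γ (Fm.neg (succT n ≐ zeroT))
  | succInj {Γ : Ctx} (m n : Tm Γ Ty.nat) : HA Γ (succT m ≐ succT n ⟹ m ≐ n)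
  | induction {Γ : Ctx} (φ : Fm (Ty.nat :: Γ)) :
      HA Γ (φ.inst zeroT ⟹
        Fm.all Ty.nat (φ ⟹ φ.subst (Sub.cons (succT v0) Sub.shift)) ⟹ Fm.all Ty.nat φ)
  | ext {Γ : Ctx} {σ τ : Ty} (f g : Tm Γ (σ ⇒ τ)) :
      HA Γ (Fm.all σ (f.wk ⬝ v0 ≐ g.wk ⬝ v0) ⟹ f ≐ g)

/-- The pure types `0 = N`, `n + 1 = n → N`. -/
def pureTy : ℕ → Ty
  | 0 => Ty.nat
  | n + 1 => pureTy n ⇒ Ty.nat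

/-- Converse extensionality at level 0 (a formula without free variables, in any context):
`∃ X ∀ Φ² ∀ f¹, g¹ (Φ f ≠ Φ g → f (X Φ f g) ≠ g (X Φ f g))`. -/
def CE₀ {Γ : Ctx} : Fm Γ :=
  Fm.ex (pureTy 2 ⇒ pureTy 1 ⇒ pureTy 1 ⇒ pureTy 0) <|
  Fm.all (pureTy 2) <| Fm.all (pureTy 1) <| Fm.all (pureTy 1) <|
    -- here `X = v3`, `Φ = v2`, `f = v1`, `g = v0`
    Fm.neg (Tm.app (τ := Ty.nat) v2 v1 ≐ Tm.app (τ := Ty.nat) v2 v0) ⟹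
      Fm.neg (Tm.app (σ := Ty.nat) (τ := Ty.nat) v1 (v3 ⬝ v2 ⬝ v1 ⬝ v0) ≐
        Tm.app (σ := Ty.nat) (τ := Ty.nat) v0 (v3 ⬝ v2 ⬝ v1 ⬝ v0))

/-- The axioms of extensional Heyting arithmetic together with `CE₀`. -/
def HAplusCE₀ : Axioms := fun Γ φ => HA Γ φ ∨ φ = CE₀

/-! ## The apartness interpretation -/

mutual
/-- The type `σ⁺` of the objects that interpret objects of type `σ`. -/
def Ty.pos : Ty → Ty
  | Ty.nat => Ty.nat
  | Ty.prod σ τ => Ty.prod σ.pos τ.pos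
  | Ty.sum σ τ => Ty.sum σ.pos τ.pos
  | Ty.arr σ τ => Ty.prod (σ.pos ⇒ τ.pos) (σ.pos ⇒ σ.pos ⇒ τ.neg ⇒ σ.neg)
/-- The type `σ⁻` of the evidence for apartness at type `σ`. -/
def Ty.neg : Ty → Ty
  | Ty.nat => Ty.nat
  | Ty.prod σ τ => Ty.sum σ.neg τ.neg
  | Ty.sum σ τ => Ty.prod σ.neg τ.neg
  | Ty.arr σ τ => Ty.prod σ.pos τ.neg
end

/-- Formulas `D(x)` with `x : σ⁺`. -/
abbrev DomFm (σ : Ty) : Type := Fm [σ.pos]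

/-- Formulas `A(x, y, z)` with `x, y : σ⁺` and `z : σ⁻`, in this order `v0, v1, v2`. -/
abbrev AppFm (σ : Ty) : Type := Fm [σ.pos, σ.pos, σ.neg]

/-- The instance `D(x)`. -/
def DomFm.at {σ : Ty} (D : DomFm σ) {Γ : Ctx} (x : Tm Γ σ.pos) : Fm Γ :=
  Fm.subst (Sub.cons x Sub.nil) D

/-- The instance `A(x, y, z)`. -/
def AppFm.at {σ : Ty} (A : AppFm σ) {Γ : Ctx} (x y : Tm Γ σ.pos) (z : Tm Γ σ.neg) : Fm Γ :=
  Fm.subst (Sub.cons x (Sub.cons y (Sub.cons z Sub.nil))) A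

/-- Application of (the interpretation of) a function to an argument: `(fst f) x`. -/
def appPos {Γ : Ctx} {σ τ : Ty} (f : Tm Γ (σ ⇒ τ).pos) (x : Tm Γ σ.pos) : Tm Γ τ.pos :=
  Tm.app (fstT (σ := σ.pos ⇒ τ.pos) (τ := σ.pos ⇒ σ.pos ⇒ τ.neg ⇒ σ.neg) f) x

/-- The evidence `(snd f) u v w`. -/
def appNeg {Γ : Ctx} {σ τ : Ty} (f : Tm Γ (σ ⇒ τ).pos) (u v : Tm Γ σ.pos) (w : Tm Γ τ.neg) :
    Tm Γ σ.neg :=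
  sndT (σ := σ.pos ⇒ τ.pos) (τ := σ.pos ⇒ σ.pos ⇒ τ.neg ⇒ σ.neg) f ⬝ u ⬝ v ⬝ w

infixl:75 " ⊙ " => appPos

def domNat : DomFm Ty.nat := Fm.eq (σ := Ty.nat) v0 v0

def appNat : AppFm Ty.nat := Fm.neg (Fm.eq (σ := Ty.nat) v0 v1)

section
variable {σ τ : Ty}

/-- `D_σ(fst x) ∧ D_τ(snd x)`. -/
def domProd (Dσ : DomFm σ) (Dτ : DomFm τ) : DomFm (Ty.prod σ τ) :=
  let x : Tm [(Ty.prod σ τ).pos] (Ty.prod σ.pos τ.pos) := v0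
  Dσ.at (fstT x) ⋏ Dτ.at (sndT x)

/-- `(∃ u (z = inl u ∧ A_σ(fst x, fst y, u)) ∨ ∃ v (z = inr v ∧ A_τ(snd x, snd y, v)))
∧ D(x) ∧ D(y)`. -/
def appProd (Dσ : DomFm σ) (Dτ : DomFm τ) (Aσ : AppFm σ) (Aτ : AppFm τ) :
    AppFm (Ty.prod σ τ) :=
  (Fm.ex σ.neg (Fm.eq (σ := Ty.sum σ.neg τ.neg) v3 (inlT v0) ⋏
      Aσ.at (fstT (τ := τ.pos) v1) (fstT (τ := τ.pos) v2) v0) ⋎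
    Fm.ex τ.neg (Fm.eq (σ := Ty.sum σ.neg τ.neg) v3 (inrT v0) ⋏
      Aτ.at (sndT (σ := σ.pos) v1) (sndT (σ := σ.pos) v2) v0)) ⋏
  (domProd Dσ Dτ).at v0 ⋏ (domProd Dσ Dτ).at v1

/-- `∃ u (x = inl u ∧ D_σ(u)) ∨ ∃ v (x = inr v ∧ D_τ(v))`. -/
def domSum (Dσ : DomFm σ) (Dτ : DomFm τ) : DomFm (Ty.sum σ τ) :=
  Fm.ex σ.pos (Fm.eq (σ := Ty.sum σ.pos τ.pos) v1 (inlT v0) ⋏ Dσ.at v0) ⋎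
  Fm.ex τ.pos (Fm.eq (σ := Ty.sum σ.pos τ.pos) v1 (inrT v0) ⋏ Dτ.at v0)

/-- `(∃ u v ((x = inl u ∧ y = inr v) ∨ (x = inr v ∧ y = inl u))
∨ ∃ u v (x = inl u ∧ y = inl v ∧ A_σ(u, v, fst z))
∨ ∃ u v (x = inr u ∧ y = inr v ∧ A_τ(u, v, snd z))) ∧ D(x) ∧ D(y)`.
Under the two quantifiers `u = v1`, `v = v0`, `x = v2`, `y = v3`, `z = v4`. -/
def appSum (Dσ : DomFm σ) (Dτ : DomFm τ) (Aσ : AppFm σ) (Aτ : AppFm τ) :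
    AppFm (Ty.sum σ τ) :=
  (Fm.ex σ.pos (Fm.ex τ.pos
      ((Fm.eq (σ := Ty.sum σ.pos τ.pos) v2 (inlT v1) ⋏
          Fm.eq (σ := Ty.sum σ.pos τ.pos) v3 (inrT v0)) ⋎
        (Fm.eq (σ := Ty.sum σ.pos τ.pos) v2 (inrT v0) ⋏
          Fm.eq (σ := Ty.sum σ.pos τ.pos) v3 (inlT v1)))) ⋎
    Fm.ex σ.pos (Fm.ex σ.pos
      (Fm.eq (σ := Ty.sum σ.pos τ.pos) v2 (inlT v1) ⋏
        Fm.eq (σ := Ty.sum σ.pos τ.pos) v3 (inlT v0) ⋏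
        Aσ.at v1 v0 (fstT (τ := τ.neg) v4))) ⋎
    Fm.ex τ.pos (Fm.ex τ.pos
      (Fm.eq (σ := Ty.sum σ.pos τ.pos) v2 (inrT v1) ⋏
        Fm.eq (σ := Ty.sum σ.pos τ.pos) v3 (inrT v0) ⋏
        Aτ.at v1 v0 (sndT (σ := σ.neg) v4)))) ⋏
  (domSum Dσ Dτ).at v0 ⋏ (domSum Dσ Dτ).at v1

/-- `∀ u (D_σ(u) → D_τ((fst x) u))
∧ ∀ u v w (D_σ(u) → D_σ(v) → A_τ((fst x) u, (fst x) v, w) → A_σ(u, v, (snd x) u v w))`.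
In the second conjunct `u = v2`, `v = v1`, `w = v0`, `x = v3`. -/
def domArr (Dσ : DomFm σ) (Dτ : DomFm τ) (Aσ : AppFm σ) (Aτ : AppFm τ) :
    DomFm (Ty.arr σ τ) :=
  Fm.all σ.pos (Dσ.at v0 ⟹ Dτ.at (appPos (σ := σ) v1 v0)) ⋏
  Fm.all σ.pos (Fm.all σ.pos (Fm.all τ.neg
    (Dσ.at v2 ⟹ Dσ.at v1 ⟹
      Aτ.at (appPos (σ := σ) v3 v2) (appPos (σ := σ) v3 v1) v0 ⟹
        Aσ.at v2 v1 (appNeg (τ := τ) v3 v2 v1 v0))))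

/-- `D_σ(fst z) ∧ A_τ((fst x)(fst z), (fst y)(fst z), snd z) ∧ D(x) ∧ D(y)`. -/
def appArr (Dσ : DomFm σ) (Dτ : DomFm τ) (Aσ : AppFm σ) (Aτ : AppFm τ) :
    AppFm (Ty.arr σ τ) :=
  let z : Tm [(σ ⇒ τ).pos, (σ ⇒ τ).pos, (σ ⇒ τ).neg] (Ty.prod σ.pos τ.neg) := v2
  Dσ.at (fstT z) ⋏
  Aτ.at (appPos (σ := σ) v0 (fstT z)) (appPos (σ := σ) v1 (fstT z)) (sndT z) ⋏
  (domArr Dσ Dτ Aσ Aτ).at v0 ⋏ (domArr Dσ Dτ Aσ Aτ).at v1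
end

/-- Simultaneous recursion for the formulas `dom_σ` and `app_σ`. -/
def domApp : (σ : Ty) → DomFm σ × AppFm σ
  | Ty.nat => (domNat, appNat)
  | Ty.prod σ τ =>
      (domProd (domApp σ).1 (domApp τ).1,
       appProd (domApp σ).1 (domApp τ).1 (domApp σ).2 (domApp τ).2)
  | Ty.sum σ τ =>
      (domSum (domApp σ).1 (domApp τ).1,
       appSum (domApp σ).1 (domApp τ).1 (domApp σ).2 (domApp τ).2)
  | Ty.arr σ τ =>
      (domArr (domApp σ).1 (domApp τ).1 (domApp σ).2 (domApp τ).2,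
       appArr (domApp σ).1 (domApp τ).1 (domApp σ).2 (domApp τ).2)

/-- `dom_σ(x)`. -/
def dom (σ : Ty) {Γ : Ctx} (x : Tm Γ σ.pos) : Fm Γ := (domApp σ).1.at x

/-- `app_σ(x, y, z)`. -/
def apart (σ : Ty) {Γ : Ctx} (x y : Tm Γ σ.pos) (z : Tm Γ σ.neg) : Fm Γ :=
  (domApp σ).2.at x y z

/-- An assignment of a closed term of type `σ⁺` to every constant of type `σ`. -/
abbrev ConInterp : Type := ∀ σ : Ty, Con σ → Tm [] σ.pos

/-- The interpretation of a constant, in an arbitrary context. -/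
def ConInterp.tm (I : ConInterp) {Γ : Ctx} {σ : Ty} (c : Con σ) : Tm Γ σ.pos :=
  (I σ c).subst Sub.nil

/-- The assignment interprets the constants correctly: each constant is interpreted, provably in
extensional Heyting arithmetic, by an element of its domain; and with application interpreted as
`f ⊙ x = (fst f) x`, the constants `0, succ, pair, fst, snd, inl, inr` are interpreted by
themselves, while `k, s, case, R` satisfy their usual defining equations. -/
structure ConInterp.Correct (I : ConInterp) : Prop where
  inDom {σ : Ty} (c : Con σ) : Thm HA (dom σ (I σ c))
  zero : Thm HA (Fm.eq (σ := Ty.nat) (I.tm (Γ := []) Con.zero) zeroT)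
  succ {Γ : Ctx} (n : Tm Γ Ty.nat) :
    Thm HA (Fm.eq (σ := Ty.nat) (appPos (σ := Ty.nat) (I.tm Con.succ) n) (succT n))
  pair {Γ : Ctx} {σ τ : Ty} (x : Tm Γ σ.pos) (y : Tm Γ τ.pos) :
    Thm HA (Fm.eq (σ := Ty.prod σ.pos τ.pos) (I.tm (Con.pair σ τ) ⊙ x ⊙ y) (pairT x y))
  fst {Γ : Ctx} {σ τ : Ty} (p : Tm Γ (Ty.prod σ.pos τ.pos)) :
    Thm HA (appPos (σ := Ty.prod σ τ) (I.tm (Con.fst σ τ)) p ≐ fstT p)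
  snd {Γ : Ctx} {σ τ : Ty} (p : Tm Γ (Ty.prod σ.pos τ.pos)) :
    Thm HA (appPos (σ := Ty.prod σ τ) (I.tm (Con.snd σ τ)) p ≐ sndT p)
  inl {Γ : Ctx} {σ τ : Ty} (x : Tm Γ σ.pos) :
    Thm HA (Fm.eq (σ := Ty.sum σ.pos τ.pos) (I.tm (Con.inl σ τ) ⊙ x) (inlT x))
  inr {Γ : Ctx} {σ τ : Ty} (y : Tm Γ τ.pos) :
    Thm HA (Fm.eq (σ := Ty.sum σ.pos τ.pos) (I.tm (Con.inr σ τ) ⊙ y) (inrT y))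
  k {Γ : Ctx} {σ τ : Ty} (x : Tm Γ σ.pos) (y : Tm Γ τ.pos) :
    Thm HA (I.tm (Con.k σ τ) ⊙ x ⊙ y ≐ x)
  s {Γ : Ctx} {σ τ ρ : Ty} (x : Tm Γ (σ ⇒ τ ⇒ ρ).pos) (y : Tm Γ (σ ⇒ τ).pos)
      (z : Tm Γ σ.pos) :
    Thm HA (I.tm (Con.s σ τ ρ) ⊙ x ⊙ y ⊙ z ≐ x ⊙ z ⊙ (y ⊙ z))
  casesInl {Γ : Ctx} {σ τ ρ : Ty} (f : Tm Γ (σ ⇒ ρ).pos) (g : Tm Γ (τ ⇒ ρ).pos)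
      (x : Tm Γ σ.pos) :
    Thm HA (appPos (σ := Ty.sum σ τ) (I.tm (Con.cases σ τ ρ) ⊙ f ⊙ g)
      (inlT (τ := τ.pos) x) ≐ f ⊙ x)
  casesInr {Γ : Ctx} {σ τ ρ : Ty} (f : Tm Γ (σ ⇒ ρ).pos) (g : Tm Γ (τ ⇒ ρ).pos)
      (y : Tm Γ τ.pos) :
    Thm HA (appPos (σ := Ty.sum σ τ) (I.tm (Con.cases σ τ ρ) ⊙ f ⊙ g)
      (inrT (σ := σ.pos) y) ≐ g ⊙ y)
  recZero {Γ : Ctx} {σ : Ty} (a : Tm Γ σ.pos) (f : Tm Γ (Ty.nat ⇒ σ ⇒ σ).pos) :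
    Thm HA (appPos (σ := Ty.nat) (I.tm (Con.recur σ) ⊙ a ⊙ f) zeroT ≐ a)
  recSucc {Γ : Ctx} {σ : Ty} (a : Tm Γ σ.pos) (f : Tm Γ (Ty.nat ⇒ σ ⇒ σ).pos)
      (n : Tm Γ Ty.nat) :
    Thm HA (appPos (σ := Ty.nat) (I.tm (Con.recur σ) ⊙ a ⊙ f) (succT n) ≐
      appPos (σ := Ty.nat) f n ⊙ appPos (σ := Ty.nat) (I.tm (Con.recur σ) ⊙ a ⊙ f) n)

/-- A variable of type `σ` is interpreted by the corresponding variable of type `σ⁺`. -/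
def Var.alpha : {Γ : Ctx} → {σ : Ty} → Var Γ σ → Var (Γ.map Ty.pos) σ.pos
  | _, _, Var.here => Var.here
  | _, _, Var.there v => Var.there v.alpha

/-- The interpretation of terms. -/
def Tm.alpha (I : ConInterp) {Γ : Ctx} : {σ : Ty} → Tm Γ σ → Tm (Γ.map Ty.pos) σ.pos
  | _, Tm.var v => Tm.var v.alpha
  | _, Tm.con c => I.tm c
  | _, Tm.app t u => t.alpha I ⊙ u.alpha I

/-- The interpretation `α` of formulas: it commutes with the connectives, relativizes quantifiers
over `σ` to `dom_σ`, and interprets `s = t` as `¬ ∃ z, app_σ(s, t, z)`. -/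
def Fm.alpha (I : ConInterp) : {Γ : Ctx} → Fm Γ → Fm (Γ.map Ty.pos)
  | _, Fm.bot => Fm.bot
  | _, Fm.eq (σ := σ) s t =>
      Fm.neg (Fm.ex σ.neg (apart σ (s.alpha I).wk (t.alpha I).wk v0))
  | _, Fm.and φ ψ => φ.alpha I ⋏ ψ.alpha I
  | _, Fm.or φ ψ => φ.alpha I ⋎ ψ.alpha I
  | _, Fm.imp φ ψ => φ.alpha I ⟹ ψ.alpha I
  | _, Fm.all σ φ => Fm.all σ.pos (dom σ v0 ⟹ φ.alpha I)
  | _, Fm.ex σ φ => Fm.ex σ.pos (dom σ v0 ⋏ φ.alpha I)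

end EHA

-- An interpreted function carries, besides its values, an operation that turns evidence of a
-- difference between two values into evidence of a difference between the arguments. Evidence
-- locates a difference: at a function type it is an argument together with evidence about the
-- values there. Interpreted equality is the absence of evidence.
--
-- Apartness is irreflexive, symmetric and cotransitive, and an explicit term `cmpT` decides which
-- alternative of cotransitivity the given evidence supports (`cmpT_spec`). Cotransitivity makes
-- interpreted equality transitive and a congruence for application (`Eqv.trans`, `Eqv.appP`), which
-- yields Leibniz's law for all interpreted formulas (`ForcesA.congr`). Extensionality holds because
-- evidence against `f = g` names an argument in the domain (`Eqv.ext`). The decision term is also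
-- needed for the constants `s` and `R`: where a value changes for two reasons at once, it tells
-- which of them to trace back.
--
-- For converse extensionality, the second component of `Φ` turns `Φ f ≠ Φ g` into some `n` with `f
-- n ≠ g n`. This `n` may depend on how `Φ`, `f`, `g` are represented, so it is used only as a bound
-- for the search for the first difference of `f` and `g`; if `Φ f = Φ g` the witness is `0`. The
-- result is determined by a few values of `Φ`, `f`, `g` (`ceO_eq`), so a difference between two
-- results can be traced effectively to a difference between the arguments. This puts the witness
-- itself in its domain (`D_ceC`).
--
-- Formal derivations are avoided by completeness. The worlds of the canonical model are prime
-- theories of `HA` in arbitrary contexts, the morphisms are truth-preserving substitutions, and the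
-- objects are terms modulo provable equality. A formula forced in every world under every valuation
-- is a theorem (`thm_of_forces`), so the argument inside arithmetic becomes reasoning about objects
-- of a world. Implication and universal quantification look at later worlds, and disjunction is
-- decided by primeness. An existential need not have a witness in its own world and can be
-- eliminated only into a forced formula; this is why witnesses are given by explicit terms
-- throughout.

attribute [reducible] EHA.Ty.pos EHA.Ty.neg

namespace EHA

/-! ## Substitution calculus -/

/-- Composition of substitutions. -/
def Sub.comp {Γ Δ Ξ : Ctx} (θ : Sub Γ Δ) (η : Sub Δ Ξ) : Sub Γ Ξ := fun σ v => (θ σ v).subst η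

theorem Tm.subst_subst {Γ Δ Ξ : Ctx} (θ : Sub Γ Δ) (η : Sub Δ Ξ) {σ : Ty} (t : Tm Γ σ) :
    (t.subst θ).subst η = t.subst (θ.comp η) := by
  induction t with
  | var v => rfl
  | con c => rfl
  | app t u iht ihu => simp only [Tm.subst, iht, ihu]

theorem Tm.subst_id {Γ : Ctx} {σ : Ty} (t : Tm Γ σ) : t.subst Sub.id = t := by
  induction t with
  | var v => rfl
  | con c => rfl
  | app t u iht ihu => simp only [Tm.subst, iht, ihu]

theorem Sub.cons_comp {Γ Δ Ξ : Ctx} {τ : Ty} (t : Tm Δ τ) (θ : Sub Γ Δ) (η : Sub Δ Ξ) :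
    (Sub.cons t θ).comp η = Sub.cons (t.subst η) (θ.comp η) := by
  funext σ v; cases v <;> rfl

theorem Sub.cons_here {Γ Δ : Ctx} {τ : Ty} (t : Tm Δ τ) (θ : Sub Γ Δ) :
    Sub.cons t θ τ Var.here = t := rfl

theorem Sub.shift_comp_cons {Γ Δ : Ctx} {τ : Ty} (t : Tm Δ τ) (θ : Sub Γ Δ) :
    Sub.shift.comp (Sub.cons t θ) = θ := rfl

theorem Sub.id_comp {Γ Δ : Ctx} (θ : Sub Γ Δ) : Sub.id.comp θ = θ := rfl

theorem Sub.comp_id {Γ Δ : Ctx} (θ : Sub Γ Δ) : θ.comp Sub.id = θ := by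
  funext σ v; exact Tm.subst_id _

theorem Sub.comp_assoc {Γ Δ Ξ Ω : Ctx} (θ : Sub Γ Δ) (η : Sub Δ Ξ) (ζ : Sub Ξ Ω) :
    (θ.comp η).comp ζ = θ.comp (η.comp ζ) := by
  funext σ v; exact Tm.subst_subst _ _ _

theorem Sub.lift_eq {Γ Δ : Ctx} {τ : Ty} (θ : Sub Γ Δ) :
    (Sub.lift θ : Sub (τ :: Γ) (τ :: Δ)) = Sub.cons v0 (θ.comp Sub.shift) := rfl

theorem Sub.cons_shift {Γ : Ctx} {τ : Ty} :
    (Sub.cons v0 Sub.shift : Sub (τ :: Γ) (τ :: Γ)) = Sub.id := by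
  funext σ v; cases v <;> rfl

theorem Sub.lift_id {Γ : Ctx} {τ : Ty} : (Sub.lift Sub.id : Sub (τ :: Γ) (τ :: Γ)) = Sub.id := by
  rw [Sub.lift_eq, Sub.id_comp, Sub.cons_shift]

theorem Sub.lift_comp_cons {Γ Δ Ξ : Ctx} {τ : Ty} (θ : Sub Γ Δ) (t : Tm Ξ τ) (η : Sub Δ Ξ) :
    θ.lift.comp (Sub.cons t η) = Sub.cons t (θ.comp η) := by
  rw [Sub.lift_eq, Sub.cons_comp, Sub.comp_assoc, Sub.shift_comp_cons]; rfl

theorem Sub.lift_comp {Γ Δ Ξ : Ctx} {τ : Ty} (θ : Sub Γ Δ) (η : Sub Δ Ξ) :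
    (θ.lift.comp η.lift : Sub (τ :: Γ) (τ :: Ξ)) = (θ.comp η).lift := by
  rw [Sub.lift_eq η, Sub.lift_comp_cons, Sub.lift_eq, Sub.comp_assoc]

theorem Fm.subst_subst {Γ : Ctx} (φ : Fm Γ) : ∀ {Δ Ξ : Ctx} (θ : Sub Γ Δ) (η : Sub Δ Ξ),
    (φ.subst θ).subst η = φ.subst (θ.comp η) := by
  induction φ with
  | bot => intros; rfl
  | eq s t => intros; simp only [Fm.subst, Tm.subst_subst]
  | and φ ψ h₁ h₂ => intros; simp only [Fm.subst, h₁, h₂]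
  | or φ ψ h₁ h₂ => intros; simp only [Fm.subst, h₁, h₂]
  | imp φ ψ h₁ h₂ => intros; simp only [Fm.subst, h₁, h₂]
  | all σ φ h => intros; simp only [Fm.subst, h, Sub.lift_comp]
  | ex σ φ h => intros; simp only [Fm.subst, h, Sub.lift_comp]

theorem Fm.subst_id {Γ : Ctx} (φ : Fm Γ) : φ.subst Sub.id = φ := by
  induction φ with
  | bot => rfl
  | eq s t => simp only [Fm.subst, Tm.subst_id]
  | and φ ψ h₁ h₂ => simp only [Fm.subst, h₁, h₂]
  | or φ ψ h₁ h₂ => simp only [Fm.subst, h₁, h₂]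
  | imp φ ψ h₁ h₂ => simp only [Fm.subst, h₁, h₂]
  | all σ φ h => simp only [Fm.subst, Sub.lift_id, h]
  | ex σ φ h => simp only [Fm.subst, Sub.lift_id, h]

theorem Tm.wk_subst_cons {Γ Δ : Ctx} {σ τ : Ty} (t : Tm Γ σ) (u : Tm Δ τ) (θ : Sub Γ Δ) :
    t.wk.subst (Sub.cons u θ) = t.subst θ := by
  rw [Tm.wk, Tm.subst_subst, Sub.shift_comp_cons]

theorem Tm.wk_subst_lift {Γ Δ : Ctx} {σ τ : Ty} (t : Tm Γ σ) (θ : Sub Γ Δ) :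
    (t.wk : Tm (τ :: Γ) σ).subst θ.lift = (t.subst θ).wk := by
  rw [Sub.lift_eq, Tm.wk_subst_cons, Tm.wk, Tm.subst_subst]

theorem Fm.wk_subst_cons {Γ Δ : Ctx} {τ : Ty} (φ : Fm Γ) (u : Tm Δ τ) (θ : Sub Γ Δ) :
    φ.wk.subst (Sub.cons u θ) = φ.subst θ := by
  rw [Fm.wk, Fm.subst_subst, Sub.shift_comp_cons]

theorem Fm.wk_subst_lift {Γ Δ : Ctx} {τ : Ty} (φ : Fm Γ) (θ : Sub Γ Δ) :
    (φ.wk : Fm (τ :: Γ)).subst θ.lift = (φ.subst θ).wk := by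
  rw [Sub.lift_eq, Fm.wk_subst_cons, Fm.wk, Fm.subst_subst]

theorem Fm.subst_lift_inst {Γ Δ : Ctx} {τ : Ty} (φ : Fm (τ :: Γ)) (θ : Sub Γ Δ) (t : Tm Δ τ) :
    (φ.subst θ.lift).inst t = φ.subst (Sub.cons t θ) := by
  rw [Fm.inst, Fm.subst_subst, Sub.lift_comp_cons, Sub.comp_id]

theorem Fm.inst_subst {Γ Δ : Ctx} {τ : Ty} (φ : Fm (τ :: Γ)) (θ : Sub Γ Δ) (t : Tm Γ τ) :
    (φ.inst t).subst θ = (φ.subst θ.lift).inst (t.subst θ) := by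
  rw [Fm.subst_lift_inst, Fm.inst, Fm.subst_subst, Sub.cons_comp, Sub.id_comp]

/-! ## Admissible rules -/

theorem Prov.weaken {T : Axioms} {Γ : Ctx} {Δ : List (Fm Γ)} {φ : Fm Γ} (h : Prov T Δ φ) :
    ∀ {Δ' : List (Fm Γ)}, (∀ ψ ∈ Δ, ψ ∈ Δ') → Prov T Δ' φ := by
  have hc : ∀ {Γ : Ctx} {Δ Δ' : List (Fm Γ)} (χ : Fm Γ), (∀ ψ ∈ Δ, ψ ∈ Δ') →
      ∀ ψ ∈ χ :: Δ, ψ ∈ χ :: Δ' := by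
    intro Γ Δ Δ' χ hs ψ hψ
    simp only [List.mem_cons] at hψ ⊢
    exact hψ.imp_right (hs ψ)
  have hm : ∀ {Γ : Ctx} {Δ Δ' : List (Fm Γ)} (τ : Ty), (∀ ψ ∈ Δ, ψ ∈ Δ') →
      ∀ ψ ∈ Δ.map (Fm.wk (τ := τ)), ψ ∈ Δ'.map (Fm.wk (τ := τ)) := by
    intro Γ Δ Δ' τ hs ψ hψ
    simp only [List.mem_map] at hψ ⊢
    obtain ⟨χ, hχ, rfl⟩ := hψ
    exact ⟨χ, hs χ hχ, rfl⟩
  induction h with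
  | ax h => exact fun _ => .ax h
  | hyp h => exact fun hs => .hyp (hs _ h)
  | botE _ ih => exact fun hs => .botE (ih hs)
  | andI _ _ ih₁ ih₂ => exact fun hs => .andI (ih₁ hs) (ih₂ hs)
  | andE₁ _ ih => exact fun hs => .andE₁ (ih hs)
  | andE₂ _ ih => exact fun hs => .andE₂ (ih hs)
  | orI₁ _ ih => exact fun hs => .orI₁ (ih hs)
  | orI₂ _ ih => exact fun hs => .orI₂ (ih hs)
  | orE _ _ _ ih ih₁ ih₂ => exact fun hs => .orE (ih hs) (ih₁ (hc _ hs)) (ih₂ (hc _ hs))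
  | impI _ ih => exact fun hs => .impI (ih (hc _ hs))
  | impE _ _ ih₁ ih₂ => exact fun hs => .impE (ih₁ hs) (ih₂ hs)
  | allI _ ih => exact fun hs => .allI (ih (hm _ hs))
  | allE t _ ih => exact fun hs => .allE t (ih hs)
  | exI t _ ih => exact fun hs => .exI t (ih hs)
  | exE _ _ ih₁ ih₂ => exact fun hs => .exE (ih₁ hs) (ih₂ (hc _ (hm _ hs)))
  | eqI t => exact fun _ => .eqI t
  | eqE φ _ _ ih₁ ih₂ => exact fun hs => .eqE φ (ih₁ hs) (ih₂ hs)

theorem HA.subst {Γ Δ : Ctx} {φ : Fm Γ} (h : HA Γ φ) (θ : Sub Γ Δ) : HA Δ (φ.subst θ) := by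
  cases h with
  | k a b => exact .k _ _
  | s a b c => exact .s _ _ _
  | fstPair a b => exact .fstPair _ _
  | sndPair a b => exact .sndPair _ _
  | pairEta p => exact .pairEta _
  | casesInl f g a => exact .casesInl _ _ _
  | casesInr f g a => exact .casesInr _ _ _
  | sumExhaust p =>
    have := HA.sumExhaust (p.subst θ)
    rw [← Tm.wk_subst_lift, ← Tm.wk_subst_lift] at this
    exact this
  | recZero a f => exact .recZero _ _
  | recSucc a f n => exact .recSucc _ _ _
  | succNeZero n => exact .succNeZero _
  | succInj m n => exact .succInj _ _
  | induction φ =>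
    have := HA.induction (φ.subst θ.lift)
    have e : (φ.subst θ.lift).subst (Sub.cons (succT v0) Sub.shift) =
        (φ.subst (Sub.cons (succT v0) Sub.shift)).subst θ.lift := by
      rw [Fm.subst_subst, Fm.subst_subst, Sub.lift_comp_cons, Sub.cons_comp]; rfl
    rw [e] at this
    simp only [Fm.subst, Fm.inst_subst]
    exact this
  | ext f g =>
    have := HA.ext (f.subst θ) (g.subst θ)
    rw [← Tm.wk_subst_lift, ← Tm.wk_subst_lift] at this
    exact this

theorem map_wk_subst_lift {Γ Γ' : Ctx} {τ : Ty} (Δ : List (Fm Γ)) (θ : Sub Γ Γ') :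
    (Δ.map (Fm.wk (τ := τ))).map (Fm.subst θ.lift) = (Δ.map (Fm.subst θ)).map Fm.wk := by
  simp only [List.map_map]
  exact List.map_congr_left fun φ _ => Fm.wk_subst_lift φ θ

/-- The axioms are schemes closed under substitution (`HA.subst`), and the eigenvariable rules pass
through because weakening commutes with lifted substitutions. -/
theorem Prov.subst {Γ : Ctx} {Δ : List (Fm Γ)} {φ : Fm Γ} (h : Prov HA Δ φ) :
    ∀ {Γ' : Ctx} (θ : Sub Γ Γ'), Prov HA (Δ.map (Fm.subst θ)) (φ.subst θ) := by
  induction h with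
  | ax h => exact fun θ => .ax (h.subst θ)
  | hyp h => exact fun θ => .hyp (List.mem_map_of_mem h)
  | botE _ ih => exact fun θ => .botE (ih θ)
  | andI _ _ ih₁ ih₂ => exact fun θ => .andI (ih₁ θ) (ih₂ θ)
  | andE₁ _ ih => exact fun θ => .andE₁ (ih θ)
  | andE₂ _ ih => exact fun θ => .andE₂ (ih θ)
  | orI₁ _ ih => exact fun θ => .orI₁ (ih θ)
  | orI₂ _ ih => exact fun θ => .orI₂ (ih θ)
  | orE _ _ _ ih ih₁ ih₂ => exact fun θ => .orE (ih θ) (ih₁ θ) (ih₂ θ)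
  | impI _ ih => exact fun θ => .impI (ih θ)
  | impE _ _ ih₁ ih₂ => exact fun θ => .impE (ih₁ θ) (ih₂ θ)
  | allI _ ih =>
    intro _ θ
    refine .allI ?_
    rw [← map_wk_subst_lift]
    exact ih θ.lift
  | allE t _ ih =>
    intro _ θ
    rw [Fm.inst_subst]
    exact .allE _ (ih θ)
  | exI t _ ih =>
    intro _ θ
    refine .exI (t.subst θ) ?_
    rw [← Fm.inst_subst]
    exact ih θ
  | exE _ _ ih₁ ih₂ =>
    intro _ θ
    refine .exE (ih₁ θ) ?_
    rw [← map_wk_subst_lift, ← Fm.wk_subst_lift]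
    exact ih₂ θ.lift
  | eqI t => exact fun θ => .eqI _
  | eqE φ _ _ ih₁ ih₂ =>
    intro _ θ
    rw [Fm.inst_subst]
    refine .eqE _ (ih₁ θ) ?_
    rw [← Fm.inst_subst]
    exact ih₂ θ

theorem Prov.cons {T : Axioms} {Γ : Ctx} {Δ : List (Fm Γ)} {φ : Fm Γ} (ψ : Fm Γ)
    (h : Prov T Δ φ) : Prov T (ψ :: Δ) φ :=
  h.weaken fun _ h => List.mem_cons_of_mem _ h

theorem Prov.wk {Γ : Ctx} {Δ : List (Fm Γ)} {φ : Fm Γ} {τ : Ty} (h : Prov HA Δ φ) :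
    Prov HA (Δ.map (Fm.wk (τ := τ))) φ.wk := h.subst _

theorem Fm.inst_lift_shift {Γ : Ctx} {τ : Ty} (φ : Fm (τ :: Γ)) :
    (φ.subst (Sub.lift Sub.shift)).inst v0 = φ := by
  rw [Fm.subst_lift_inst, Sub.cons_shift, Fm.subst_id]

theorem Prov.allE_var {Γ : Ctx} {Δ : List (Fm Γ)} {τ : Ty} {φ : Fm (τ :: Γ)}
    (h : Prov HA Δ (Fm.all τ φ)) : Prov HA (Δ.map Fm.wk) φ := by
  have := Prov.allE v0 (h.wk (τ := τ))
  rwa [Fm.inst_lift_shift] at this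

theorem Prov.exI_var {Γ : Ctx} {τ : Ty} {Δ : List (Fm (τ :: Γ))} {φ : Fm (τ :: Γ)}
    (h : Prov HA Δ φ) : Prov HA Δ (Fm.ex τ φ).wk := by
  refine Prov.exI v0 ?_
  rw [Fm.inst_lift_shift]
  exact h

theorem Prov.eqSymm {T : Axioms} {Γ : Ctx} {Δ : List (Fm Γ)} {σ : Ty} {s t : Tm Γ σ}
    (h : Prov T Δ (s ≐ t)) : Prov T Δ (t ≐ s) := by
  have := Prov.eqE (v0 ≐ s.wk) h (by
    simpa only [Fm.inst, Fm.subst, Tm.subst, Sub.cons_here, Tm.wk_subst_cons, Tm.subst_id] using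
        Prov.eqI s)
  simpa only [Fm.inst, Fm.subst, Tm.subst, Sub.cons_here, Tm.wk_subst_cons, Tm.subst_id] using this

theorem Prov.eqTrans {T : Axioms} {Γ : Ctx} {Δ : List (Fm Γ)} {σ : Ty} {s t u : Tm Γ σ}
    (h : Prov T Δ (s ≐ t)) (h' : Prov T Δ (t ≐ u)) : Prov T Δ (s ≐ u) := by
  have := Prov.eqE (s.wk ≐ v0) h' (by
    simpa only [Fm.inst, Fm.subst, Tm.subst, Sub.cons_here, Tm.wk_subst_cons, Tm.subst_id] using h)
  simpa only [Fm.inst, Fm.subst, Tm.subst, Sub.cons_here, Tm.wk_subst_cons, Tm.subst_id] using this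

theorem Prov.eqApp {T : Axioms} {Γ : Ctx} {Δ : List (Fm Γ)} {σ τ : Ty} {f g : Tm Γ (σ ⇒ τ)}
    {s t : Tm Γ σ} (hf : Prov T Δ (f ≐ g)) (hs : Prov T Δ (s ≐ t)) :
    Prov T Δ (f ⬝ s ≐ g ⬝ t) := by
  have h₁ := Prov.eqE ((f ⬝ s).wk ≐ v0 ⬝ s.wk) hf (by
    simpa only [Fm.inst, Fm.subst, Tm.subst, Sub.cons_here, Tm.wk_subst_cons, Tm.subst_id] using
      Prov.eqI (f ⬝ s))
  have h₂ := Prov.eqE ((f ⬝ s).wk ≐ g.wk ⬝ v0) hs (by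
    simpa only [Fm.inst, Fm.subst, Tm.subst, Sub.cons_here, Tm.wk_subst_cons, Tm.subst_id] using h₁)
  simpa only [Fm.inst, Fm.subst, Tm.subst, Sub.cons_here, Tm.wk_subst_cons, Tm.subst_id] using h₂

theorem Prov.eqSubst {T : Axioms} {Γ Γ' : Ctx} {Δ : List (Fm Γ')} {θ θ' : Sub Γ Γ'}
    (h : ∀ σ v, Prov T Δ (θ σ v ≐ θ' σ v)) {σ : Ty} (t : Tm Γ σ) :
    Prov T Δ (t.subst θ ≐ t.subst θ') := by
  induction t with
  | var v => exact h _ v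
  | con c => exact .eqI _
  | app t u iht ihu => exact .eqApp iht ihu

theorem Prov.eqLift {Γ Γ' : Ctx} {Δ : List (Fm Γ')} {θ θ' : Sub Γ Γ'} {τ : Ty}
    (h : ∀ σ v, Prov HA Δ (θ σ v ≐ θ' σ v)) (σ : Ty) (v : Var (τ :: Γ) σ) :
    Prov HA (Δ.map Fm.wk) (θ.lift σ v ≐ θ'.lift σ v) := by
  cases v with
  | here => exact .eqI _
  | there v => exact (h _ v).wk

/-- Simultaneous replacement, where `eqE` handles one variable at a time. It is what makes truth
independent of the terms chosen to represent objects. The implication case needs the symmetric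
statement, hence the arbitrary pair `θ`, `θ'` in the induction. -/
theorem Prov.congr {Γ : Ctx} (φ : Fm Γ) : ∀ {Γ' : Ctx} {Δ : List (Fm Γ')} {θ θ' : Sub Γ Γ'},
    (∀ σ v, Prov HA Δ (θ σ v ≐ θ' σ v)) → Prov HA Δ (φ.subst θ) → Prov HA Δ (φ.subst θ') := by
  induction φ with
  | bot => exact fun _ h => h
  | eq s t => exact fun h h' => ((Prov.eqSubst h s).eqSymm.eqTrans h').eqTrans (Prov.eqSubst h t)
  | and φ ψ h₁ h₂ => exact fun h h' => .andI (h₁ h h'.andE₁) (h₂ h h'.andE₂)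
  | or φ ψ h₁ h₂ =>
    exact fun h h' => .orE h' (.orI₁ (h₁ (fun σ v => (h σ v).cons _) (.hyp (by simp))))
      (.orI₂ (h₂ (fun σ v => (h σ v).cons _) (.hyp (by simp))))
  | imp φ ψ h₁ h₂ =>
    exact fun h h' => .impI (h₂ (fun σ v => (h σ v).cons _)
      (.impE (h'.cons _) (h₁ (fun σ v => (h σ v).eqSymm.cons _) (.hyp (by simp)))))
  | all σ φ ih => exact fun h h' => .allI (ih (Prov.eqLift h) (Prov.allE_var h'))
  | ex σ φ ih =>
    exact fun h h' => .exE h' (Prov.exI_var (ih (fun σ v => (Prov.eqLift h σ v).cons _)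
      (.hyp (by simp))))

end EHA

namespace EHA

/-! ## Prime theories -/

/-- Derivability in `HA` from a set of hypotheses. -/
def Entails {Γ : Ctx} (S : Set (Fm Γ)) (φ : Fm Γ) : Prop :=
  ∃ Δ : List (Fm Γ), (∀ ψ ∈ Δ, ψ ∈ S) ∧ Prov HA Δ φ

theorem Entails.of_mem {Γ : Ctx} {S : Set (Fm Γ)} {φ : Fm Γ} (h : φ ∈ S) : Entails S φ :=
  ⟨[φ], by simpa using h, .hyp (by simp)⟩

theorem Entails.cut {Γ : Ctx} {S : Set (Fm Γ)} (Δ : List (Fm Γ)) {φ : Fm Γ}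
    (hΔ : ∀ ψ ∈ Δ, Entails S ψ) (h : Prov HA Δ φ) : Entails S φ := by
  induction Δ generalizing φ with
  | nil => exact ⟨[], by simp, h⟩
  | cons ψ Δ ih =>
    obtain ⟨Δ₁, h₁, p₁⟩ := ih (fun χ hχ => hΔ χ (List.mem_cons_of_mem _ hχ)) (.impI h)
    obtain ⟨Δ₂, h₂, p₂⟩ := hΔ ψ (by simp)
    refine ⟨Δ₁ ++ Δ₂, ?_, .impE (p₁.weaken (by simp +contextual))
      (p₂.weaken (by simp +contextual))⟩
    intro χ hχ
    exact (List.mem_append.mp hχ).elim (h₁ χ) (h₂ χ)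

theorem Entails.imp {Γ : Ctx} {S : Set (Fm Γ)} {φ ψ : Fm Γ} (h : Entails (insert φ S) ψ) :
    Entails S (φ ⟹ ψ) := by
  classical
  obtain ⟨Δ, hΔ, hp⟩ := h
  -- The list may contain `φ` any number of times; all copies are discharged together.
  refine ⟨Δ.filter (· ≠ φ), ?_, .impI (hp.weaken ?_)⟩
  · intro χ hχ
    simp only [List.mem_filter, decide_eq_true_eq] at hχ
    exact (hΔ χ hχ.1).resolve_left hχ.2
  · intro χ hχ
    by_cases h : χ = φ <;> simp [h, hχ]

/-- Consistent prime deductively closed sets of formulas. -/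
structure PrimeTheory (Γ : Ctx) where
  carrier : Set (Fm Γ)
  closed : ∀ (Δ : List (Fm Γ)) (φ : Fm Γ), (∀ ψ ∈ Δ, ψ ∈ carrier) → Prov HA Δ φ → φ ∈ carrier
  prime : ∀ φ ψ : Fm Γ, (φ ⋎ ψ) ∈ carrier → φ ∈ carrier ∨ ψ ∈ carrier
  consistent : Fm.bot ∉ carrier

/-- Zorn's lemma for the sets that do not entail `χ`; unions of chains are admissible because
derivations use finitely many hypotheses. Whatever is missing from a maximal set implies `χ` over
it. So a missing consequence, a disjunction with both disjuncts missing, or falsity would each give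
a derivation of `χ`. -/
theorem exists_primeTheory {Γ : Ctx} (S : Set (Fm Γ)) (χ : Fm Γ) (h : ¬ Entails S χ) :
    ∃ T : PrimeTheory Γ, S ⊆ T.carrier ∧ χ ∉ T.carrier := by
  obtain ⟨M, hSM, hM⟩ := zorn_subset_nonempty {S' : Set (Fm Γ) | ¬ Entails S' χ} (by
    intro c hc hchain hne
    refine ⟨⋃₀ c, ?_, fun s hs => Set.subset_sUnion_of_mem hs⟩
    rintro ⟨Δ, hΔ, hp⟩
    have : ∃ s ∈ c, ∀ ψ ∈ Δ, ψ ∈ s := by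
      clear hp
      induction Δ with
      | nil => exact ⟨_, hne.some_mem, by simp⟩
      | cons ψ Δ ih =>
        obtain ⟨s, hs, hs'⟩ := ih fun χ hχ => hΔ χ (List.mem_cons_of_mem _ hχ)
        obtain ⟨t, ht, ht'⟩ := hΔ ψ (by simp)
        rcases hchain.total hs ht with hst | hts
        · exact ⟨t, ht, by simpa using ⟨ht', fun χ hχ => hst (hs' χ hχ)⟩⟩
        · exact ⟨s, hs, by simpa using ⟨hts ht', hs'⟩⟩
    obtain ⟨s, hs, hs'⟩ := this
    exact hc hs ⟨Δ, hs', hp⟩) S h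
  have hM' : ¬ Entails M χ := hM.prop
  have hins : ∀ φ, φ ∉ M → Entails M (φ ⟹ χ) := by
    intro φ hφ
    by_contra hn
    exact hφ (hM.le_of_ge (y := insert φ M) (fun h => hn (Entails.imp h))
      (Set.subset_insert _ _) (Set.mem_insert _ _))
  have hcl : ∀ φ, Entails M φ → φ ∈ M := by
    intro φ hφ
    by_contra hn
    exact hM' (Entails.cut [φ ⟹ χ, φ] (by simpa using ⟨hins φ hn, hφ⟩)
      (.impE (φ := φ) (.hyp (by simp)) (.hyp (by simp))))
  refine ⟨⟨M, fun Δ φ hΔ hp => hcl φ ⟨Δ, hΔ, hp⟩, ?_, ?_⟩, hSM, fun h => hM' (.of_mem h)⟩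
  · intro φ ψ h
    by_contra hn
    rw [not_or] at hn
    refine hM' (Entails.cut [φ ⟹ χ, ψ ⟹ χ, φ ⋎ ψ]
      (by simpa using ⟨hins φ hn.1, hins ψ hn.2, .of_mem h⟩) ?_)
    exact .orE (φ := φ) (ψ := ψ) (.hyp (by simp))
      (.impE (φ := φ) (.hyp (by simp)) (.hyp (by simp)))
      (.impE (φ := ψ) (.hyp (by simp)) (.hyp (by simp)))
  · exact fun h => hM' (Entails.cut [Fm.bot] (by simpa using Entails.of_mem h)
      (.botE (.hyp (by simp))))

/-! ## The canonical model -/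

/-- A world is a prime theory in some context. -/
structure World where
  ctx : Ctx
  th : PrimeTheory ctx

/-- The formulas that hold in a world. -/
def World.Holds (w : World) (φ : Fm w.ctx) : Prop := φ ∈ w.th.carrier

/-- Morphisms of worlds are truth preserving substitutions. -/
structure Hom (w w' : World) where
  sub : Sub w.ctx w'.ctx
  holds : ∀ φ, w.Holds φ → w'.Holds (φ.subst sub)

/-- The identity morphism. -/
def Hom.id (w : World) : Hom w w := ⟨Sub.id, fun φ h => by rwa [Fm.subst_id]⟩

/-- Composition of morphisms. -/
def Hom.comp {w w' w'' : World} (m : Hom w w') (n : Hom w' w'') : Hom w w'' :=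
  ⟨m.sub.comp n.sub, fun φ h => by rw [← Fm.subst_subst]; exact n.holds _ (m.holds _ h)⟩

namespace World
variable {w : World}

theorem holds_of_prov {Δ : List (Fm w.ctx)} {φ : Fm w.ctx} (h : Prov HA Δ φ)
    (hΔ : ∀ ψ ∈ Δ, w.Holds ψ) : w.Holds φ := w.th.closed Δ φ hΔ h

theorem holds_of_thm {φ : Fm w.ctx} (h : Thm HA φ) : w.Holds φ := holds_of_prov h (by simp)

theorem holds_of_ax {φ : Fm w.ctx} (h : HA w.ctx φ) : w.Holds φ := holds_of_thm (.ax h)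

theorem holds_of_prov₁ {φ ψ : Fm w.ctx} (h : Prov HA [φ] ψ) (h₁ : w.Holds φ) : w.Holds ψ :=
  holds_of_prov h (by simpa using h₁)

theorem holds_of_prov₂ {φ φ' ψ : Fm w.ctx} (h : Prov HA [φ, φ'] ψ) (h₁ : w.Holds φ)
    (h₂ : w.Holds φ') : w.Holds ψ :=
  holds_of_prov h (by simpa using ⟨h₁, h₂⟩)

theorem not_holds_bot : ¬ w.Holds Fm.bot := w.th.consistent

theorem holds_and {φ ψ : Fm w.ctx} : w.Holds (φ ⋏ ψ) ↔ w.Holds φ ∧ w.Holds ψ :=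
  ⟨fun h => ⟨holds_of_prov₁ (.andE₁ (ψ := ψ) (.hyp (by simp))) h,
    holds_of_prov₁ (.andE₂ (φ := φ) (.hyp (by simp))) h⟩,
   fun h => holds_of_prov₂ (.andI (.hyp (by simp)) (.hyp (by simp))) h.1 h.2⟩

theorem holds_or {φ ψ : Fm w.ctx} : w.Holds (φ ⋎ ψ) ↔ w.Holds φ ∨ w.Holds ψ :=
  ⟨w.th.prime φ ψ, fun h => h.elim (holds_of_prov₁ (.orI₁ (.hyp (by simp))))
    (holds_of_prov₁ (.orI₂ (.hyp (by simp))))⟩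

/-- An implication that fails is refuted in the same context, by a prime theory that contains the
present one and `φ` but not `ψ`; the identity substitution leads there. -/
theorem holds_of_forall_hom {φ ψ : Fm w.ctx}
    (h : ∀ (w' : World) (m : Hom w w'), w'.Holds (φ.subst m.sub) → w'.Holds (ψ.subst m.sub)) :
    w.Holds (φ ⟹ ψ) := by
  by_contra hn
  obtain ⟨T, hT, hψ⟩ := exists_primeTheory (insert φ w.th.carrier) ψ
    (fun ⟨Δ, hΔ, hp⟩ => hn (by
      obtain ⟨Δ', hΔ', hp'⟩ := Entails.imp ⟨Δ, hΔ, hp⟩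
      exact holds_of_prov hp' hΔ'))
  have := h ⟨w.ctx, T⟩ ⟨Sub.id, fun χ hχ => by
    rw [Fm.subst_id]; exact hT (Set.mem_insert_of_mem _ hχ)⟩
  simp only [Fm.subst_id] at this
  exact hψ (this (hT (Set.mem_insert _ _)))

theorem holds_imp {φ ψ : Fm w.ctx} : w.Holds (φ ⟹ ψ) ↔
    ∀ (w' : World) (m : Hom w w'), w'.Holds (φ.subst m.sub) → w'.Holds (ψ.subst m.sub) :=
  ⟨fun h _ m h' => holds_of_prov₂ (.impE (φ := φ.subst m.sub) (.hyp (by simp [Fm.subst])) (.hyp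
    (by simp)))
    (m.holds _ h) h',
    holds_of_forall_hom⟩

/-- If `ψ` does not follow, after weakening, from the truths of `w` and some other formulas,
then there is a world above `w` with a new element that separates them. -/
theorem exists_hom_of_not_entails {σ : Ty} (S : Set (Fm (σ :: w.ctx))) (ψ : Fm (σ :: w.ctx))
    (h : ¬ Entails (Fm.wk '' w.th.carrier ∪ S) ψ) :
    ∃ (T : PrimeTheory (σ :: w.ctx)) (m : Hom w ⟨σ :: w.ctx, T⟩),
      m.sub = Sub.shift ∧ S ⊆ T.carrier ∧ ψ ∉ T.carrier := by
  obtain ⟨T, hT, hψ⟩ := exists_primeTheory _ ψ h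
  exact ⟨T, ⟨Sub.shift, fun χ hχ => hT (.inl ⟨χ, hχ, rfl⟩)⟩, rfl,
    fun χ hχ => hT (.inr hχ), hψ⟩

theorem exists_list_of_image {σ : Ty} (S : Set (Fm w.ctx)) (Δ : List (Fm (σ :: w.ctx)))
    (h : ∀ ψ ∈ Δ, ψ ∈ Fm.wk '' S) :
    ∃ Δ' : List (Fm w.ctx), (∀ ψ ∈ Δ', ψ ∈ S) ∧ Δ = Δ'.map Fm.wk := by
  induction Δ with
  | nil => exact ⟨[], by simp, rfl⟩
  | cons ψ Δ ih =>
    obtain ⟨Δ', h', rfl⟩ := ih fun χ hχ => h χ (List.mem_cons_of_mem _ hχ)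
    obtain ⟨χ, hχ, rfl⟩ := h ψ (by simp)
    exact ⟨χ :: Δ', by simpa using ⟨hχ, h'⟩, rfl⟩

/-- The counterexample to a universal formula that fails is a fresh variable, in a world whose
context has been enlarged by it. -/
theorem holds_all {σ : Ty} {φ : Fm (σ :: w.ctx)} : w.Holds (Fm.all σ φ) ↔
    ∀ (w' : World) (m : Hom w w') (t : Tm w'.ctx σ), w'.Holds (φ.subst (Sub.cons t m.sub)) := by
  constructor
  · intro h w' m t
    have := holds_of_prov₁ (.allE (φ := φ.subst m.sub.lift) t (.hyp (by simp [Fm.subst])))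
        (m.holds _ h)
    rwa [Fm.subst_lift_inst] at this
  · intro h
    by_contra hn
    obtain ⟨T, m, hm, -, hψ⟩ := exists_hom_of_not_entails (w := w) ∅ φ (by
      rintro ⟨Δ, hΔ, hp⟩
      simp only [Set.union_empty] at hΔ
      obtain ⟨Δ', hΔ', rfl⟩ := exists_list_of_image _ _ hΔ
      exact hn (holds_of_prov (.allI hp) hΔ'))
    have := h _ m v0
    rw [hm, Sub.cons_shift, Fm.subst_id] at this
    exact hψ this

theorem holds_exI {σ : Ty} {φ : Fm (σ :: w.ctx)} (t : Tm w.ctx σ) (h : w.Holds (φ.inst t)) :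
    w.Holds (Fm.ex σ φ) := holds_of_prov₁ (.exI t (.hyp (by simp))) h

/-- Prime theories need not have the existence property, so no witness in `w` is claimed. It is
enough to test `χ` where there is one: if `χ` failed, it would still fail in a world with a generic
witness. -/
theorem holds_exE {σ : Ty} {φ : Fm (σ :: w.ctx)} {χ : Fm w.ctx} (h : w.Holds (Fm.ex σ φ))
    (h' : ∀ (w' : World) (m : Hom w w') (t : Tm w'.ctx σ),
      w'.Holds (φ.subst (Sub.cons t m.sub)) → w'.Holds (χ.subst m.sub)) : w.Holds χ := by
  by_contra hn
  obtain ⟨T, m, hm, hφ, hχ⟩ := exists_hom_of_not_entails (w := w) {φ} χ.wk (by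
    intro he
    rw [Set.union_singleton] at he
    obtain ⟨Δ, hΔ, hp⟩ := Entails.imp he
    obtain ⟨Δ', hΔ', rfl⟩ := exists_list_of_image _ _ hΔ
    refine hn (holds_of_prov (Δ := Fm.ex σ φ :: Δ') (.exE (φ := φ) (.hyp (by simp)) ?_)
      (by simpa using ⟨h, hΔ'⟩))
    exact .impE (hp.weaken (by simp +contextual)) (.hyp (by simp)))
  have := h' _ m v0
  rw [hm, Sub.cons_shift, Fm.subst_id] at this
  exact hχ (this (hφ rfl))

theorem holds_eq_refl {σ : Ty} (t : Tm w.ctx σ) : w.Holds (t ≐ t) := holds_of_thm (.eqI t)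

theorem holds_eq_symm {σ : Ty} {s t : Tm w.ctx σ} (h : w.Holds (s ≐ t)) : w.Holds (t ≐ s) :=
  holds_of_prov₁ (Prov.eqSymm (.hyp (by simp))) h

theorem holds_eq_trans {σ : Ty} {s t u : Tm w.ctx σ} (h : w.Holds (s ≐ t))
    (h' : w.Holds (t ≐ u)) : w.Holds (s ≐ u) :=
  holds_of_prov₂ (Prov.eqTrans (t := t) (.hyp (by simp)) (.hyp (by simp))) h h'

theorem holds_eq_app {σ τ : Ty} {f g : Tm w.ctx (σ ⇒ τ)} {s t : Tm w.ctx σ}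
    (h : w.Holds (f ≐ g)) (h' : w.Holds (s ≐ t)) : w.Holds (f ⬝ s ≐ g ⬝ t) :=
  holds_of_prov₂ (Prov.eqApp (.hyp (by simp)) (.hyp (by simp))) h h'

end World

/-- Provable equality in a world. -/
def World.setoid (w : World) (σ : Ty) : Setoid (Tm w.ctx σ) where
  r s t := w.Holds (s ≐ t)
  iseqv := ⟨World.holds_eq_refl, World.holds_eq_symm, World.holds_eq_trans⟩

/-- The objects of type `σ` in a world: terms up to provable equality. -/
def Obj (w : World) (σ : Ty) : Type := Quotient (w.setoid σ)

namespace Obj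
variable {w w' w'' : World} {σ τ : Ty}

/-- The object denoted by a term. -/
def mk (t : Tm w.ctx σ) : Obj w σ := Quotient.mk (w.setoid σ) t

theorem mk_eq_mk {s t : Tm w.ctx σ} : (mk s = mk t) ↔ w.Holds (s ≐ t) :=
  Quotient.eq (r := w.setoid σ)

theorem exists_rep (x : Obj w σ) : ∃ t, mk t = x := Quotient.exists_rep x

/-- Application of objects. -/
def app : Obj w (σ ⇒ τ) → Obj w σ → Obj w τ :=
  Quotient.map₂ Tm.app fun _ _ h _ _ h' => World.holds_eq_app h h'

/-- Transport of objects along a morphism of worlds. -/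
def map (m : Hom w w') : Obj w σ → Obj w' σ :=
  Quotient.map (Tm.subst m.sub) fun _ _ h => m.holds _ h

theorem map_mk (m : Hom w w') (t : Tm w.ctx σ) : map m (mk t) = mk (t.subst m.sub) := rfl

@[simp]
theorem map_app (m : Hom w w') (f : Obj w (σ ⇒ τ)) (x : Obj w σ) :
    map m (app f x) = app (map m f) (map m x) := by
  obtain ⟨t, rfl⟩ := f.exists_rep; obtain ⟨u, rfl⟩ := x.exists_rep; rfl

@[simp]
theorem map_id (x : Obj w σ) : map (Hom.id w) x = x := by
  obtain ⟨t, rfl⟩ := x.exists_rep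
  rw [map_mk]; exact congrArg mk (Tm.subst_id t)

@[simp]
theorem map_comp (m : Hom w w') (n : Hom w' w'') (x : Obj w σ) :
    map (m.comp n) x = map n (map m x) := by
  obtain ⟨t, rfl⟩ := x.exists_rep
  rw [map_mk, map_mk, map_mk, Tm.subst_subst]; rfl

end Obj

/-- Valuations of the variables of a context. -/
abbrev Env (w : World) (Γ : Ctx) : Type := ∀ σ : Ty, Var Γ σ → Obj w σ

namespace Env
variable {w w' w'' : World} {Γ : Ctx} {σ : Ty}

/-- The empty valuation. -/
def nil : Env w [] := fun _ v => nomatch v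

/-- Extension of a valuation. -/
def cons (a : Obj w σ) (ρ : Env w Γ) : Env w (σ :: Γ)
  | _, Var.here => a
  | _, Var.there v => ρ _ v

/-- Transport of valuations. -/
def map (m : Hom w w') (ρ : Env w Γ) : Env w' Γ := fun σ v => (ρ σ v).map m

/-- The valuation given by a substitution. -/
def ofSub (θ : Sub Γ w.ctx) : Env w Γ := fun σ v => Obj.mk (θ σ v)

theorem exists_rep (ρ : Env w Γ) : ∃ θ, ofSub θ = ρ :=
  ⟨fun σ v => (ρ σ v).exists_rep.choose, by
    funext σ v; exact (ρ σ v).exists_rep.choose_spec⟩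

@[simp] theorem cons_here (a : Obj w σ) (ρ : Env w Γ) : cons a ρ σ Var.here = a := rfl
@[simp] theorem cons_there {τ : Ty} (a : Obj w σ) (ρ : Env w Γ) (v : Var Γ τ) :
    cons a ρ τ (Var.there v) = ρ τ v := rfl

@[simp] theorem map_apply {τ : Ty} (m : Hom w w') (ρ : Env w Γ) (v : Var Γ τ) :
    map m ρ τ v = (ρ τ v).map m := rfl

theorem eq_nil (ρ : Env w []) : ρ = nil := by funext σ v; cases v

@[simp] theorem map_nil (m : Hom w w') : map m (nil : Env w []) = nil := eq_nil _

@[simp] theorem map_cons (m : Hom w w') (a : Obj w σ) (ρ : Env w Γ) :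
    map m (cons a ρ) = cons (a.map m) (map m ρ) := by
  funext τ v; cases v <;> rfl

@[simp] theorem map_id (ρ : Env w Γ) : map (Hom.id w) ρ = ρ := by
  funext τ v; exact Obj.map_id _

@[simp] theorem map_comp (m : Hom w w') (n : Hom w' w'') (ρ : Env w Γ) :
    map (m.comp n) ρ = map n (map m ρ) := by
  funext τ v; exact Obj.map_comp _ _ _

theorem ofSub_cons (t : Tm w.ctx σ) (θ : Sub Γ w.ctx) :
    ofSub (Sub.cons t θ) = cons (Obj.mk t) (ofSub θ) := by
  funext τ v; cases v <;> rfl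

theorem map_ofSub (m : Hom w w') (θ : Sub Γ w.ctx) :
    map m (ofSub θ) = ofSub (θ.comp m.sub) := rfl

end Env

/-- The value of a term. -/
def ev {w : World} {Γ : Ctx} (ρ : Env w Γ) : {σ : Ty} → Tm Γ σ → Obj w σ
  | _, Tm.var v => ρ _ v
  | _, Tm.con c => Obj.mk (Tm.con c)
  | _, Tm.app t u => (ev ρ t).app (ev ρ u)

section
variable {w w' : World} {Γ Γ' : Ctx} {σ τ : Ty}

theorem ev_ofSub (θ : Sub Γ w.ctx) (t : Tm Γ σ) : ev (Env.ofSub θ) t = Obj.mk (t.subst θ) := by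
  induction t with
  | var v => rfl
  | con c => rfl
  | app t u iht ihu => simp only [ev, iht, ihu]; rfl

theorem map_ev (m : Hom w w') (ρ : Env w Γ) (t : Tm Γ σ) :
    (ev ρ t).map m = ev (ρ.map m) t := by
  induction t with
  | var v => rfl
  | con c => rfl
  | app t u iht ihu => simp only [ev, Obj.map_app, iht, ihu]

theorem ev_subst (ρ : Env w Γ') (θ : Sub Γ Γ') (t : Tm Γ σ) :
    ev ρ (t.subst θ) = ev (fun τ v => ev ρ (θ τ v)) t := by
  induction t with
  | var v => rfl
  | con c => rfl
  | app t u iht ihu => simp only [Tm.subst, ev, iht, ihu]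

@[simp] theorem ev_wk (a : Obj w τ) (ρ : Env w Γ) (t : Tm Γ σ) :
    ev (Env.cons a ρ) t.wk = ev ρ t := ev_subst _ _ _

@[simp] theorem ev_nil_subst (ρ : Env w Γ) (t : Tm [] σ) :
    ev ρ (t.subst Sub.nil) = ev Env.nil t := by
  rw [ev_subst]; congr 1; exact Env.eq_nil _

end

-- Forcing, and completeness of the canonical model

/-- Truth of a formula under a valuation. -/
def Forces (w : World) {Γ : Ctx} (ρ : Env w Γ) (φ : Fm Γ) : Prop :=
  w.Holds (φ.subst ρ.exists_rep.choose)

section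
variable {w w' : World} {Γ Γ' : Ctx} {σ τ : Ty}

/-- `Forces` is defined with a chosen representative of the valuation; this shows that any other
choice gives the same truth value. -/
theorem forces_ofSub (θ : Sub Γ w.ctx) (φ : Fm Γ) :
    Forces w (Env.ofSub θ) φ ↔ w.Holds (φ.subst θ) := by
  have key : ∀ θ θ' : Sub Γ w.ctx, Env.ofSub θ = Env.ofSub θ' →
      w.Holds (φ.subst θ) → w.Holds (φ.subst θ') := by
    intro θ θ' h hφ
    by_contra hn
    -- A context has finitely many variables, so finitely many equations true in `w` identify the
    -- two substitutions, and `Prov.congr` can take them as a list of hypotheses.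
    have hall : ∀ (Γ₀ : Ctx) (η η' : Sub Γ₀ w.ctx), Env.ofSub η = Env.ofSub η' →
        ∃ Δ : List (Fm w.ctx), (∀ ψ ∈ Δ, w.Holds ψ) ∧ ∀ σ v, Prov HA Δ (η σ v ≐ η' σ v) := by
      intro Γ₀
      induction Γ₀ with
      | nil => exact fun _ _ _ => ⟨[], by simp, fun σ v => nomatch v⟩
      | cons τ Γ₀ ih =>
        intro η η' h
        obtain ⟨Δ, hΔ, hp⟩ := ih (Sub.shift.comp η) (Sub.shift.comp η') (by
          funext σ v; exact congrFun (congrFun h σ) (Var.there v))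
        refine ⟨(η τ Var.here ≐ η' τ Var.here) :: Δ, ?_, ?_⟩
        · simp only [List.forall_mem_cons]
          exact ⟨Obj.mk_eq_mk.mp (congrFun (congrFun h τ) Var.here), hΔ⟩
        · intro σ v
          cases v with
          | here => exact .hyp (by simp)
          | there v => exact (hp _ v).cons _
    obtain ⟨Δ, hΔ, hp⟩ := hall Γ θ θ' h
    refine hn (World.holds_of_prov (Δ := φ.subst θ :: Δ)
      (Prov.congr φ (fun σ v => (hp σ v).cons _) (.hyp (by simp))) ?_)
    simpa using ⟨hφ, hΔ⟩
  exact ⟨key _ _ (Env.ofSub θ).exists_rep.choose_spec,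
    key _ _ (Env.ofSub θ).exists_rep.choose_spec.symm⟩

theorem Forces.map {ρ : Env w Γ} {φ : Fm Γ} (h : Forces w ρ φ) (m : Hom w w') :
    Forces w' (ρ.map m) φ := by
  obtain ⟨θ, rfl⟩ := ρ.exists_rep
  rw [Env.map_ofSub, forces_ofSub, ← Fm.subst_subst]
  exact m.holds _ ((forces_ofSub _ _).mp h)

theorem forces_subst (ρ : Env w Γ') (θ : Sub Γ Γ') (φ : Fm Γ) :
    Forces w ρ (φ.subst θ) ↔ Forces w (fun τ v => ev ρ (θ τ v)) φ := by
  obtain ⟨η, rfl⟩ := ρ.exists_rep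
  have : (fun τ v => ev (Env.ofSub η) (θ τ v)) = Env.ofSub (θ.comp η) := by
    funext τ v; exact ev_ofSub _ _
  rw [this, forces_ofSub, forces_ofSub, Fm.subst_subst]

theorem forces_inst (ρ : Env w Γ) (φ : Fm (τ :: Γ)) (t : Tm Γ τ) :
    Forces w ρ (φ.inst t) ↔ Forces w (Env.cons (ev ρ t) ρ) φ := by
  rw [Fm.inst, forces_subst]
  have : (fun σ v => ev ρ (Sub.cons t Sub.id σ v)) = Env.cons (ev ρ t) ρ := by
    funext σ v; cases v <;> rfl
  rw [this]

@[simp] theorem forces_bot (ρ : Env w Γ) : ¬ Forces w ρ Fm.bot := World.not_holds_bot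

@[simp] theorem forces_eq (ρ : Env w Γ) (s t : Tm Γ σ) :
    Forces w ρ (s ≐ t) ↔ ev ρ s = ev ρ t := by
  obtain ⟨θ, rfl⟩ := ρ.exists_rep
  rw [forces_ofSub, ev_ofSub, ev_ofSub, Obj.mk_eq_mk]; rfl

@[simp] theorem forces_and (ρ : Env w Γ) (φ ψ : Fm Γ) :
    Forces w ρ (φ ⋏ ψ) ↔ Forces w ρ φ ∧ Forces w ρ ψ := World.holds_and

@[simp] theorem forces_or (ρ : Env w Γ) (φ ψ : Fm Γ) :
    Forces w ρ (φ ⋎ ψ) ↔ Forces w ρ φ ∨ Forces w ρ ψ := World.holds_or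

@[simp] theorem forces_imp (ρ : Env w Γ) (φ ψ : Fm Γ) : Forces w ρ (φ ⟹ ψ) ↔
    ∀ (w' : World) (m : Hom w w'), Forces w' (ρ.map m) φ → Forces w' (ρ.map m) ψ := by
  obtain ⟨θ, rfl⟩ := ρ.exists_rep
  rw [forces_ofSub, Fm.subst, World.holds_imp]
  simp only [Env.map_ofSub, forces_ofSub, Fm.subst_subst]

@[simp] theorem forces_all (ρ : Env w Γ) (φ : Fm (σ :: Γ)) : Forces w ρ (Fm.all σ φ) ↔
    ∀ (w' : World) (m : Hom w w') (a : Obj w' σ), Forces w' (Env.cons a (ρ.map m)) φ := by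
  obtain ⟨θ, rfl⟩ := ρ.exists_rep
  rw [forces_ofSub, Fm.subst, World.holds_all]
  refine forall₂_congr fun w' m => ⟨fun h a => ?_, fun h t => ?_⟩
  · obtain ⟨t, rfl⟩ := a.exists_rep
    rw [Env.map_ofSub, ← Env.ofSub_cons, forces_ofSub, ← Sub.lift_comp_cons, ← Fm.subst_subst]
    exact h t
  · have := h (Obj.mk t)
    rwa [Env.map_ofSub, ← Env.ofSub_cons, forces_ofSub, ← Sub.lift_comp_cons,
      ← Fm.subst_subst] at this

theorem forces_exI {ρ : Env w Γ} {φ : Fm (σ :: Γ)} (a : Obj w σ)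
    (h : Forces w (Env.cons a ρ) φ) : Forces w ρ (Fm.ex σ φ) := by
  obtain ⟨θ, rfl⟩ := ρ.exists_rep
  obtain ⟨t, rfl⟩ := a.exists_rep
  rw [← Env.ofSub_cons, forces_ofSub] at h
  rw [forces_ofSub]
  refine World.holds_exI t ?_
  rwa [Fm.subst_lift_inst]

/-- The conclusion lives over its own context and valuation, so that the existential can be
eliminated into any forced formula, not only one over `Γ`. -/
theorem forces_exE {ρ : Env w Γ} {φ : Fm (σ :: Γ)} {ρ' : Env w Γ'} {χ : Fm Γ'}
    (h : Forces w ρ (Fm.ex σ φ))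
    (h' : ∀ (w' : World) (m : Hom w w') (a : Obj w' σ),
      Forces w' (Env.cons a (ρ.map m)) φ → Forces w' (ρ'.map m) χ) : Forces w ρ' χ := by
  obtain ⟨θ, rfl⟩ := ρ.exists_rep
  obtain ⟨θ', rfl⟩ := ρ'.exists_rep
  rw [forces_ofSub] at h ⊢
  refine World.holds_exE h fun w' m t ht => ?_
  rw [Fm.subst_subst, Sub.lift_comp_cons, ← forces_ofSub, Env.ofSub_cons] at ht
  rw [Fm.subst_subst, ← forces_ofSub]
  exact h' w' m _ ht

theorem forces_of_thm {φ : Fm Γ} (h : Thm HA φ) (ρ : Env w Γ) : Forces w ρ φ :=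
  World.holds_of_thm (h.subst _)

/-- Completeness: an underivable formula is omitted by some prime theory in its own context, and so
fails there when each variable denotes itself. -/
theorem thm_of_forces {φ : Fm Γ} (h : ∀ (w : World) (ρ : Env w Γ), Forces w ρ φ) : Thm HA φ := by
  by_contra hn
  obtain ⟨T, -, hT⟩ := exists_primeTheory ∅ φ (by
    rintro ⟨Δ, hΔ, hp⟩
    exact hn (hp.weaken fun ψ hψ => (hΔ ψ hψ).elim))
  have := (forces_ofSub (w := ⟨Γ, T⟩) Sub.id φ).mp (h _ _)
  rw [Fm.subst_id] at this
  exact hT this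

end

end EHA

namespace EHA

/-! ## Constants and abstraction in the canonical model -/

namespace Obj
variable {w w' : World} {σ τ ρ : Ty}

/-- The object denoted by a constant. -/
def con (c : Con σ) : Obj w σ := mk (Tm.con c)

@[simp] theorem map_con (m : Hom w w') (c : Con σ) : map m (con c : Obj w σ) = con c := rfl

/-- Pairing. -/
def pair (x : Obj w σ) (y : Obj w τ) : Obj w (Ty.prod σ τ) := (con (.pair σ τ)).app x |>.app y
/-- First projection. -/
def fst (x : Obj w (Ty.prod σ τ)) : Obj w σ := (con (.fst σ τ)).app x
/-- Second projection. -/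
def snd (x : Obj w (Ty.prod σ τ)) : Obj w τ := (con (.snd σ τ)).app x
/-- First injection. -/
def inl (x : Obj w σ) : Obj w (Ty.sum σ τ) := (con (.inl σ τ)).app x
/-- Second injection. -/
def inr (x : Obj w τ) : Obj w (Ty.sum σ τ) := (con (.inr σ τ)).app x
/-- Case distinction. -/
def cases (f : Obj w (σ ⇒ ρ)) (g : Obj w (τ ⇒ ρ)) (x : Obj w (Ty.sum σ τ)) : Obj w ρ :=
  (((con (.cases σ τ ρ)).app f).app g).app x
/-- Zero. -/
def zero : Obj w Ty.nat := con .zero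
/-- Successor. -/
def succ (n : Obj w Ty.nat) : Obj w Ty.nat := (con .succ).app n
/-- Primitive recursion. -/
def recur (a : Obj w σ) (f : Obj w (Ty.nat ⇒ σ ⇒ σ)) (n : Obj w Ty.nat) : Obj w σ :=
  (((con (.recur σ)).app a).app f).app n

section
variable (m : Hom w w')
@[simp] theorem map_pair (x : Obj w σ) (y : Obj w τ) :
    map m (pair x y) = pair (map m x) (map m y) := by simp [pair]
@[simp] theorem map_fst (x : Obj w (Ty.prod σ τ)) : map m (fst x) = fst (map m x) := by simp [fst]
@[simp] theorem map_snd (x : Obj w (Ty.prod σ τ)) : map m (snd x) = snd (map m x) := by simp [snd]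
@[simp] theorem map_inl (x : Obj w σ) :
    map m (inl x : Obj w (Ty.sum σ τ)) = inl (map m x) := by simp [inl]
@[simp] theorem map_inr (x : Obj w τ) :
    map m (inr x : Obj w (Ty.sum σ τ)) = inr (map m x) := by simp [inr]
@[simp] theorem map_zero : map m (zero : Obj w Ty.nat) = zero := rfl
@[simp] theorem map_succ (n : Obj w Ty.nat) : map m (succ n) = succ (map m n) := by simp [succ]
end

theorem k_app (x : Obj w σ) (y : Obj w τ) : ((con (.k σ τ)).app x).app y = x := by
  obtain ⟨x, rfl⟩ := x.exists_rep; obtain ⟨y, rfl⟩ := y.exists_rep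
  exact mk_eq_mk.mpr (World.holds_of_ax (.k _ _))

theorem s_app (x : Obj w (σ ⇒ τ ⇒ ρ)) (y : Obj w (σ ⇒ τ)) (z : Obj w σ) :
    (((con (.s σ τ ρ)).app x).app y).app z = (x.app z).app (y.app z) := by
  obtain ⟨x, rfl⟩ := x.exists_rep; obtain ⟨y, rfl⟩ := y.exists_rep
  obtain ⟨z, rfl⟩ := z.exists_rep
  exact mk_eq_mk.mpr (World.holds_of_ax (.s _ _ _))

@[simp] theorem fst_pair (x : Obj w σ) (y : Obj w τ) : fst (pair x y) = x := by
  obtain ⟨x, rfl⟩ := x.exists_rep; obtain ⟨y, rfl⟩ := y.exists_rep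
  exact mk_eq_mk.mpr (World.holds_of_ax (.fstPair _ _))

@[simp] theorem snd_pair (x : Obj w σ) (y : Obj w τ) : snd (pair x y) = y := by
  obtain ⟨x, rfl⟩ := x.exists_rep; obtain ⟨y, rfl⟩ := y.exists_rep
  exact mk_eq_mk.mpr (World.holds_of_ax (.sndPair _ _))

@[simp] theorem pair_fst_snd (x : Obj w (Ty.prod σ τ)) : pair (fst x) (snd x) = x := by
  obtain ⟨x, rfl⟩ := x.exists_rep
  exact mk_eq_mk.mpr (World.holds_of_ax (.pairEta _))

@[simp] theorem cases_inl (f : Obj w (σ ⇒ ρ)) (g : Obj w (τ ⇒ ρ)) (x : Obj w σ) :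
    cases f g (inl x) = f.app x := by
  obtain ⟨x, rfl⟩ := x.exists_rep; obtain ⟨f, rfl⟩ := f.exists_rep
  obtain ⟨g, rfl⟩ := g.exists_rep
  exact mk_eq_mk.mpr (World.holds_of_ax (.casesInl _ _ _))

@[simp] theorem cases_inr (f : Obj w (σ ⇒ ρ)) (g : Obj w (τ ⇒ ρ)) (x : Obj w τ) :
    cases f g (inr x) = g.app x := by
  obtain ⟨x, rfl⟩ := x.exists_rep; obtain ⟨f, rfl⟩ := f.exists_rep
  obtain ⟨g, rfl⟩ := g.exists_rep
  exact mk_eq_mk.mpr (World.holds_of_ax (.casesInr _ _ _))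

@[simp] theorem recur_zero (a : Obj w σ) (f : Obj w (Ty.nat ⇒ σ ⇒ σ)) : recur a f zero = a := by
  obtain ⟨a, rfl⟩ := a.exists_rep; obtain ⟨f, rfl⟩ := f.exists_rep
  exact mk_eq_mk.mpr (World.holds_of_ax (.recZero _ _))

@[simp] theorem recur_succ (a : Obj w σ) (f : Obj w (Ty.nat ⇒ σ ⇒ σ)) (n : Obj w Ty.nat) :
    recur a f (succ n) = (f.app n).app (recur a f n) := by
  obtain ⟨a, rfl⟩ := a.exists_rep; obtain ⟨f, rfl⟩ := f.exists_rep
  obtain ⟨n, rfl⟩ := n.exists_rep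
  exact mk_eq_mk.mpr (World.holds_of_ax (.recSucc _ _ _))

@[simp] theorem succ_ne_zero (n : Obj w Ty.nat) : succ n ≠ zero := by
  obtain ⟨n, rfl⟩ := n.exists_rep
  intro h
  have h₁ := World.holds_imp.mp (World.holds_of_ax (.succNeZero n)) w (Hom.id w)
  simp only [Hom.id, Fm.subst_id] at h₁
  exact World.not_holds_bot (h₁ (mk_eq_mk.mp h))

@[simp] theorem zero_ne_succ (n : Obj w Ty.nat) : zero ≠ succ n := (succ_ne_zero n).symm

@[simp] theorem succ_inj {n k : Obj w Ty.nat} : succ n = succ k ↔ n = k := by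
  refine ⟨fun h => ?_, congrArg succ⟩
  obtain ⟨n, rfl⟩ := n.exists_rep; obtain ⟨k, rfl⟩ := k.exists_rep
  have h₁ := World.holds_imp.mp (World.holds_of_ax (.succInj n k)) w (Hom.id w)
  simp only [Hom.id, Fm.subst_id] at h₁
  exact mk_eq_mk.mpr (h₁ (mk_eq_mk.mp h))

section
@[simp] theorem con_fst_app (x : Obj w (Ty.prod σ τ)) : (con (.fst σ τ)).app x = fst x := rfl
@[simp] theorem con_snd_app (x : Obj w (Ty.prod σ τ)) : (con (.snd σ τ)).app x = snd x := rfl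
end

end Obj

open Obj

section
variable {w w' : World} {Γ : Ctx} {σ τ ρ : Ty} (e : Env w Γ)

theorem ev_var (v : Var Γ σ) : ev e (Tm.var v) = e σ v := rfl
theorem ev_con (c : Con σ) : ev e (Tm.con c) = con c := rfl
theorem ev_app (t : Tm Γ (σ ⇒ τ)) (u : Tm Γ σ) : ev e (t ⬝ u) = (ev e t).app (ev e u) := rfl
theorem ev_pair (t : Tm Γ σ) (u : Tm Γ τ) : ev e (pairT t u) = pair (ev e t) (ev e u) := rfl
theorem ev_fst (t : Tm Γ (Ty.prod σ τ)) : ev e (fstT t) = fst (ev e t) := rfl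
theorem ev_snd (t : Tm Γ (Ty.prod σ τ)) : ev e (sndT t) = snd (ev e t) := rfl
theorem ev_inl (t : Tm Γ σ) : ev e (inlT (τ := τ) t) = inl (ev e t) := rfl
theorem ev_inr (t : Tm Γ τ) : ev e (inrT (σ := σ) t) = inr (ev e t) := rfl
theorem ev_cases (f : Tm Γ (σ ⇒ ρ)) (g : Tm Γ (τ ⇒ ρ)) (t : Tm Γ (Ty.sum σ τ)) :
    ev e (casesT f g t) = cases (ev e f) (ev e g) (ev e t) := rfl
theorem ev_zero : ev e zeroT = zero := rfl
theorem ev_succ (t : Tm Γ Ty.nat) : ev e (succT t) = succ (ev e t) := rfl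
theorem ev_rec (a : Tm Γ σ) (f : Tm Γ (Ty.nat ⇒ σ ⇒ σ)) (t : Tm Γ Ty.nat) :
    ev e (recT a f t) = recur (ev e a) (ev e f) (ev e t) := rfl

end

theorem con_recur_app {w : World} {σ : Ty} (a : Obj w σ) (f : Obj w (Ty.nat ⇒ σ ⇒ σ))
    (n : Obj w Ty.nat) : (((con (.recur σ)).app a).app f).app n = recur a f n := rfl

-- The general rules for applications and constants get low priority, so that pairs, projections,
-- cases and recursions are recognised before they dissolve into bare applications.
attribute [simp] con_recur_app ev_var ev_pair ev_fst ev_snd ev_inl ev_inr ev_cases ev_zero ev_succ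
    ev_rec
attribute [simp low] ev_app
attribute [simp low - 1] ev_con

/-- Bracket abstraction. -/
def lam {Γ : Ctx} {σ : Ty} : {τ : Ty} → Tm (σ :: Γ) τ → Tm Γ (σ ⇒ τ)
  | _, Tm.var Var.here => S ⬝ K ⬝ (K : Tm Γ (σ ⇒ σ ⇒ σ))
  | _, Tm.var (Var.there v) => K ⬝ Tm.var v
  | _, Tm.con c => K ⬝ Tm.con c
  | _, Tm.app t u => S ⬝ lam t ⬝ lam u

-- Beta reduction at the level of values: it needs only the equations of `k` and `s`, not
-- extensionality.
@[simp]
theorem lam_app {w : World} {Γ : Ctx} {σ τ : Ty} (e : Env w Γ) (t : Tm (σ :: Γ) τ) (a : Obj w σ) :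
    (ev e (lam t)).app a = ev (Env.cons a e) t := by
  induction t with
  | var v =>
    cases v with
    | here => simp only [lam, ev_app, ev_con, s_app, k_app]; rfl
    | there v => simp only [lam, ev_app, ev_con, k_app]; rfl
  | con c => simp only [lam, ev_app, ev_con, k_app]
  | app t u iht ihu => simp only [lam, ev_app, ev_con, s_app, iht, ihu]

-- Induction, sums and decidable equality of numbers in a world

section
variable {w : World} {Γ : Ctx} {σ τ : Ty}

/-- Induction is available only for properties expressed by a formula. Operations used in later
inductions therefore exist both as terms and as operations on objects, usually through a closed term
whose value does not depend on the valuation. -/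
theorem forces_nat_ind {e : Env w Γ} (φ : Fm (Ty.nat :: Γ)) (h₀ : Forces w (Env.cons zero e) φ)
    (hs : ∀ (w' : World) (m : Hom w w') (n : Obj w' Ty.nat),
      Forces w' (Env.cons n (e.map m)) φ → Forces w' (Env.cons (succ n) (e.map m)) φ)
    (n : Obj w Ty.nat) : Forces w (Env.cons n e) φ := by
  have h := forces_of_thm (w := w) (.ax (.induction φ)) e
  simp only [forces_imp, forces_inst, forces_all, forces_subst] at h
  have key := h w (Hom.id w) (by simpa using h₀) w (Hom.id w) ?_ w (Hom.id w) n
  · simpa using key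
  · intro w₁ m₁ k w₂ m₂ hk
    simp only [Env.map_cons, Env.map_id] at hk ⊢
    rw [← Env.map_comp] at hk ⊢
    have := hs _ _ _ hk
    convert this using 1
    funext τ v; cases v <;> rfl

/-- The predecessor function. -/
def predT (t : Tm Γ Ty.nat) : Tm Γ Ty.nat := recT zeroT (lam (lam v1)) t

/-- The induction formula uses the predecessor term in place of an existential, whose truth would
not provide an object of `w`; the disjunction is then decided by primeness. -/
theorem nat_cases (n : Obj w Ty.nat) : n = zero ∨ ∃ k, n = succ k := by
  have := forces_nat_ind (e := Env.nil) ((v0 ≐ zeroT) ⋎ (v0 ≐ succT (predT v0)))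
    (by simp) (by intro w' m n _; simp [predT]) n
  simp only [forces_or, forces_eq, ev_var, ev_zero, ev_succ, Env.cons_here] at this
  exact this.imp_right fun h => ⟨_, h⟩

/-- A closed term of each type. -/
def dflt : (σ : Ty) → Tm Γ σ
  | Ty.nat => zeroT
  | Ty.prod σ τ => pairT (dflt σ) (dflt τ)
  | Ty.sum σ _ => inlT (dflt σ)
  | Ty.arr _ τ => K ⬝ dflt τ

/-- The first component of an element of a sum. -/
def outlT (t : Tm Γ (Ty.sum σ τ)) : Tm Γ σ := casesT (lam v0) (lam (dflt σ)) t

/-- The second component of an element of a sum. -/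
def outrT (t : Tm Γ (Ty.sum σ τ)) : Tm Γ τ := casesT (lam (dflt τ)) (lam v0) t

theorem inl_inj {a b : Obj w σ} : (inl a : Obj w (.sum σ τ)) = inl b ↔ a = b := by
  refine ⟨fun h => ?_, congrArg inl⟩
  have := congrArg (fun x => ev (Env.cons x Env.nil) (outlT v0)) h
  simpa [outlT] using this

theorem inr_inj {a b : Obj w τ} : (inr a : Obj w (.sum σ τ)) = inr b ↔ a = b := by
  refine ⟨fun h => ?_, congrArg inr⟩
  have := congrArg (fun x => ev (Env.cons x Env.nil) (outrT v0)) h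
  simpa [outrT] using this

theorem inl_ne_inr (a : Obj w σ) (b : Obj w τ) : inl a ≠ inr b := by
  intro h
  have := congrArg
    (fun x => ev (Env.cons x Env.nil) (casesT (lam zeroT) (lam (succT zeroT)) v0)) h
  simp at this

/-- Primeness decides the disjunction in `sumExhaust`. The existential is eliminated into the
equation `x = inl (outl x)` or its mirror image, which supplies a witness in `w` itself. -/
theorem sum_cases (x : Obj w (Ty.sum σ τ)) : (∃ a, x = inl a) ∨ ∃ b, x = inr b := by
  have h := forces_of_thm (w := w) (.ax (.sumExhaust v0)) (Env.cons x Env.nil)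
  rw [forces_or] at h
  refine h.imp (fun h => ⟨ev (Env.cons x Env.nil) (outlT v0), ?_⟩)
    (fun h => ⟨ev (Env.cons x Env.nil) (outrT v0), ?_⟩)
  · have := forces_exE (ρ' := Env.cons x Env.nil) (χ := v0 ≐ inlT (outlT v0)) h (by
      intro w' m a ha
      simp only [forces_eq, ev_wk, ev_var, ev_inl, Env.map_cons, Env.cons_here] at ha
      simp [ha, outlT])
    simpa using this
  · have := forces_exE (ρ' := Env.cons x Env.nil) (χ := v0 ≐ inrT (outrT v0)) h (by
      intro w' m a ha
      simp only [forces_eq, ev_wk, ev_var, ev_inr, Env.map_cons, Env.cons_here] at ha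
      simp [ha, outrT])
    simpa using this

/-- If `t` is zero then `a` else `b`. -/
def iteT (t : Tm Γ Ty.nat) (a b : Tm Γ σ) : Tm Γ σ := recT a (lam (lam b.wk.wk)) t

theorem ev_ite_of_eq (e : Env w Γ) {t : Tm Γ Ty.nat} (a b : Tm Γ σ) (h : ev e t = zero) :
    ev e (iteT t a b) = ev e a := by
  simp [iteT, h]

theorem ev_ite_of_ne (e : Env w Γ) {t : Tm Γ Ty.nat} (a b : Tm Γ σ) (h : ev e t ≠ zero) :
    ev e (iteT t a b) = ev e b := by
  obtain ⟨k, hk⟩ := (nat_cases (ev e t)).resolve_left h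
  simp [iteT, hk]

/-- A function that vanishes exactly at equal pairs of numbers. -/
def neqC : Tm [] (Ty.nat ⇒ Ty.nat ⇒ Ty.nat) :=
  Tm.con (Con.recur _) ⬝ lam v0 ⬝ lam (lam (lam (recT (succT zeroT) (lam (lam (v3 ⬝ v1))) v0)))

/-- A term that vanishes exactly when two numbers are equal. -/
def neqT (a b : Tm Γ Ty.nat) : Tm Γ Ty.nat := neqC.subst Sub.nil ⬝ a ⬝ b

/-- The value of `neqT`. -/
def neq (a b : Obj w Ty.nat) : Obj w Ty.nat := ((ev Env.nil neqC).app a).app b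

@[simp] theorem ev_neq (e : Env w Γ) (a b : Tm Γ Ty.nat) :
    ev e (neqT a b) = neq (ev e a) (ev e b) := by
  simp only [neqT, ev_app, ev_nil_subst]; rfl

@[simp] theorem map_neq {w' : World} (m : Hom w w') (a b : Obj w Ty.nat) :
    (neq a b).map m = neq (a.map m) (b.map m) := by
  simp [neq, map_ev]

@[simp] theorem neq_zero_left (b : Obj w Ty.nat) : neq zero b = b := by simp [neq, neqC]
@[simp] theorem neq_succ_zero (a : Obj w Ty.nat) : neq (succ a) zero = succ zero := by
  simp [neq, neqC]
@[simp] theorem neq_succ_succ (a b : Obj w Ty.nat) : neq (succ a) (succ b) = neq a b := by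
  simp [neq, neqC]

/-- Equality of numbers is decided by a term. The induction on `a` keeps `b` universally quantified,
since both decrease together. -/
theorem neq_eq_zero {a b : Obj w Ty.nat} : neq a b = zero ↔ a = b := by
  constructor
  · have := forces_nat_ind (e := Env.nil) (Fm.all Ty.nat (neqT v1 v0 ≐ zeroT ⟹ v1 ≐ v0))
      (by simp +contextual) (by
        intro w' m n ih
        simp only [forces_all, forces_imp, forces_eq] at ih ⊢
        intro w₁ m₁ b w₂ m₂ h
        simp only [Env.map_cons, ev_neq, ev_var, Env.cons_there, Env.cons_here, map_succ] at h ⊢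
        rcases nat_cases (b.map m₂) with hb | ⟨k, hb⟩
        · simp [hb] at h
        · have := ih w₂ (m₁.comp m₂) k w₂ (Hom.id _)
          simp only [hb, neq_succ_succ, ev_zero] at h
          simp_all) a
    simp only [forces_all, forces_imp, forces_eq] at this
    simpa using this w (Hom.id w) b w (Hom.id w)
  · rintro rfl
    have := forces_nat_ind (e := Env.nil) (neqT v0 v0 ≐ zeroT)
      (by simp) (by intro w' m n h; simpa using h) a
    simpa using this

/-- Distinctness of numbers amounts to a positive fact, that `neq a b` is a successor, and equations
persist along morphisms. Without decidability, distinct objects could become equal later. -/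
theorem map_ne_map {w' : World} (m : Hom w w') {a b : Obj w Ty.nat} (h : a ≠ b) :
    a.map m ≠ b.map m := by
  rw [Ne, ← neq_eq_zero] at h ⊢
  obtain ⟨k, hk⟩ := (nat_cases _).resolve_left h
  rw [← map_neq, hk]; simp

theorem forces_neg_eq_nat (e : Env w Γ) (s t : Tm Γ Ty.nat) :
    Forces w e (Fm.neg (s ≐ t)) ↔ ev e s ≠ ev e t := by
  simp only [forces_imp, forces_bot, forces_eq, imp_false, ← map_ev]
  exact ⟨fun h => by simpa using h w (Hom.id w), fun h w' m => map_ne_map m h⟩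

end
end EHA

namespace EHA
open Obj

/-! ## Domains and apartness in the canonical model -/

section
variable {w w' : World} {Γ Γ' : Ctx} {σ τ : Ty}

/-- Membership in the domain. -/
def D (w : World) (σ : Ty) (x : Obj w σ.pos) : Prop :=
  Forces w (Env.cons x Env.nil) (domApp σ).1

/-- Apartness with evidence. -/
def A (w : World) (σ : Ty) (x y : Obj w σ.pos) (z : Obj w σ.neg) : Prop :=
  Forces w (Env.cons x (Env.cons y (Env.cons z Env.nil))) (domApp σ).2

theorem forces_domApp_fst (x : Obj w σ.pos) :
    Forces w (Env.cons x Env.nil) (domApp σ).1 ↔ D w σ x := Iff.rfl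

theorem forces_domApp_snd (x y : Obj w σ.pos) (z : Obj w σ.neg) :
    Forces w (Env.cons x (Env.cons y (Env.cons z Env.nil))) (domApp σ).2 ↔ A w σ x y z := Iff.rfl

theorem D.map {x : Obj w σ.pos} (h : D w σ x) (m : Hom w w') : D w' σ (x.map m) := by
  simpa [D] using Forces.map h m

theorem forces_domAt (e : Env w Γ) (Dσ : DomFm σ) (x : Tm Γ σ.pos) :
    Forces w e (Dσ.at x) ↔ Forces w (Env.cons (ev e x) Env.nil) Dσ := by
  rw [DomFm.at, forces_subst]
  have : (fun τ v => ev e (Sub.cons x Sub.nil τ v)) = Env.cons (ev e x) Env.nil := by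
    funext τ v
    cases v with
    | here => rfl
    | there v => cases v
  rw [this]

theorem forces_appAt (e : Env w Γ) (Aσ : AppFm σ) (x y : Tm Γ σ.pos) (z : Tm Γ σ.neg) :
    Forces w e (Aσ.at x y z) ↔
      Forces w (Env.cons (ev e x) (Env.cons (ev e y) (Env.cons (ev e z) Env.nil))) Aσ := by
  rw [AppFm.at, forces_subst]
  have : (fun τ v => ev e (Sub.cons x (Sub.cons y (Sub.cons z Sub.nil)) τ v)) =
      Env.cons (ev e x) (Env.cons (ev e y) (Env.cons (ev e z) Env.nil)) := by
    funext τ v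
    rcases v with _ | _ | _ | v
    · rfl
    · rfl
    · rfl
    · cases v
  rw [this]

@[simp] theorem forces_dom (e : Env w Γ) (x : Tm Γ σ.pos) :
    Forces w e (dom σ x) ↔ D w σ (ev e x) := forces_domAt _ _ _

@[simp] theorem forces_apart (e : Env w Γ) (x y : Tm Γ σ.pos) (z : Tm Γ σ.neg) :
    Forces w e (apart σ x y z) ↔ A w σ (ev e x) (ev e y) (ev e z) := forces_appAt _ _ _ _ _

theorem forces_ex₂E {ρ : Env w Γ} {φ : Fm (τ :: σ :: Γ)} {ρ' : Env w Γ'} {χ : Fm Γ'}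
    (h : Forces w ρ (Fm.ex σ (Fm.ex τ φ)))
    (h' : ∀ (w' : World) (m : Hom w w') (a : Obj w' σ) (b : Obj w' τ),
      Forces w' (Env.cons b (Env.cons a (ρ.map m))) φ → Forces w' (ρ'.map m) χ) :
    Forces w ρ' χ := by
  refine forces_exE h fun w₁ m₁ a h₁ => forces_exE h₁ fun w₂ m₂ b h₂ => ?_
  rw [← Env.map_comp]
  exact h' w₂ (m₁.comp m₂) (a.map m₂) b (by simpa using h₂)

/-- Application of interpreted functions. -/
def appP (f : Obj w (σ ⇒ τ).pos) (x : Obj w σ.pos) : Obj w τ.pos :=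
  (fst (σ := σ.pos ⇒ τ.pos) (τ := σ.pos ⇒ σ.pos ⇒ τ.neg ⇒ σ.neg) f).app x

/-- Evidence transformation of interpreted functions. -/
def appN (f : Obj w (σ ⇒ τ).pos) (u v : Obj w σ.pos) (z : Obj w τ.neg) : Obj w σ.neg :=
  (((snd (σ := σ.pos ⇒ τ.pos) (τ := σ.pos ⇒ σ.pos ⇒ τ.neg ⇒ σ.neg) f).app u).app v).app z

@[simp] theorem map_appP (m : Hom w w') (f : Obj w (σ ⇒ τ).pos) (x : Obj w σ.pos) :
    (appP f x).map m = appP (f.map m) (x.map m) :=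
  (map_app _ _ _).trans (congrArg (fun g => app g (x.map m)) (map_fst _ _))

@[simp] theorem ev_appPos (e : Env w Γ) (f : Tm Γ (σ ⇒ τ).pos) (x : Tm Γ σ.pos) :
    ev e (appPos f x) = appP (ev e f) (ev e x) := rfl

@[simp] theorem ev_appNeg (e : Env w Γ) (f : Tm Γ (σ ⇒ τ).pos) (u v : Tm Γ σ.pos)
    (z : Tm Γ τ.neg) : ev e (appNeg f u v z) = appN (ev e f) (ev e u) (ev e v) (ev e z) := rfl

/-- Function objects given by their values and their evidence transformation; the latter has the
evidence as its variable 0 and the two arguments as its variables 2 and 1. -/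
def funT (t : Tm (σ.pos :: Γ) τ.pos) (e : Tm (τ.neg :: σ.pos :: σ.pos :: Γ) σ.neg) :
    Tm Γ (σ ⇒ τ).pos :=
  pairT (σ := σ.pos ⇒ τ.pos) (τ := σ.pos ⇒ σ.pos ⇒ τ.neg ⇒ σ.neg) (lam t) (lam (lam (lam e)))

@[simp] theorem appP_funT (ρ : Env w Γ) (t : Tm (σ.pos :: Γ) τ.pos)
    (e : Tm (τ.neg :: σ.pos :: σ.pos :: Γ) σ.neg) (x : Obj w σ.pos) :
    appP (ev ρ (funT t e)) x = ev (Env.cons x ρ) t := by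
  unfold appP funT
  rw [ev_pair, fst_pair, lam_app]

@[simp] theorem appN_funT (ρ : Env w Γ) (t : Tm (σ.pos :: Γ) τ.pos)
    (e : Tm (τ.neg :: σ.pos :: σ.pos :: Γ) σ.neg) (u v : Obj w σ.pos) (z : Obj w τ.neg) :
    appN (ev ρ (funT t e)) u v z = ev (Env.cons z (Env.cons v (Env.cons u ρ))) e := by
  unfold appN funT
  rw [ev_pair, snd_pair, lam_app, lam_app, lam_app]

-- The clauses of `dom` and `app`, type by type

theorem D_nat (x : Obj w Ty.nat) : D w Ty.nat x := (forces_eq _ _ _).mpr rfl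

theorem A_nat (x y z : Obj w Ty.nat) : A w Ty.nat x y z ↔ x ≠ y := forces_neg_eq_nat _ _ _

theorem D_prod (x : Obj w (Ty.prod σ.pos τ.pos)) :
    D w (Ty.prod σ τ) x ↔ D w σ (fst x) ∧ D w τ (snd x) := by
  change Forces w _ (domProd _ _) ↔ _
  rw [domProd, forces_and, forces_domAt, forces_domAt]; rfl

/-- The existentials of the clause are eliminated into the right-hand side, which is itself a forced
formula. Injectivity of the injections identifies the witness and their disjointness excludes the
other disjunct. The other clauses for sums and products follow the same pattern. -/
theorem D_inl (a : Obj w σ.pos) : D w (Ty.sum σ τ) (inl (τ := τ.pos) a) ↔ D w σ a := by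
  change Forces w _ (domSum _ _) ↔ _
  rw [domSum, forces_or]
  refine ⟨?_, fun h => .inl (forces_exI a ?_)⟩
  · rintro (h | h) <;> refine forces_exE h fun w' m b hb => ?_
    · rw [forces_and, forces_eq, forces_domAt] at hb
      simp only [ev_var, ev_inl, Env.cons_there, Env.cons_here, Env.map_cons, map_inl] at hb
      rw [inl_inj] at hb
      simp only [Env.map_cons, Env.map_nil, hb.1]
      exact hb.2
    · rw [forces_and, forces_eq] at hb
      simp only [ev_var, ev_inr, Env.cons_there, Env.cons_here, Env.map_cons, map_inl] at hb
      exact absurd hb.1 (inl_ne_inr _ _)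
  · rw [forces_and, forces_eq, forces_domAt]
    exact ⟨rfl, h⟩

theorem D_inr (a : Obj w τ.pos) : D w (Ty.sum σ τ) (inr (σ := σ.pos) a) ↔ D w τ a := by
  change Forces w _ (domSum _ _) ↔ _
  rw [domSum, forces_or]
  refine ⟨?_, fun h => .inr (forces_exI a ?_)⟩
  · rintro (h | h) <;> refine forces_exE h fun w' m b hb => ?_
    · rw [forces_and, forces_eq] at hb
      simp only [ev_var, ev_inl, Env.cons_there, Env.cons_here, Env.map_cons, map_inr] at hb
      exact absurd hb.1.symm (inl_ne_inr _ _)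
    · rw [forces_and, forces_eq, forces_domAt] at hb
      simp only [ev_var, ev_inr, Env.cons_there, Env.cons_here, Env.map_cons, map_inr] at hb
      rw [inr_inj] at hb
      simp only [Env.map_cons, Env.map_nil, hb.1]
      exact hb.2
  · rw [forces_and, forces_eq, forces_domAt]
    exact ⟨rfl, h⟩

theorem A_prod_inl (x y : Obj w (Ty.prod σ.pos τ.pos)) (u : Obj w σ.neg) :
    A w (Ty.prod σ τ) x y (inl (τ := τ.neg) u) ↔
      A w σ (fst x) (fst y) u ∧ D w (Ty.prod σ τ) x ∧ D w (Ty.prod σ τ) y := by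
  change Forces w _ (appProd _ _ _ _) ↔ _
  rw [appProd, forces_and, forces_and, forces_domAt, forces_domAt, forces_or]
  refine and_congr_left' ⟨?_, fun h => .inl (forces_exI u ?_)⟩
  · rintro (h | h) <;> refine forces_exE h fun w' m b hb => ?_
    · rw [forces_and, forces_eq, forces_appAt] at hb
      simp only [ev_var, ev_inl, ev_fst, Env.cons_there, Env.cons_here, Env.map_cons,
        map_inl] at hb
      rw [inl_inj] at hb
      simp only [Env.map_cons, Env.map_nil, hb.1, map_fst]
      exact hb.2
    · rw [forces_and, forces_eq] at hb
      simp only [ev_var, ev_inr, Env.cons_there, Env.cons_here, Env.map_cons, map_inl] at hb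
      exact absurd hb.1 (inl_ne_inr _ _)
  · rw [forces_and, forces_eq, forces_appAt]
    exact ⟨rfl, h⟩

theorem A_prod_inr (x y : Obj w (Ty.prod σ.pos τ.pos)) (u : Obj w τ.neg) :
    A w (Ty.prod σ τ) x y (inr (σ := σ.neg) u) ↔
      A w τ (snd x) (snd y) u ∧ D w (Ty.prod σ τ) x ∧ D w (Ty.prod σ τ) y := by
  change Forces w _ (appProd _ _ _ _) ↔ _
  rw [appProd, forces_and, forces_and, forces_domAt, forces_domAt, forces_or]
  refine and_congr_left' ⟨?_, fun h => .inr (forces_exI u ?_)⟩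
  · rintro (h | h) <;> refine forces_exE h fun w' m b hb => ?_
    · rw [forces_and, forces_eq] at hb
      simp only [ev_var, ev_inl, Env.cons_there, Env.cons_here, Env.map_cons, map_inr] at hb
      exact absurd hb.1.symm (inl_ne_inr _ _)
    · rw [forces_and, forces_eq, forces_appAt] at hb
      simp only [ev_var, ev_inr, ev_snd, Env.cons_there, Env.cons_here, Env.map_cons,
        map_inr] at hb
      rw [inr_inj] at hb
      simp only [Env.map_cons, Env.map_nil, hb.1, map_snd]
      exact hb.2
  · rw [forces_and, forces_eq, forces_appAt]
    exact ⟨rfl, h⟩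

theorem A_inl_inr (a : Obj w σ.pos) (b : Obj w τ.pos) (z : Obj w (Ty.prod σ.neg τ.neg)) :
    A w (Ty.sum σ τ) (inl (τ := τ.pos) a) (inr (σ := σ.pos) b) z ↔ D w σ a ∧ D w τ b := by
  rw [← D_inl (τ := τ) a, ← D_inr (σ := σ) b]
  change Forces w _ (appSum _ _ _ _) ↔ _
  rw [appSum, forces_and, forces_and, forces_domAt, forces_domAt, forces_or]
  refine and_iff_right (.inl (forces_exI a (forces_exI b ?_)))
  rw [forces_or, forces_and, forces_eq, forces_eq]
  exact .inl ⟨rfl, rfl⟩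

theorem A_inr_inl (a : Obj w σ.pos) (b : Obj w τ.pos) (z : Obj w (Ty.prod σ.neg τ.neg)) :
    A w (Ty.sum σ τ) (inr (σ := σ.pos) b) (inl (τ := τ.pos) a) z ↔ D w τ b ∧ D w σ a := by
  rw [← D_inl (τ := τ) a, ← D_inr (σ := σ) b]
  change Forces w _ (appSum _ _ _ _) ↔ _
  rw [appSum, forces_and, forces_and, forces_domAt, forces_domAt, forces_or]
  refine and_iff_right (.inl (forces_exI a (forces_exI b ?_)))
  rw [forces_or, forces_and, forces_and, forces_eq, forces_eq, forces_eq, forces_eq]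
  exact .inr ⟨rfl, rfl⟩

theorem A_inl_inl (a b : Obj w σ.pos) (z : Obj w (Ty.prod σ.neg τ.neg)) :
    A w (Ty.sum σ τ) (inl (τ := τ.pos) a) (inl (τ := τ.pos) b) z ↔
      A w σ a b (fst z) ∧ D w σ a ∧ D w σ b := by
  rw [← D_inl (τ := τ) a, ← D_inl (τ := τ) b]
  change Forces w _ (appSum _ _ _ _) ↔ _
  rw [appSum, forces_and, forces_and, forces_domAt, forces_domAt, forces_or, forces_or]
  refine and_congr_left' ⟨?_, fun h => .inr (.inl (forces_exI a (forces_exI b ?_)))⟩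
  · rintro (h | h | h) <;> refine forces_ex₂E h fun w' m c d hb => ?_
    · rw [forces_or, forces_and, forces_and, forces_eq, forces_eq, forces_eq, forces_eq] at hb
      simp only [ev_var, ev_inr, Env.cons_there, Env.cons_here, Env.map_cons, map_inl] at hb
      exact hb.elim (fun h => absurd h.2 (inl_ne_inr _ _)) (fun h => absurd h.1 (inl_ne_inr _ _))
    · rw [forces_and, forces_and, forces_eq, forces_eq, forces_appAt] at hb
      simp only [ev_var, ev_inl, ev_fst, Env.cons_there, Env.cons_here, Env.map_cons,
        map_inl] at hb
      rw [inl_inj, inl_inj] at hb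
      simp only [Env.map_cons, Env.map_nil, hb.1, hb.2.1, map_fst]
      exact hb.2.2
    · rw [forces_and, forces_eq] at hb
      simp only [ev_var, ev_inr, Env.cons_there, Env.cons_here, Env.map_cons, map_inl] at hb
      exact absurd hb.1 (inl_ne_inr _ _)
  · rw [forces_and, forces_and, forces_eq, forces_eq, forces_appAt]
    exact ⟨rfl, rfl, h⟩

theorem A_inr_inr (a b : Obj w τ.pos) (z : Obj w (Ty.prod σ.neg τ.neg)) :
    A w (Ty.sum σ τ) (inr (σ := σ.pos) a) (inr (σ := σ.pos) b) z ↔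
      A w τ a b (snd z) ∧ D w τ a ∧ D w τ b := by
  rw [← D_inr (σ := σ) a, ← D_inr (σ := σ) b]
  change Forces w _ (appSum _ _ _ _) ↔ _
  rw [appSum, forces_and, forces_and, forces_domAt, forces_domAt, forces_or, forces_or]
  refine and_congr_left' ⟨?_, fun h => .inr (.inr (forces_exI a (forces_exI b ?_)))⟩
  · rintro (h | h | h) <;> refine forces_ex₂E h fun w' m c d hb => ?_
    · rw [forces_or, forces_and, forces_and, forces_eq, forces_eq, forces_eq, forces_eq] at hb
      simp only [ev_var, ev_inl, Env.cons_there, Env.cons_here, Env.map_cons, map_inr] at hb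
      exact hb.elim (fun h => absurd h.1.symm (inl_ne_inr _ _))
        (fun h => absurd h.2.symm (inl_ne_inr _ _))
    · rw [forces_and, forces_eq] at hb
      simp only [ev_var, ev_inl, Env.cons_there, Env.cons_here, Env.map_cons, map_inr] at hb
      exact absurd hb.1.symm (inl_ne_inr _ _)
    · rw [forces_and, forces_and, forces_eq, forces_eq, forces_appAt] at hb
      simp only [ev_var, ev_inr, ev_snd, Env.cons_there, Env.cons_here, Env.map_cons,
        map_inr] at hb
      rw [inr_inj, inr_inj] at hb
      simp only [Env.map_cons, Env.map_nil, hb.1, hb.2.1, map_snd]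
      exact hb.2.2
  · rw [forces_and, forces_and, forces_eq, forces_eq, forces_appAt]
    exact ⟨rfl, rfl, h⟩

/-- Every quantifier and every implication of the clause moves to a later world. The chain of
morphisms is composed into one, along which all earlier arguments are transported. -/
theorem D_arr (f : Obj w (σ ⇒ τ).pos) : D w (σ ⇒ τ) f ↔
    (∀ (w' : World) (m : Hom w w') (u : Obj w' σ.pos), D w' σ u → D w' τ (appP (f.map m) u)) ∧
    ∀ (w' : World) (m : Hom w w') (u v : Obj w' σ.pos) (z : Obj w' τ.neg),
      D w' σ u → D w' σ v → A w' τ (appP (f.map m) u) (appP (f.map m) v) z →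
        A w' σ u v (appN (f.map m) u v z) := by
  change Forces w _ (domArr _ _ _ _) ↔ _
  rw [domArr, forces_and]
  simp only [forces_all, forces_imp, forces_domAt, forces_appAt, ev_var, ev_appPos, ev_appNeg,
    Env.cons_here, Env.cons_there, Env.map_cons, forces_domApp_fst, forces_domApp_snd]
  refine and_congr ⟨fun h w' m u hu => ?_, fun h w₁ m₁ u w₂ m₂ hu => ?_⟩
    ⟨fun h w' m u v z hu hv hz => ?_, fun h w₁ m₁ u w₂ m₂ v w₃ m₃ z w₄ m₄ hu w₅ m₅ hv w₆ m₆ hz =>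
      ?_⟩
  · simpa using h w' m u w' (Hom.id _) (by simpa using hu)
  · rw [← map_comp]; exact h _ _ _ hu
  · simpa using h w' m u w' (Hom.id _) v w' (Hom.id _) z w' (Hom.id _) (by simpa using hu)
      w' (Hom.id _) (by simpa using hv) w' (Hom.id _) (by simpa using hz)
  · have := h w₆ (m₁.comp (m₂.comp (m₃.comp (m₄.comp (m₅.comp m₆)))))
      (u.map (m₂.comp (m₃.comp (m₄.comp (m₅.comp m₆))))) (v.map (m₃.comp (m₄.comp (m₅.comp m₆))))
      (z.map (m₄.comp (m₅.comp m₆))) (by simpa using (D.map hu m₅).map m₆)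
      (by simpa using D.map hv m₆) (by simpa using hz)
    simpa using this

theorem A_arr (f g : Obj w (σ ⇒ τ).pos) (z : Obj w (Ty.prod σ.pos τ.neg)) :
    A w (σ ⇒ τ) f g z ↔ D w σ (fst z) ∧ A w τ (appP f (fst z)) (appP g (fst z)) (snd z) ∧
      D w (σ ⇒ τ) f ∧ D w (σ ⇒ τ) g := by
  change Forces w _ (appArr _ _ _ _) ↔ _
  rw [appArr, forces_and, forces_and, forces_and, forces_domAt, forces_domAt, forces_domAt,
    forces_appAt]
  rfl

theorem D.appP {f : Obj w (σ ⇒ τ).pos} (hf : D w (σ ⇒ τ) f) {u : Obj w σ.pos} (hu : D w σ u) :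
    D w τ (appP f u) := by
  simpa using ((D_arr f).mp hf).1 w (Hom.id w) u hu

theorem D.appN {f : Obj w (σ ⇒ τ).pos} (hf : D w (σ ⇒ τ) f) {u v : Obj w σ.pos} (hu : D w σ u)
    (hv : D w σ v) {z : Obj w τ.neg} (hz : A w τ (EHA.appP f u) (EHA.appP f v) z) :
    A w σ u v (appN f u v z) := by
  simpa using ((D_arr f).mp hf).2 w (Hom.id w) u v z hu hv (by simpa using hz)

theorem D_funT {ρ : Env w Γ} {t : Tm (σ.pos :: Γ) τ.pos}
    {e : Tm (τ.neg :: σ.pos :: σ.pos :: Γ) σ.neg}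
    (ht : ∀ (w' : World) (m : Hom w w') (u : Obj w' σ.pos), D w' σ u →
      D w' τ (ev (Env.cons u (ρ.map m)) t))
    (he : ∀ (w' : World) (m : Hom w w') (u v : Obj w' σ.pos) (z : Obj w' τ.neg),
      D w' σ u → D w' σ v → A w' τ (ev (Env.cons u (ρ.map m)) t) (ev (Env.cons v (ρ.map m)) t) z →
        A w' σ u v (ev (Env.cons z (Env.cons v (Env.cons u (ρ.map m)))) e)) :
    D w (σ ⇒ τ) (ev ρ (funT t e)) := by
  rw [D_arr]
  simp only [map_ev, appP_funT, appN_funT]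
  exact ⟨ht, he⟩

-- General properties of apartness

theorem A.dom : ∀ {σ : Ty} {w : World} {x y : Obj w σ.pos} {z : Obj w σ.neg},
    A w σ x y z → D w σ x ∧ D w σ y
  | Ty.nat, _, _, _, _, _ => ⟨D_nat _, D_nat _⟩
  | Ty.prod σ τ, w, x, y, z, h => by
    rcases sum_cases (σ := σ.neg) (τ := τ.neg) z with ⟨u, rfl⟩ | ⟨u, rfl⟩
    · exact ((A_prod_inl x y u).mp h).2
    · exact ((A_prod_inr x y u).mp h).2
  | Ty.sum σ τ, w, x, y, z, h => by
    rcases sum_cases (σ := σ.pos) (τ := τ.pos) x with ⟨a, rfl⟩ | ⟨a, rfl⟩ <;>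
    rcases sum_cases (σ := σ.pos) (τ := τ.pos) y with ⟨b, rfl⟩ | ⟨b, rfl⟩
    · exact ⟨(D_inl _).mpr ((A_inl_inl _ _ _).mp h).2.1, (D_inl _).mpr ((A_inl_inl _ _ _).mp h).2.2⟩
    · exact ⟨(D_inl _).mpr ((A_inl_inr _ _ _).mp h).1, (D_inr _).mpr ((A_inl_inr _ _ _).mp h).2⟩
    · exact ⟨(D_inr _).mpr ((A_inr_inl _ _ _).mp h).1, (D_inl _).mpr ((A_inr_inl _ _ _).mp h).2⟩
    · exact ⟨(D_inr _).mpr ((A_inr_inr _ _ _).mp h).2.1, (D_inr _).mpr ((A_inr_inr _ _ _).mp h).2.2⟩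
  | Ty.arr σ τ, w, x, y, z, h => ((A_arr x y z).mp h).2.2

theorem A.irrefl : ∀ {σ : Ty} {w : World} {x : Obj w σ.pos} {z : Obj w σ.neg}, ¬ A w σ x x z
  | Ty.nat, _, _, _, h => (A_nat _ _ _).mp h rfl
  | Ty.prod σ τ, w, x, z, h => by
    rcases sum_cases (σ := σ.neg) (τ := τ.neg) z with ⟨u, rfl⟩ | ⟨u, rfl⟩
    · exact A.irrefl ((A_prod_inl x x u).mp h).1
    · exact A.irrefl ((A_prod_inr x x u).mp h).1
  | Ty.sum σ τ, w, x, z, h => by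
    rcases sum_cases (σ := σ.pos) (τ := τ.pos) x with ⟨a, rfl⟩ | ⟨a, rfl⟩
    · exact A.irrefl ((A_inl_inl _ _ _).mp h).1
    · exact A.irrefl ((A_inr_inr _ _ _).mp h).1
  | Ty.arr σ τ, w, x, z, h => A.irrefl ((A_arr x x z).mp h).2.1

/-- Evidence names a place of difference, not a direction, so the same `z` serves both orders. -/
theorem A.symm : ∀ {σ : Ty} {w : World} {x y : Obj w σ.pos} {z : Obj w σ.neg},
    A w σ x y z → A w σ y x z
  | Ty.nat, _, _, _, _, h => (A_nat _ _ _).mpr ((A_nat _ _ _).mp h).symm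
  | Ty.prod σ τ, w, x, y, z, h => by
    rcases sum_cases (σ := σ.neg) (τ := τ.neg) z with ⟨u, rfl⟩ | ⟨u, rfl⟩
    · rw [A_prod_inl] at h ⊢; exact ⟨h.1.symm, h.2.symm⟩
    · rw [A_prod_inr] at h ⊢; exact ⟨h.1.symm, h.2.symm⟩
  | Ty.sum σ τ, w, x, y, z, h => by
    rcases sum_cases (σ := σ.pos) (τ := τ.pos) x with ⟨a, rfl⟩ | ⟨a, rfl⟩ <;>
    rcases sum_cases (σ := σ.pos) (τ := τ.pos) y with ⟨b, rfl⟩ | ⟨b, rfl⟩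
    · exact (A_inl_inl _ _ _).mpr ⟨A.symm ((A_inl_inl _ _ _).mp h).1,
        ((A_inl_inl _ _ _).mp h).2.symm⟩
    · exact (A_inr_inl _ _ _).mpr ((A_inl_inr _ _ _).mp h).symm
    · exact (A_inl_inr _ _ _).mpr ((A_inr_inl _ _ _).mp h).symm
    · exact (A_inr_inr _ _ _).mpr ⟨A.symm ((A_inr_inr _ _ _).mp h).1,
        ((A_inr_inr _ _ _).mp h).2.symm⟩
  | Ty.arr σ τ, w, x, y, z, h => by
    rw [A_arr] at h ⊢; exact ⟨h.1, h.2.1.symm, h.2.2.symm⟩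

end
end EHA

namespace EHA
open Obj

/-! ## Cotransitivity of apartness, with a decision term -/

/-- If `x` and `y` are apart with evidence `z`, then `cmpT σ x v y z` vanishes only if `z` is
evidence that `x` and `v` are apart, and is different from zero only if `z` is evidence that `v`
and `y` are apart. -/
def cmpT : (σ : Ty) → {Γ : Ctx} → (x v y : Tm Γ σ.pos) → (z : Tm Γ σ.neg) → Tm Γ Ty.nat
  | Ty.nat, _, x, v, _, _ => iteT (neqT x v) (succT zeroT) zeroT
  | Ty.prod σ τ, _, x, v, y, z =>
      casesT (σ := σ.neg) (τ := τ.neg)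
        (lam (cmpT σ (fstT (τ := τ.pos) x).wk (fstT (τ := τ.pos) v).wk (fstT (τ := τ.pos) y).wk v0))
        (lam (cmpT τ (sndT (σ := σ.pos) x).wk (sndT (σ := σ.pos) v).wk (sndT (σ := σ.pos) y).wk v0))
        z
  | Ty.sum σ τ, _, x, v, y, z =>
      casesT (σ := σ.pos) (τ := τ.pos)
        (lam (casesT (σ := σ.pos) (τ := τ.pos)
          (lam (casesT (σ := σ.pos) (τ := τ.pos)
            (lam (cmpT σ v2 v1 v0 (fstT (τ := τ.neg) z).wk.wk.wk)) (lam (succT zeroT)) y.wk.wk))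
          (lam zeroT) v.wk))
        (lam (casesT (σ := σ.pos) (τ := τ.pos) (lam zeroT)
          (lam (casesT (σ := σ.pos) (τ := τ.pos) (lam (succT zeroT))
            (lam (cmpT τ v2 v1 v0 (sndT (σ := σ.neg) z).wk.wk.wk)) y.wk.wk)) v.wk))
        x
  | Ty.arr σ τ, _, x, v, y, z =>
      cmpT τ (appPos x (fstT (τ := τ.neg) z)) (appPos v (fstT (τ := τ.neg) z))
        (appPos y (fstT (τ := τ.neg) z)) (sndT (σ := σ.pos) z)

/-- The evidence `z` is kept and only the pair it applies to has to be chosen. Its location reduces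
products and functions to a component or a value. In a sum, a difference of summands settles the
matter whatever the evidence. At `N` decidability does: if `x = v` then `v` differs from `y`,
otherwise `x` differs from `v`. -/
theorem cmpT_spec : ∀ (σ : Ty) {Γ : Ctx} {w : World} (e : Env w Γ) (x v y : Tm Γ σ.pos)
    (z : Tm Γ σ.neg), A w σ (ev e x) (ev e y) (ev e z) → D w σ (ev e v) →
      (ev e (cmpT σ x v y z) = zero → A w σ (ev e x) (ev e v) (ev e z)) ∧
      (ev e (cmpT σ x v y z) ≠ zero → A w σ (ev e v) (ev e y) (ev e z))
  | Ty.nat, Γ, w, e, x, v, y, z, h, _ => by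
    rw [A_nat] at h
    rw [cmpT, A_nat, A_nat]
    by_cases hx : ev e x = ev e v
    · rw [ev_ite_of_eq _ _ _ (by simpa [neq_eq_zero] using hx), ← hx]
      simpa using h
    · rw [ev_ite_of_ne _ _ _ (by simpa [neq_eq_zero] using hx)]
      simpa using hx
  | Ty.prod σ τ, Γ, w, e, x, v, y, z, h, hv => by
    have hd := (D_prod _).mp hv
    rw [cmpT, ev_cases]
    rcases sum_cases (σ := σ.neg) (τ := τ.neg) (ev e z) with ⟨u, hu⟩ | ⟨u, hu⟩ <;> rw [hu] at h ⊢
    · rw [A_prod_inl] at h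
      rw [A_prod_inl, A_prod_inl, cases_inl, lam_app]
      have := cmpT_spec σ (Env.cons u e) (fstT (τ := τ.pos) x).wk (fstT (τ := τ.pos) v).wk
        (fstT (τ := τ.pos) y).wk v0 (by simpa using h.1) (by simpa using hd.1)
      simp only [ev_wk, ev_fst] at this
      exact ⟨fun h0 => ⟨this.1 h0, h.2.1, hv⟩, fun h0 => ⟨this.2 h0, hv, h.2.2⟩⟩
    · rw [A_prod_inr] at h
      rw [A_prod_inr, A_prod_inr, cases_inr, lam_app]
      have := cmpT_spec τ (Env.cons u e) (sndT (σ := σ.pos) x).wk (sndT (σ := σ.pos) v).wk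
        (sndT (σ := σ.pos) y).wk v0 (by simpa using h.1) (by simpa using hd.2)
      simp only [ev_wk, ev_snd] at this
      exact ⟨fun h0 => ⟨this.1 h0, h.2.1, hv⟩, fun h0 => ⟨this.2 h0, hv, h.2.2⟩⟩
  | Ty.sum σ τ, Γ, w, e, x, v, y, z, h, hv => by
    have hx := h.dom.1
    have hy := h.dom.2
    rw [cmpT, ev_cases]
    rcases sum_cases (σ := σ.pos) (τ := τ.pos) (ev e x) with ⟨a, ha⟩ | ⟨a, ha⟩ <;>
    rcases sum_cases (σ := σ.pos) (τ := τ.pos) (ev e v) with ⟨b, hb⟩ | ⟨b, hb⟩ <;>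
    rw [ha] at h hx ⊢ <;> rw [hb] at hv ⊢
    · rw [cases_inl, lam_app, ev_cases, ev_wk, hb, cases_inl, lam_app, ev_cases, ev_wk, ev_wk]
      rcases sum_cases (σ := σ.pos) (τ := τ.pos) (ev e y) with ⟨c, hc⟩ | ⟨c, hc⟩ <;>
      rw [hc] at h hy ⊢ <;> rw [D_inl] at hv hx
      · rw [D_inl] at hy
        rw [A_inl_inl] at h
        rw [cases_inl, lam_app, A_inl_inl, A_inl_inl]
        have := cmpT_spec σ (Env.cons c (Env.cons b (Env.cons a e))) v2 v1 v0
          (fstT (τ := τ.neg) z).wk.wk.wk (by simpa using h.1) (by simpa using hv)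
        simp only [ev_wk, ev_fst, ev_var, Env.cons_here, Env.cons_there] at this
        exact ⟨fun h0 => ⟨this.1 h0, hx, hv⟩, fun h0 => ⟨this.2 h0, hv, hy⟩⟩
      · rw [D_inr] at hy
        rw [cases_inr, lam_app, A_inl_inr]
        simpa using ⟨hv, hy⟩
    · rw [D_inl] at hx
      rw [D_inr] at hv
      rw [cases_inl, lam_app, ev_cases, ev_wk, hb, cases_inr, lam_app, A_inl_inr]
      simpa using ⟨hx, hv⟩
    · rw [D_inr] at hx
      rw [D_inl] at hv
      rw [cases_inr, lam_app, ev_cases, ev_wk, hb, cases_inl, lam_app, A_inr_inl]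
      simpa using ⟨hx, hv⟩
    · rw [cases_inr, lam_app, ev_cases, ev_wk, hb, cases_inr, lam_app, ev_cases, ev_wk, ev_wk]
      rcases sum_cases (σ := σ.pos) (τ := τ.pos) (ev e y) with ⟨c, hc⟩ | ⟨c, hc⟩ <;>
      rw [hc] at h hy ⊢ <;> rw [D_inr] at hv hx
      · rw [D_inl] at hy
        rw [cases_inl, lam_app, A_inr_inl]
        simpa using ⟨hv, hy⟩
      · rw [D_inr] at hy
        rw [A_inr_inr] at h
        rw [cases_inr, lam_app, A_inr_inr, A_inr_inr]
        have := cmpT_spec τ (Env.cons c (Env.cons b (Env.cons a e))) v2 v1 v0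
          (sndT (σ := σ.neg) z).wk.wk.wk (by simpa using h.1) (by simpa using hv)
        simp only [ev_wk, ev_snd, ev_var, Env.cons_here, Env.cons_there] at this
        exact ⟨fun h0 => ⟨this.1 h0, hx, hv⟩, fun h0 => ⟨this.2 h0, hv, hy⟩⟩
  | Ty.arr σ τ, Γ, w, e, x, v, y, z, h, hv => by
    rw [A_arr] at h
    rw [cmpT, A_arr, A_arr]
    have := cmpT_spec τ e (appPos x (fstT (τ := τ.neg) z)) (appPos v (fstT (τ := τ.neg) z))
      (appPos y (fstT (τ := τ.neg) z)) (sndT (σ := σ.pos) z) h.2.1 (hv.appP h.1)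
    exact ⟨fun h0 => ⟨h.1, this.1 h0, h.2.2.1, hv⟩, fun h0 => ⟨h.1, this.2 h0, hv, h.2.2.2⟩⟩

theorem A.cotrans {σ : Ty} {w : World} {x v y : Obj w σ.pos} {z : Obj w σ.neg}
    (h : A w σ x y z) (hv : D w σ v) : A w σ x v z ∨ A w σ v y z := by
  have := cmpT_spec σ (Env.cons x (Env.cons v (Env.cons y (Env.cons z Env.nil)))) v0 v1 v2 v3 h hv
  exact (em _).imp this.1 this.2

/-! ## The interpretation of the constants -/

section
variable {σ τ ρ : Ty}

/-- The interpretation of `k`. -/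
def kI (σ τ : Ty) : Tm [] (σ ⇒ τ ⇒ σ).pos :=
  funT (σ := σ) (τ := τ ⇒ σ) (funT (σ := τ) (τ := σ) v1 (dflt τ.neg)) (sndT (σ := τ.pos) v0)

theorem kI_app {w : World} (x : Obj w σ.pos) (y : Obj w τ.pos) :
    appP (appP (ev Env.nil (kI σ τ)) x) y = x := by simp [kI]

/-- For fixed `x` the function is constant, so irreflexivity rules out any difference of values and
the default evidence is never used. -/
theorem D_kI (w : World) : D w (σ ⇒ τ ⇒ σ) (ev Env.nil (kI σ τ)) := by
  refine D_funT (fun w₁ m₁ x hx => D_funT (fun w₂ m₂ y hy => ?_) fun w₂ m₂ y y' z hy hy' h => ?_)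
    fun w₁ m₁ x x' z hx hx' h => ?_
  · simpa using hx.map m₂
  · exact absurd h A.irrefl
  · simpa using ((A_arr _ _ _).mp h).2.1

/-- The interpretation of `s`. -/
def sI (σ τ ρ : Ty) : Tm [] ((σ ⇒ τ ⇒ ρ) ⇒ (σ ⇒ τ) ⇒ σ ⇒ ρ).pos :=
  funT (σ := σ ⇒ τ ⇒ ρ) (τ := (σ ⇒ τ) ⇒ σ ⇒ ρ)
    (funT (σ := σ ⇒ τ) (τ := σ ⇒ ρ)
      (funT (σ := σ) (τ := ρ) (appPos (σ := τ) (appPos (σ := σ) (τ := τ ⇒ ρ) v2 v0)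
        (appPos (σ := σ) v1 v0))
        (iteT
          (cmpT ρ (appPos (σ := τ) (appPos (σ := σ) (τ := τ ⇒ ρ) v4 v2) (appPos (σ := σ) v3 v2))
            (appPos (σ := τ) (appPos (σ := σ) (τ := τ ⇒ ρ) v4 v1) (appPos (σ := σ) v3 v2))
            (appPos (σ := τ) (appPos (σ := σ) (τ := τ ⇒ ρ) v4 v1) (appPos (σ := σ) v3 v1)) v0)
          (appNeg (σ := σ) (τ := τ ⇒ ρ) v4 v2 v1
            (pairT (τ := ρ.neg) (appPos (σ := σ) (τ := τ) v3 v2) v0))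
          (appNeg (σ := σ) (τ := τ) v3 v2 v1
            (appNeg (σ := τ) (τ := ρ) (appPos (σ := σ) (τ := τ ⇒ ρ) v4 v1)
              (appPos (σ := σ) v3 v2) (appPos (σ := σ) v3 v1) v0))))
      (pairT (σ := σ.pos) (τ := τ.neg) (fstT (τ := ρ.neg) v0)
        (appNeg (σ := τ) (τ := ρ) (appPos (σ := σ) (τ := τ ⇒ ρ) v3 (fstT (τ := ρ.neg) v0))
          (appPos (σ := σ) v2 (fstT (τ := ρ.neg) v0)) (appPos (σ := σ) v1 (fstT (τ := ρ.neg) v0))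
          (sndT (σ := σ.pos) v0))))
    (let W : Tm [((σ ⇒ τ) ⇒ σ ⇒ ρ).neg, (σ ⇒ τ ⇒ ρ).pos, (σ ⇒ τ ⇒ ρ).pos]
        (Ty.prod (σ ⇒ τ).pos (Ty.prod σ.pos ρ.neg)) := v0;
      pairT (σ := σ.pos) (τ := Ty.prod τ.pos ρ.neg) (fstT (sndT W))
        (pairT (appPos (σ := σ) (fstT W) (fstT (sndT W))) (sndT (sndT W))))

theorem sI_app {w : World} (x : Obj w (σ ⇒ τ ⇒ ρ).pos) (y : Obj w (σ ⇒ τ).pos)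
    (z : Obj w σ.pos) :
    appP (appP (appP (ev Env.nil (sI σ τ ρ)) x) y) z = appP (appP x z) (appP y z) := by
  simp [sI]

/-- The last argument occurs twice, so `x z (y z)` and `x z' (y z')` are both compared with `x z' (y
z)`. A difference on one side is traced through `x`, one on the other side through `x z'` and then
`y`. For varying `x` or `y` the evidence is only rearranged or passed through one function. -/
theorem D_sI (w : World) : D w ((σ ⇒ τ ⇒ ρ) ⇒ (σ ⇒ τ) ⇒ σ ⇒ ρ) (ev Env.nil (sI σ τ ρ)) := by
  refine D_funT (fun w₁ m₁ x hx => D_funT (fun w₂ m₂ y hy => D_funT (fun w₃ m₃ z hz => ?_)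
    fun w₃ m₃ z z' u hz hz' h => ?_) fun w₂ m₂ y y' u hy hy' h => ?_) fun w₁ m₁ x x' u hx hx' h =>
      ?_
  · simpa using (((hx.map m₂).map m₃).appP hz).appP ((hy.map m₃).appP hz)
  · replace hx := (hx.map m₂).map m₃
    replace hy := hy.map m₃
    simp only [Env.map_cons, Env.map_nil, ev_appPos, ev_var, Env.cons_here, Env.cons_there] at h ⊢
    generalize Obj.map m₃ (Obj.map m₂ x) = x at *
    generalize Obj.map m₃ y = y at *
    have hc := cmpT_spec ρ
      (Env.cons u (Env.cons z' (Env.cons z (Env.cons y (Env.cons x Env.nil)))))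
      (appPos (σ := τ) (appPos (σ := σ) (τ := τ ⇒ ρ) v4 v2) (appPos (σ := σ) v3 v2))
      (appPos (σ := τ) (appPos (σ := σ) (τ := τ ⇒ ρ) v4 v1) (appPos (σ := σ) v3 v2))
      (appPos (σ := τ) (appPos (σ := σ) (τ := τ ⇒ ρ) v4 v1) (appPos (σ := σ) v3 v1)) v0 h
      ((hx.appP hz').appP (hy.appP hz))
    by_cases h0 : ev (Env.cons u (Env.cons z' (Env.cons z (Env.cons y (Env.cons x Env.nil)))))
      (cmpT ρ (appPos (σ := τ) (appPos (σ := σ) (τ := τ ⇒ ρ) v4 v2) (appPos (σ := σ) v3 v2))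
      (appPos (σ := τ) (appPos (σ := σ) (τ := τ ⇒ ρ) v4 v1) (appPos (σ := σ) v3 v2))
      (appPos (σ := τ) (appPos (σ := σ) (τ := τ ⇒ ρ) v4 v1) (appPos (σ := σ) v3 v1)) v0) = zero
    · rw [ev_ite_of_eq _ _ _ h0]
      refine hx.appN hz hz' ((A_arr _ _ _).mpr ⟨?_, ?_, hx.appP hz, hx.appP hz'⟩)
      · simpa using hy.appP hz
      · simpa using hc.1 h0
    · rw [ev_ite_of_ne _ _ _ h0]
      exact hy.appN hz hz' ((hx.appP hz').appN (hy.appP hz) (hy.appP hz') (hc.2 h0))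
  · obtain ⟨hz, h, -⟩ := (A_arr _ _ _).mp h
    rw [appP_funT, appP_funT] at h
    replace hx := hx.map m₂
    exact (A_arr _ _ _).mpr ⟨by simpa using hz, by
      simpa using (hx.appP hz).appN (hy.appP hz) (hy'.appP hz) (by simpa using h), hy, hy'⟩
  · obtain ⟨hy, h, -⟩ := (A_arr _ _ _).mp h
    obtain ⟨hz, h, -⟩ := (A_arr _ _ _).mp h
    rw [appP_funT, appP_funT] at h
    refine (A_arr _ _ _).mpr ⟨by simpa using hz, (A_arr _ _ _).mpr ⟨?_, ?_, ?_, ?_⟩, hx, hx'⟩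
    · simpa using hy.appP hz
    · simpa using h
    · simpa using hx.appP hz
    · simpa using hx'.appP hz

/-- The interpretation of `pair`. -/
def pairI (σ τ : Ty) : Tm [] (σ ⇒ τ ⇒ Ty.prod σ τ).pos :=
  funT (σ := σ) (τ := τ ⇒ Ty.prod σ τ)
    (funT (σ := τ) (τ := Ty.prod σ τ) (pairT v1 v0) (outrT (σ := σ.neg) (τ := τ.neg) v0))
    (outlT (τ := τ.neg) (sndT (σ := τ.pos) v0))

theorem pairI_app {w : World} (x : Obj w σ.pos) (y : Obj w τ.pos) :
    appP (appP (ev Env.nil (pairI σ τ)) x) y = pair x y := by simp [pairI]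

/-- When only one component varies, irreflexivity forces the evidence into the matching summand, so
the projection out of the sum does not return its default. -/
theorem D_pairI (w : World) : D w (σ ⇒ τ ⇒ Ty.prod σ τ) (ev Env.nil (pairI σ τ)) := by
  refine D_funT (fun w₁ m₁ x hx => D_funT (fun w₂ m₂ y hy => ?_) fun w₂ m₂ y y' z hy hy' h => ?_)
    fun w₁ m₁ x x' z hx hx' h => ?_
  · exact (D_prod _).mpr ⟨by simpa using hx.map m₂, by simpa using hy⟩
  · rcases sum_cases (σ := σ.neg) (τ := τ.neg) z with ⟨u, rfl⟩ | ⟨u, rfl⟩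
    · exact absurd (by simpa using ((A_prod_inl _ _ _).mp h).1) A.irrefl
    · simpa [outrT] using ((A_prod_inr _ _ _).mp h).1
  · have h' := ((A_arr _ _ _).mp h).2.1
    rw [appP_funT, appP_funT] at h'
    generalize fst (σ := τ.pos) (τ := (Ty.prod σ τ).neg) z = y at h'
    rcases sum_cases (σ := σ.neg) (τ := τ.neg) (snd (σ := τ.pos) z) with ⟨u, hu⟩ | ⟨u, hu⟩ <;>
      rw [hu] at h'
    · simpa [outlT, hu] using ((A_prod_inl _ _ _).mp h').1
    · exact absurd (by simpa using ((A_prod_inr _ _ _).mp h').1) A.irrefl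

/-- The interpretation of `fst`. -/
def fstI (σ τ : Ty) : Tm [] (Ty.prod σ τ ⇒ σ).pos :=
  funT (σ := Ty.prod σ τ) (τ := σ) (fstT (τ := τ.pos) v0) (inlT (τ := τ.neg) v0)

theorem fstI_app {w : World} (x : Obj w (Ty.prod σ.pos τ.pos)) :
    appP (σ := Ty.prod σ τ) (ev Env.nil (fstI σ τ)) x = fst x := by simp [fstI]

theorem D_fstI (w : World) : D w (Ty.prod σ τ ⇒ σ) (ev Env.nil (fstI σ τ)) :=
  D_funT (fun _ _ _ hx => ((D_prod _).mp hx).1)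
    fun _ _ _ _ _ hx hx' h => (A_prod_inl _ _ _).mpr ⟨h, hx, hx'⟩

/-- The interpretation of `snd`. -/
def sndI (σ τ : Ty) : Tm [] (Ty.prod σ τ ⇒ τ).pos :=
  funT (σ := Ty.prod σ τ) (τ := τ) (sndT (σ := σ.pos) v0) (inrT (σ := σ.neg) v0)

theorem sndI_app {w : World} (x : Obj w (Ty.prod σ.pos τ.pos)) :
    appP (σ := Ty.prod σ τ) (ev Env.nil (sndI σ τ)) x = snd x := by simp [sndI]

theorem D_sndI (w : World) : D w (Ty.prod σ τ ⇒ τ) (ev Env.nil (sndI σ τ)) :=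
  D_funT (fun _ _ _ hx => ((D_prod _).mp hx).2)
    fun _ _ _ _ _ hx hx' h => (A_prod_inr _ _ _).mpr ⟨h, hx, hx'⟩

/-- The interpretation of `inl`. -/
def inlI (σ τ : Ty) : Tm [] (σ ⇒ Ty.sum σ τ).pos :=
  funT (σ := σ) (τ := Ty.sum σ τ) (inlT v0) (fstT (τ := τ.neg) v0)

theorem inlI_app {w : World} (x : Obj w σ.pos) :
    appP (τ := Ty.sum σ τ) (ev Env.nil (inlI σ τ)) x = inl (τ := τ.pos) x := by simp [inlI]

theorem D_inlI (w : World) : D w (σ ⇒ Ty.sum σ τ) (ev Env.nil (inlI σ τ)) :=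
  D_funT (fun _ _ _ hx => (D_inl _).mpr hx) fun _ _ _ _ _ _ _ h => ((A_inl_inl _ _ _).mp h).1

/-- The interpretation of `inr`. -/
def inrI (σ τ : Ty) : Tm [] (τ ⇒ Ty.sum σ τ).pos :=
  funT (σ := τ) (τ := Ty.sum σ τ) (inrT v0) (sndT (σ := σ.neg) v0)

theorem inrI_app {w : World} (x : Obj w τ.pos) :
    appP (τ := Ty.sum σ τ) (ev Env.nil (inrI σ τ)) x = inr (σ := σ.pos) x := by simp [inrI]

theorem D_inrI (w : World) : D w (τ ⇒ Ty.sum σ τ) (ev Env.nil (inrI σ τ)) :=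
  D_funT (fun _ _ _ hx => (D_inr _).mpr hx) fun _ _ _ _ _ _ _ h => ((A_inr_inr _ _ _).mp h).1

/-- The interpretation of `succ`. -/
def succI : Tm [] (Ty.nat ⇒ Ty.nat).pos := funT (σ := Ty.nat) (τ := Ty.nat) (succT v0) zeroT

theorem succI_app {w : World} (n : Obj w Ty.nat) :
    appP (σ := Ty.nat) (τ := Ty.nat) (ev Env.nil succI) n = succ n := by simp [succI]

/-- At `N` apartness does not look at the evidence, so the constant `0` will do. -/
theorem D_succI (w : World) : D w (Ty.nat ⇒ Ty.nat) (ev Env.nil succI) :=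
  D_funT (fun _ _ _ _ => D_nat _) fun _ _ _ _ _ _ _ h =>
    (A_nat _ _ _).mpr fun h' => (A_nat _ _ _).mp h (congrArg succ h')

end
end EHA

namespace EHA
open Obj

-- Case distinction and recursion in the domain

section
variable {Γ : Ctx} {σ τ ρ : Ty}

/-- The interpretation of `cases`. -/
def casesI (σ τ ρ : Ty) : Tm [] ((σ ⇒ ρ) ⇒ (τ ⇒ ρ) ⇒ Ty.sum σ τ ⇒ ρ).pos :=
  funT (σ := σ ⇒ ρ) (τ := (τ ⇒ ρ) ⇒ Ty.sum σ τ ⇒ ρ)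
    (funT (σ := τ ⇒ ρ) (τ := Ty.sum σ τ ⇒ ρ)
      (funT (σ := Ty.sum σ τ) (τ := ρ)
        (casesT (σ := σ.pos) (τ := τ.pos) (lam (appPos (σ := σ) v3 v0))
          (lam (appPos (σ := τ) v2 v0)) v0)
        (casesT (σ := σ.pos) (τ := τ.pos)
          (lam (casesT (σ := σ.pos) (τ := τ.pos)
            (lam (pairT
              (appNeg (σ := σ) (τ := ρ) (Tm.var (.there (.there (.there (.there (.there (.there
                .here))))))) v1 v0 v2) (dflt τ.neg)))
            (lam (dflt _)) v2))
          (lam (casesT (σ := σ.pos) (τ := τ.pos) (lam (dflt _))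
            (lam (pairT (dflt σ.neg)
              (appNeg (σ := τ) (τ := ρ) (Tm.var (.there (.there (.there (.there (.there
                .here)))))) v1 v0 v2)))
            v2)) v2))
      (pairT (σ := τ.pos) (τ := ρ.neg)
        (outrT (σ := σ.pos) (τ := τ.pos) (fstT (τ := ρ.neg) v0))
        (sndT (σ := Ty.sum σ.pos τ.pos) v0)))
    (let W : Tm [((τ ⇒ ρ) ⇒ Ty.sum σ τ ⇒ ρ).neg, (σ ⇒ ρ).pos, (σ ⇒ ρ).pos]
        (Ty.prod (τ ⇒ ρ).pos (Ty.prod (Ty.sum σ.pos τ.pos) ρ.neg)) := v0;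
      pairT (σ := σ.pos) (τ := ρ.neg) (outlT (fstT (sndT W))) (sndT (sndT W)))

theorem casesI_inl {w : World} (f : Obj w (σ ⇒ ρ).pos) (g : Obj w (τ ⇒ ρ).pos)
    (x : Obj w σ.pos) :
    appP (σ := Ty.sum σ τ) (appP (appP (ev Env.nil (casesI σ τ ρ)) f) g) (inl (τ := τ.pos) x) =
      appP f x := by
  simp [casesI]

theorem casesI_inr {w : World} (f : Obj w (σ ⇒ ρ).pos) (g : Obj w (τ ⇒ ρ).pos)
    (y : Obj w τ.pos) :
    appP (σ := Ty.sum σ τ) (appP (appP (ev Env.nil (casesI σ τ ρ)) f) g) (inr (σ := σ.pos) y) =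
      appP g y := by
  simp [casesI]

/-- Scrutinees in different summands are apart under any evidence, so defaults may stand there; in
the same summand the chosen branch traces the difference. If only one branch function varies, a
scrutinee in the other summand would give equal values, which irreflexivity excludes. -/
theorem D_casesI (w : World) :
    D w ((σ ⇒ ρ) ⇒ (τ ⇒ ρ) ⇒ Ty.sum σ τ ⇒ ρ) (ev Env.nil (casesI σ τ ρ)) := by
  refine D_funT (fun w₁ m₁ f hf => D_funT (fun w₂ m₂ g hg => D_funT (fun w₃ m₃ x hx => ?_)
    fun w₃ m₃ x x' u hx hx' h => ?_) fun w₂ m₂ g g' u hg hg' h => ?_) fun w₁ m₁ f f' u hf hf' h =>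
      ?_
  · replace hf := (hf.map m₂).map m₃
    replace hg := hg.map m₃
    rcases sum_cases (σ := σ.pos) (τ := τ.pos) x with ⟨a, rfl⟩ | ⟨a, rfl⟩
    · simpa using hf.appP ((D_inl a).mp hx)
    · simpa using hg.appP ((D_inr a).mp hx)
  · replace hf := (hf.map m₂).map m₃
    replace hg := hg.map m₃
    rcases sum_cases (σ := σ.pos) (τ := τ.pos) x with ⟨a, rfl⟩ | ⟨a, rfl⟩ <;>
    rcases sum_cases (σ := σ.pos) (τ := τ.pos) x' with ⟨b, rfl⟩ | ⟨b, rfl⟩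
    · rw [D_inl] at hx hx'
      refine (A_inl_inl _ _ _).mpr ⟨?_, hx, hx'⟩
      simpa using hf.appN hx hx' (by simpa using h)
    · exact (A_inl_inr _ _ _).mpr ⟨(D_inl _).mp hx, (D_inr _).mp hx'⟩
    · exact (A_inr_inl _ _ _).mpr ⟨(D_inr _).mp hx, (D_inl _).mp hx'⟩
    · rw [D_inr] at hx hx'
      refine (A_inr_inr _ _ _).mpr ⟨?_, hx, hx'⟩
      simpa using hg.appN hx hx' (by simpa using h)
  · obtain ⟨hx, h, -⟩ := (A_arr _ _ _).mp h
    rw [appP_funT, appP_funT] at h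
    rcases sum_cases (σ := σ.pos) (τ := τ.pos) (fst (τ := ρ.neg) u) with ⟨a, ha⟩ | ⟨a, ha⟩ <;>
      rw [ha] at h hx
    · exact absurd (by simpa using h) A.irrefl
    · exact (A_arr _ _ _).mpr ⟨by simpa [ha, outrT] using (D_inr _).mp hx,
        by simpa [ha, outrT] using h, hg, hg'⟩
  · obtain ⟨hg, h, -⟩ := (A_arr _ _ _).mp h
    obtain ⟨hx, h, -⟩ := (A_arr _ _ _).mp h
    rw [appP_funT, appP_funT] at h
    rcases sum_cases (σ := σ.pos) (τ := τ.pos) (fst (τ := ρ.neg) (snd (σ := (τ ⇒ ρ).pos) u))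
      with ⟨a, ha⟩ | ⟨a, ha⟩ <;> rw [ha] at h hx
    · exact (A_arr _ _ _).mpr ⟨by simpa [ha, outlT] using (D_inl _).mp hx,
        by simpa [ha, outlT] using h, hf, hf'⟩
    · exact absurd (by simpa using h) A.irrefl

/-! ### Recursion -/

/-- Recursion over an interpreted step function, as a closed term. -/
def recC (σ : Ty) : Tm [] (σ.pos ⇒ (Ty.nat ⇒ σ ⇒ σ).pos ⇒ Ty.nat ⇒ σ.pos) :=
  lam (lam (Tm.con (Con.recur σ.pos) ⬝ v1 ⬝
    lam (lam (appPos (σ := σ) (τ := σ) (appPos (σ := Ty.nat) (τ := σ ⇒ σ) v2 v1) v0))))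

/-- Recursion over an interpreted step function. -/
def recP (a : Tm Γ σ.pos) (f : Tm Γ (Ty.nat ⇒ σ ⇒ σ).pos) (n : Tm Γ Ty.nat) : Tm Γ σ.pos :=
  (recC σ).subst Sub.nil ⬝ a ⬝ f ⬝ n

/-- The value of `recP`. -/
def recO {w : World} (a : Obj w σ.pos) (f : Obj w (Ty.nat ⇒ σ ⇒ σ).pos) (n : Obj w Ty.nat) :
    Obj w σ.pos := (((ev Env.nil (recC σ)).app a).app f).app n

section
variable {w w' : World} (e : Env w Γ)

@[simp] theorem ev_recP (a : Tm Γ σ.pos) (f : Tm Γ (Ty.nat ⇒ σ ⇒ σ).pos) (n : Tm Γ Ty.nat) :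
    ev e (recP a f n) = recO (ev e a) (ev e f) (ev e n) := by
  simp only [recP, ev_app, ev_nil_subst]; rfl

@[simp] theorem recO_zero (a : Obj w σ.pos) (f : Obj w (Ty.nat ⇒ σ ⇒ σ).pos) :
    recO a f zero = a := by
  simp [recO, recC]

@[simp] theorem recO_succ (a : Obj w σ.pos) (f : Obj w (Ty.nat ⇒ σ ⇒ σ).pos) (n : Obj w Ty.nat) :
    recO a f (succ n) = appP (appP (σ := Ty.nat) (τ := σ ⇒ σ) f n) (recO a f n) := by
  simp [recO, recC]

theorem D_recO {a : Obj w σ.pos} {f : Obj w (Ty.nat ⇒ σ ⇒ σ).pos} (ha : D w σ a)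
    (hf : D w (Ty.nat ⇒ σ ⇒ σ) f) (n : Obj w Ty.nat) : D w σ (recO a f n) := by
  have := forces_nat_ind (e := Env.cons f (Env.cons a Env.nil))
    (dom σ (recP v2 v1 v0)) (by simpa using ha) (by
      intro w' m n h
      simp only [forces_dom, ev_recP, ev_var, Env.cons_here, Env.cons_there, Env.map_cons,
        recO_succ] at h ⊢
      exact ((hf.map m).appP (D_nat n)).appP h) n
  simpa using this

/-- The variable with de Bruijn index 5. -/
abbrev v5 {a b c d e f : Ty} : Tm (f :: e :: d :: c :: b :: a :: Γ) a :=
  Tm.var (.there (.there (.there (.there (.there .here)))))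

/-- Evidence that the start values of two recursions are apart. -/
def recStartC (σ : Ty) : Tm [] (σ.pos ⇒ σ.pos ⇒ (Ty.nat ⇒ σ ⇒ σ).pos ⇒ Ty.nat ⇒ σ.neg ⇒ σ.neg) :=
  lam (lam (lam (Tm.con (Con.recur (σ.neg ⇒ σ.neg)) ⬝ lam v0 ⬝
    lam (lam (lam (v1 ⬝ appNeg (σ := σ) (τ := σ) (appPos (σ := Ty.nat) (τ := σ ⇒ σ) v3 v2)
      (recP v5 v3 v2) (recP v4 v3 v2) v0))))))

/-- Evidence that the start values of two recursions are apart. -/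
def recStartT (a a' : Tm Γ σ.pos) (f : Tm Γ (Ty.nat ⇒ σ ⇒ σ).pos) (n : Tm Γ Ty.nat)
    (z : Tm Γ σ.neg) : Tm Γ σ.neg :=
  (recStartC σ).subst Sub.nil ⬝ a ⬝ a' ⬝ f ⬝ n ⬝ z

/-- With the same step function, a difference at `n + 1` is pulled back through `f n` to a
difference at `n`, and so down to the start values. The evidence changes at each stage, hence the
universal quantifier over it in the induction formula. -/
theorem A_recStart {a a' : Obj w σ.pos} {f : Obj w (Ty.nat ⇒ σ ⇒ σ).pos} (ha : D w σ a)
    (ha' : D w σ a') (hf : D w (Ty.nat ⇒ σ ⇒ σ) f) (n : Obj w Ty.nat) (z : Obj w σ.neg)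
    (h : A w σ (recO a f n) (recO a' f n) z) :
    A w σ a a' (((((ev Env.nil (recStartC σ)).app a).app a').app f |>.app n).app z) := by
  have := forces_nat_ind (e := Env.cons f (Env.cons a' (Env.cons a Env.nil)))
    (Fm.all σ.neg (apart σ (recP v4 v2 v1) (recP v3 v2 v1) v0 ⟹
      apart σ v4 v3 (recStartT v4 v3 v2 v1 v0)))
    (by simp [recStartT, ev_app, recStartC]) (by
      intro w₁ m₁ n ih
      simp only [forces_all, forces_imp, forces_apart] at ih ⊢
      intro w₂ m₂ z w₃ m₃ h
      have hf := ((hf.map m₁).map m₂).map m₃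
      have ha := ((ha.map m₁).map m₂).map m₃
      have ha' := ((ha'.map m₁).map m₂).map m₃
      have ih' := fun z => ih w₃ (m₂.comp m₃) z w₃ (Hom.id _)
      simp only [ev_recP, ev_var, Env.cons_here, Env.cons_there, Env.map_cons, map_succ, map_comp,
        map_id, recO_succ, recStartT, ev_app, ev_nil_subst] at h ih' ⊢
      have := ih' _ ((hf.appP (D_nat _)).appN (D_recO ha hf _) (D_recO ha' hf _) h)
      simpa [recStartC] using this) n
  simp only [forces_all, forces_imp, forces_apart] at this
  simpa [recStartT, ev_app] using this w (Hom.id w) z w (Hom.id w) (by simpa using h)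

/-- Decides at which of the two differences between the steps of two recursions `f` and `f'` from
the same start value the evidence `z` is to be used; the variables are `a, f, f', n, r, z`. -/
def recStepCmp (σ : Ty) : Tm [σ.neg, σ.neg ⇒ (Ty.nat ⇒ σ ⇒ σ).neg, Ty.nat, (Ty.nat ⇒ σ ⇒ σ).pos,
    (Ty.nat ⇒ σ ⇒ σ).pos, σ.pos] Ty.nat :=
  cmpT σ
    (appPos (σ := σ) (τ := σ) (appPos (σ := Ty.nat) (τ := σ ⇒ σ) v4 v2) (recP v5 v4 v2))
    (appPos (σ := σ) (τ := σ) (appPos (σ := Ty.nat) (τ := σ ⇒ σ) v4 v2) (recP v5 v3 v2))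
    (appPos (σ := σ) (τ := σ) (appPos (σ := Ty.nat) (τ := σ ⇒ σ) v3 v2) (recP v5 v3 v2)) v0

/-- Evidence that the step functions of two recursions are apart. -/
def recStepC (σ : Ty) : Tm [] (σ.pos ⇒ (Ty.nat ⇒ σ ⇒ σ).pos ⇒ (Ty.nat ⇒ σ ⇒ σ).pos ⇒ Ty.nat ⇒
    σ.neg ⇒ (Ty.nat ⇒ σ ⇒ σ).neg) :=
  lam (lam (lam (Tm.con (Con.recur (σ.neg ⇒ (Ty.nat ⇒ σ ⇒ σ).neg)) ⬝ lam (dflt _) ⬝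
    lam (lam (lam (iteT (recStepCmp σ)
      (v1 ⬝ appNeg (σ := σ) (τ := σ) (appPos (σ := Ty.nat) (τ := σ ⇒ σ) v4 v2)
        (recP v5 v4 v2) (recP v5 v3 v2) v0)
      (pairT (σ := Ty.nat) (τ := Ty.prod σ.pos σ.neg) v2 (pairT (recP v5 v3 v2) v0))))))))

/-- A single unfolding that leaves the conditional intact, so that the two outcomes of the
comparison can be treated separately. -/
theorem recStepC_succ (a : Obj w σ.pos) (f f' : Obj w (Ty.nat ⇒ σ ⇒ σ).pos) (n : Obj w Ty.nat)
    (z : Obj w σ.neg) :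
    (((((ev Env.nil (recStepC σ)).app a).app f).app f').app (succ n)).app z =
      ev (Env.cons z (Env.cons (((((ev Env.nil (recStepC σ)).app a).app f).app f').app n)
        (Env.cons n (Env.cons f' (Env.cons f (Env.cons a Env.nil))))))
        (iteT (recStepCmp σ)
          (v1 ⬝ appNeg (σ := σ) (τ := σ) (appPos (σ := Ty.nat) (τ := σ ⇒ σ) v4 v2)
            (recP v5 v4 v2) (recP v5 v3 v2) v0)
          (pairT (σ := Ty.nat) (τ := Ty.prod σ.pos σ.neg) v2 (pairT (recP v5 v3 v2) v0))) := by
  simp only [recStepC, lam_app, ev_app (Γ := _ :: _), ev_con, con_recur_app, recur_succ]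

/-- Evidence that the step functions of two recursions are apart. -/
def recStepT (a : Tm Γ σ.pos) (f f' : Tm Γ (Ty.nat ⇒ σ ⇒ σ).pos) (n : Tm Γ Ty.nat)
    (z : Tm Γ σ.neg) : Tm Γ (Ty.nat ⇒ σ ⇒ σ).neg :=
  (recStepC σ).subst Sub.nil ⬝ a ⬝ f ⬝ f' ⬝ n ⬝ z

/-- Let `r` and `r'` be the two values at `n`. Then `f n r` and `f' n r'` are compared with `f n
r'`: either the difference is pulled back through `f n` to stage `n`, or the step functions already
differ at `n` and `r'`. -/
theorem A_recStep {a : Obj w σ.pos} {f f' : Obj w (Ty.nat ⇒ σ ⇒ σ).pos} (ha : D w σ a)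
    (hf : D w (Ty.nat ⇒ σ ⇒ σ) f) (hf' : D w (Ty.nat ⇒ σ ⇒ σ) f') (n : Obj w Ty.nat)
    (z : Obj w σ.neg) (h : A w σ (recO a f n) (recO a f' n) z) :
    A w (Ty.nat ⇒ σ ⇒ σ) f f'
      (((((ev Env.nil (recStepC σ)).app a).app f).app f' |>.app n).app z) := by
  have := forces_nat_ind (e := Env.cons f' (Env.cons f (Env.cons a Env.nil)))
    (Fm.all σ.neg (apart σ (recP v4 v3 v1) (recP v4 v2 v1) v0 ⟹
      apart (Ty.nat ⇒ σ ⇒ σ) v3 v2 (recStepT v4 v3 v2 v1 v0)))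
    (by
      simp only [forces_all, forces_imp, forces_apart]
      intro w₁ m₁ z w₂ m₂ h
      simp only [ev_recP, ev_var, Env.cons_here, Env.cons_there, Env.map_cons, map_zero,
        recO_zero] at h
      -- At stage zero both recursions return `a`, so the default in the base case of `recStepC` is
      -- harmless.
      exact absurd h A.irrefl) (by
      intro w₁ m₁ n ih
      simp only [forces_all, forces_imp, forces_apart] at ih ⊢
      intro w₂ m₂ z w₃ m₃ h
      have hf := ((hf.map m₁).map m₂).map m₃
      have hf' := ((hf'.map m₁).map m₂).map m₃
      have ha := ((ha.map m₁).map m₂).map m₃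
      have ih' := fun z => ih w₃ (m₂.comp m₃) z w₃ (Hom.id _)
      simp only [ev_recP, ev_var, Env.cons_here, Env.cons_there, Env.map_cons, map_succ, map_comp,
        map_id, recO_succ, recStepT, ev_app, ev_nil_subst] at h ih' ⊢
      generalize Obj.map m₃ (Obj.map m₂ (Obj.map m₁ f)) = f at *
      generalize Obj.map m₃ (Obj.map m₂ (Obj.map m₁ f')) = f' at *
      generalize Obj.map m₃ (Obj.map m₂ (Obj.map m₁ a)) = a at *
      generalize Obj.map m₃ (Obj.map m₂ n) = n at *
      generalize Obj.map m₃ z = z at *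
      have hr := D_recO ha hf n
      have hr' := D_recO ha hf' n
      rw [recStepC_succ]
      generalize ((((ev Env.nil (recStepC σ)).app a).app f).app f').app n = r at *
      have hc := cmpT_spec σ
        (Env.cons z (Env.cons r (Env.cons n (Env.cons f' (Env.cons f (Env.cons a Env.nil))))))
        (appPos (σ := σ) (τ := σ) (appPos (σ := Ty.nat) (τ := σ ⇒ σ) v4 v2) (recP v5 v4 v2))
        (appPos (σ := σ) (τ := σ) (appPos (σ := Ty.nat) (τ := σ ⇒ σ) v4 v2) (recP v5 v3 v2))
        (appPos (σ := σ) (τ := σ) (appPos (σ := Ty.nat) (τ := σ ⇒ σ) v3 v2) (recP v5 v3 v2)) v0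
        (by simpa using h) (by simpa using (hf.appP (D_nat n)).appP hr')
      by_cases h0 : ev (Env.cons z (Env.cons r (Env.cons n (Env.cons f' (Env.cons f
        (Env.cons a Env.nil)))))) (recStepCmp σ) = zero
      · rw [ev_ite_of_eq _ _ _ h0]
        have := hc.1 h0
        have hz := (hf.appP (D_nat n)).appN hr hr' (by simpa using this)
        simpa only [ev_app, ev_appNeg, ev_appPos, ev_recP, ev_var, Env.cons_here, Env.cons_there]
          using ih' _ hz
      · rw [ev_ite_of_ne _ _ _ h0]
        have := hc.2 h0
        refine (A_arr _ _ _).mpr ⟨D_nat _, (A_arr _ _ _).mpr ⟨?_, ?_, ?_, ?_⟩, hf, hf'⟩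
        · simpa using hr'
        · simpa using this
        · simpa using hf.appP (D_nat n)
        · simpa using hf'.appP (D_nat n)) n
  simp only [forces_all, forces_imp, forces_apart] at this
  simpa [recStepT, ev_app] using this w (Hom.id w) z w (Hom.id w) (by simpa using h)

end

/-- The interpretation of `recur`. -/
def recI (σ : Ty) : Tm [] (σ ⇒ (Ty.nat ⇒ σ ⇒ σ) ⇒ Ty.nat ⇒ σ).pos :=
  funT (σ := σ) (τ := (Ty.nat ⇒ σ ⇒ σ) ⇒ Ty.nat ⇒ σ)
    (funT (σ := Ty.nat ⇒ σ ⇒ σ) (τ := Ty.nat ⇒ σ)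
      (funT (σ := Ty.nat) (τ := σ) (recP v2 v1 v0) zeroT)
      (recStepT v3 v2 v1 (fstT (σ := Ty.nat) (τ := σ.neg) v0) (sndT (σ := Ty.nat) v0)))
    (let W : Tm [((Ty.nat ⇒ σ ⇒ σ) ⇒ Ty.nat ⇒ σ).neg, σ.pos, σ.pos]
        (Ty.prod (Ty.nat ⇒ σ ⇒ σ).pos (Ty.prod Ty.nat σ.neg)) := v0;
      recStartT v2 v1 (fstT W) (fstT (sndT W)) (sndT (sndT W)))

theorem recI_app {w : World} (a : Obj w σ.pos) (f : Obj w (Ty.nat ⇒ σ ⇒ σ).pos)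
    (n : Obj w Ty.nat) :
    appP (σ := Ty.nat) (appP (appP (ev Env.nil (recI σ)) a) f) n = recO a f n := by
  simp [recI]

/-- Each argument varies separately: the number (where any evidence works), the step function
(`A_recStep`) and the start value (`A_recStart`). -/
theorem D_recI (w : World) : D w (σ ⇒ (Ty.nat ⇒ σ ⇒ σ) ⇒ Ty.nat ⇒ σ) (ev Env.nil (recI σ)) := by
  refine D_funT (fun w₁ m₁ a ha => D_funT (fun w₂ m₂ f hf => D_funT (fun w₃ m₃ n hn => ?_)
    fun w₃ m₃ n n' u hn hn' h => ?_) fun w₂ m₂ f f' u hf hf' h => ?_) fun w₁ m₁ a a' u ha ha' h =>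
      ?_
  · simpa using D_recO ((ha.map m₂).map m₃) (hf.map m₃) n
  · refine (A_nat _ _ _).mpr ?_
    rintro rfl
    exact absurd h A.irrefl
  · obtain ⟨hn, h, -⟩ := (A_arr _ _ _).mp h
    rw [appP_funT, appP_funT] at h
    have := A_recStep (ha.map m₂) hf hf' (fst (σ := Ty.nat) (τ := σ.neg) u)
      (snd (σ := Ty.nat) (τ := σ.neg) u) (by simpa using h)
    simp only [recStepT, ev_app, ev_nil_subst]
    exact this
  · obtain ⟨hf, h, -⟩ := (A_arr _ _ _).mp h
    obtain ⟨hn, h, -⟩ := (A_arr _ _ _).mp h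
    rw [appP_funT, appP_funT] at h
    have := A_recStart ha ha' hf _ _ (by simpa using h)
    simp only [recStartT, ev_app, ev_nil_subst]
    exact this

-- The correct assignment assembled

/-- A correct assignment. -/
def stdInterp : ConInterp
  | _, .k σ τ => kI σ τ
  | _, .s σ τ ρ => sI σ τ ρ
  | _, .pair σ τ => pairI σ τ
  | _, .fst σ τ => fstI σ τ
  | _, .snd σ τ => sndI σ τ
  | _, .inl σ τ => inlI σ τ
  | _, .inr σ τ => inrI σ τ
  | _, .cases σ τ ρ => casesI σ τ ρ
  | _, .zero => zeroT
  | _, .succ => succI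
  | _, .recur σ => recI σ

theorem thm_eq {s t : Tm Γ σ} (h : ∀ (w : World) (e : Env w Γ), ev e s = ev e t) :
    Thm HA (s ≐ t) := thm_of_forces fun w e => (forces_eq _ _ _).mpr (h w e)

@[simp] theorem ev_conInterp (I : ConInterp) {w : World} (e : Env w Γ) (c : Con σ) :
    ev e (I.tm c) = ev Env.nil (I σ c) := ev_nil_subst _ _

theorem stdInterp_correct : stdInterp.Correct where
  inDom {σ} c := thm_of_forces fun w e => by
    rw [forces_dom, Env.eq_nil e]
    cases c with
    | k σ τ => exact D_kI w
    | s σ τ ρ => exact D_sI w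
    | pair σ τ => exact D_pairI w
    | fst σ τ => exact D_fstI w
    | snd σ τ => exact D_sndI w
    | inl σ τ => exact D_inlI w
    | inr σ τ => exact D_inrI w
    | cases σ τ ρ => exact D_casesI w
    | zero => exact D_nat _
    | succ => exact D_succI w
    | recur σ => exact D_recI w
  zero := thm_eq fun w e => by rw [ev_conInterp]; rfl
  succ n := thm_eq fun w e => by rw [ev_appPos, ev_conInterp]; exact succI_app _
  pair x y := thm_eq fun w e => by
    rw [ev_appPos, ev_appPos, ev_conInterp]; exact pairI_app _ _
  fst p := thm_eq fun w e => by rw [ev_appPos, ev_conInterp]; exact fstI_app _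
  snd p := thm_eq fun w e => by rw [ev_appPos, ev_conInterp]; exact sndI_app _
  inl x := thm_eq fun w e => by rw [ev_appPos, ev_conInterp]; exact inlI_app _
  inr x := thm_eq fun w e => by rw [ev_appPos, ev_conInterp]; exact inrI_app _
  k x y := thm_eq fun w e => by rw [ev_appPos, ev_appPos, ev_conInterp]; exact kI_app _ _
  s x y z := thm_eq fun w e => by
    rw [ev_appPos, ev_appPos, ev_appPos, ev_conInterp]; exact sI_app _ _ _
  casesInl f g x := thm_eq fun w e => by
    rw [ev_appPos, ev_appPos, ev_appPos, ev_conInterp]; exact casesI_inl _ _ _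
  casesInr f g x := thm_eq fun w e => by
    rw [ev_appPos, ev_appPos, ev_appPos, ev_conInterp]; exact casesI_inr _ _ _
  recZero a f := thm_eq fun w e => by
    rw [ev_appPos, ev_appPos, ev_appPos, ev_conInterp]; exact (recI_app _ _ _).trans (recO_zero _ _)
  recSucc a f n := thm_eq fun w e => by
    simp only [ev_appPos, ev_conInterp]
    exact (recI_app _ _ _).trans ((recO_succ _ _ _).trans (by rw [← recI_app]; rfl))

end
end EHA

namespace EHA
open Obj

/-! ## The witness for converse extensionality -/

section
variable {Γ : Ctx} {w w' : World}

/-- The type of functions on the numbers. -/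
abbrev NN : Ty := Ty.nat ⇒ Ty.nat

/-- The shift `f ↦ (n ↦ f (n + 1))`, as a closed term. -/
def shiftC : Tm [] (NN ⇒ NN) := lam (lam (v1 ⬝ succT v0))

/-- The shift of a function. -/
def shiftO (f : Obj w NN) : Obj w NN := (ev Env.nil shiftC).app f

@[simp] theorem shiftO_app (f : Obj w NN) (n : Obj w Ty.nat) :
    (shiftO f).app n = f.app (succ n) := by simp [shiftO, shiftC]

/-- The search for the first argument at which two functions differ, with a bound for it. -/
def searchC : Tm [] (Ty.nat ⇒ NN ⇒ NN ⇒ Ty.nat) :=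
  Tm.con (Con.recur (NN ⇒ NN ⇒ Ty.nat)) ⬝ lam (lam zeroT) ⬝
    lam (lam (lam (lam (iteT (neqT (v1 ⬝ zeroT) (v0 ⬝ zeroT))
      (succT (v2 ⬝ (shiftC.subst Sub.nil ⬝ v1) ⬝ (shiftC.subst Sub.nil ⬝ v0))) zeroT))))

/-- The first argument up to `n` at which `f` and `g` differ. -/
def searchT (f g : Tm Γ NN) (n : Tm Γ Ty.nat) : Tm Γ Ty.nat :=
  searchC.subst Sub.nil ⬝ n ⬝ f ⬝ g

/-- The value of `searchT`. -/
def searchO (f g : Obj w NN) (n : Obj w Ty.nat) : Obj w Ty.nat :=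
  (((ev Env.nil searchC).app n).app f).app g

@[simp] theorem ev_search (e : Env w Γ) (f g : Tm Γ NN) (n : Tm Γ Ty.nat) :
    ev e (searchT f g n) = searchO (ev e f) (ev e g) (ev e n) := by
  simp only [searchT, ev_app, ev_nil_subst]; rfl

@[simp] theorem searchO_zero (f g : Obj w NN) : searchO f g zero = zero := by
  simp [searchO, searchC]

theorem searchO_succ (f g : Obj w NN) (n : Obj w Ty.nat) :
    searchO f g (succ n) = ev (Env.cons g (Env.cons f (Env.cons ((ev Env.nil searchC).app n)
      (Env.cons n Env.nil)))) (iteT (neqT (v1 ⬝ zeroT) (v0 ⬝ zeroT))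
      (succT (v2 ⬝ (shiftC.subst Sub.nil ⬝ v1) ⬝ (shiftC.subst Sub.nil ⬝ v0))) zeroT) := by
  simp only [searchO, searchC, lam_app, ev_app (Γ := []), ev_con, con_recur_app, recur_succ]

theorem searchO_succ_of_eq {f g : Obj w NN} (n : Obj w Ty.nat) (h : f.app zero = g.app zero) :
    searchO f g (succ n) = succ (searchO (shiftO f) (shiftO g) n) := by
  rw [searchO_succ, ev_ite_of_eq _ _ _ (by simpa [neq_eq_zero] using h)]
  simp only [ev_app, ev_nil_subst]; rfl

theorem searchO_succ_of_ne {f g : Obj w NN} (n : Obj w Ty.nat) (h : f.app zero ≠ g.app zero) :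
    searchO f g (succ n) = zero := by
  rw [searchO_succ, ev_ite_of_ne _ _ _ (by simpa [neq_eq_zero] using h)]; rfl

/-- The search returns the bound when it meets no difference earlier, so it always ends at a
difference if the bound is one. -/
theorem searchO_ne {f g : Obj w NN} {n : Obj w Ty.nat} (h : f.app n ≠ g.app n) :
    f.app (searchO f g n) ≠ g.app (searchO f g n) := by
  -- The functions must be generalised because the inductive step replaces them by their shifts;
  -- packing them into a pair lets one quantifier do this.
  have := forces_nat_ind (e := Env.nil) (Fm.all (Ty.prod NN NN)
    (fstT v0 ⬝ searchT (fstT v0) (sndT v0) v1 ≐ sndT v0 ⬝ searchT (fstT v0) (sndT v0) v1 ⟹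
      fstT v0 ⬝ v1 ≐ sndT v0 ⬝ v1)) (by simp) (by
      intro w₁ m₁ n ih
      simp only [forces_all, forces_imp, forces_eq] at ih ⊢
      intro w₂ m₂ p w₃ m₃ h
      have ih' := fun p => ih w₃ (m₂.comp m₃) p w₃ (Hom.id _)
      simp only [ev_search, ev_app, ev_con, con_fst_app, con_snd_app, ev_var, Env.cons_here,
          Env.cons_there,
        Env.map_cons, map_succ, map_comp, map_id] at h ih' ⊢
      by_cases h0 : (fst (p.map m₃)).app zero = (snd (p.map m₃)).app zero
      · rw [searchO_succ_of_eq _ h0] at h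
        simpa using ih' (pair (shiftO (fst (p.map m₃))) (shiftO (snd (p.map m₃))))
            (by simpa using h)
      · rw [searchO_succ_of_ne _ h0] at h
        exact absurd h h0) n
  simp only [forces_all, forces_imp, forces_eq] at this
  intro h'
  have := this w (Hom.id w) (pair f g) w (Hom.id w) (by simpa using h')
  exact h (by simpa using this)

/-- Results of the search are fixed points of it, and a fixed point is a number before which `f` and
`g` agree. This expresses minimality without an order on the numbers. -/
theorem searchO_idem (f g : Obj w NN) (n : Obj w Ty.nat) :
    searchO f g (searchO f g n) = searchO f g n := by
  have := forces_nat_ind (e := Env.nil) (Fm.all (Ty.prod NN NN)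
    (searchT (fstT v0) (sndT v0) (searchT (fstT v0) (sndT v0) v1) ≐
      searchT (fstT v0) (sndT v0) v1)) (by simp) (by
      intro w₁ m₁ n ih
      simp only [forces_all, forces_eq] at ih ⊢
      intro w₂ m₂ p
      have ih' := fun p => ih w₂ m₂ p
      simp only [ev_search, ev_fst, ev_snd, ev_var, Env.cons_here, Env.cons_there,
        Env.map_cons, map_succ] at ih' ⊢
      by_cases h0 : (fst p).app zero = (snd p).app zero
      · rw [searchO_succ_of_eq _ h0, searchO_succ_of_eq _ h0]
        simpa using ih' (pair (shiftO (fst p)) (shiftO (snd p)))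
      · rw [searchO_succ_of_ne _ h0, searchO_zero]) n
  simp only [forces_all, forces_eq] at this
  simpa using this w (Hom.id w) (pair f g)

/-- Suppose both pairs differ at their fixed points. If `n` came before `n'`, the difference of `f`
and `g` at `n` would be one of `f'` and `g'`, too early for `n'` to be a fixed point; likewise with
the roles exchanged. The conclusion is a disjunction so that the induction formula stays free of
negations. -/
theorem fixed_unique {f g f' g' : Obj w NN} {n n' : Obj w Ty.nat} (hn : searchO f g n = n)
    (hn' : searchO f' g' n' = n') (hf : f.app n = f'.app n) (hg : g.app n = g'.app n)
    (hf' : f.app n' = f'.app n') (hg' : g.app n' = g'.app n') :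
    n = n' ∨ f.app n = g.app n ∨ f'.app n' = g'.app n' := by
  have := forces_nat_ind (e := Env.nil) (Fm.all (Ty.prod NN (Ty.prod NN (Ty.prod NN
      (Ty.prod NN Ty.nat))))
    (let f := fstT v0
     let g := fstT (sndT v0)
     let f' := fstT (sndT (sndT v0))
     let g' := fstT (sndT (sndT (sndT v0)))
     let n' := sndT (sndT (sndT (sndT v0)))
     (searchT f g v1 ≐ v1 ⋏ searchT f' g' n' ≐ n' ⋏ f ⬝ v1 ≐ f' ⬝ v1 ⋏ g ⬝ v1 ≐ g' ⬝ v1 ⋏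
      f ⬝ n' ≐ f' ⬝ n' ⋏ g ⬝ n' ≐ g' ⬝ n') ⟹
        v1 ≐ n' ⋎ f ⬝ v1 ≐ g ⬝ v1 ⋎ f' ⬝ n' ≐ g' ⬝ n')) (by
      simp only [forces_all, forces_imp, forces_eq, forces_or, forces_and]
      intro w₂ m₂ p w₃ m₃ ⟨_, h₁, h₂, h₃, h₄, h₅⟩
      simp only [ev_search, ev_app, ev_con, con_fst_app, con_snd_app, ev_var, Env.cons_here,
          Env.cons_there,
        Env.map_cons, map_zero] at h₁ h₂ h₃ h₄ h₅ ⊢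
      generalize p.map m₃ = p at *
      generalize fst p = f at *
      generalize fst (snd p) = g at *
      generalize fst (snd (snd p)) = f' at *
      generalize fst (snd (snd (snd p))) = g' at *
      generalize snd (snd (snd (snd p))) = n' at *
      rcases nat_cases n' with rfl | ⟨k, rfl⟩
      · exact .inl rfl
      · by_cases h0 : f.app zero = g.app zero
        · exact .inr (.inl h0)
        · rw [searchO_succ_of_ne _ (by rwa [← h₂, ← h₃])] at h₁
          simp at h₁) (by
      intro w₁ m₁ n ih
      simp only [forces_all, forces_imp, forces_eq, forces_or, forces_and] at ih ⊢
      intro w₂ m₂ p w₃ m₃ ⟨h₀, h₁, h₂, h₃, h₄, h₅⟩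
      have ih' := fun p => ih w₃ (m₂.comp m₃) p w₃ (Hom.id _)
      clear ih
      simp only [ev_search, ev_app, ev_con, con_fst_app, con_snd_app, ev_var, Env.cons_here,
          Env.cons_there,
        Env.map_cons, map_succ, map_comp, map_id] at h₀ h₁ h₂ h₃ h₄ h₅ ih' ⊢
      generalize p.map m₃ = p at *
      generalize fst p = f at *
      generalize fst (snd p) = g at *
      generalize fst (snd (snd p)) = f' at *
      generalize fst (snd (snd (snd p))) = g' at *
      generalize snd (snd (snd (snd p))) = n' at *
      generalize Obj.map m₃ (Obj.map m₂ n) = n at *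
      by_cases h0 : f.app zero = g.app zero
      · rw [searchO_succ_of_eq _ h0, succ_inj] at h₀
        rcases nat_cases n' with rfl | ⟨k, rfl⟩
        -- Here `n'` is zero, where `f` and `g` agree, and hence so do `f'` and `g'`.
        · exact .inr (.inr (by rw [← h₄, ← h₅, h0]))
        · by_cases h0' : f'.app zero = g'.app zero
          · rw [searchO_succ_of_eq _ h0', succ_inj] at h₁
            have := ih' (pair (shiftO f) (pair (shiftO g) (pair (shiftO f') (pair (shiftO g') k))))
            simp only [fst_pair, snd_pair, shiftO_app] at this
            rw [succ_inj]
            exact this ⟨h₀, h₁, h₂, h₃, h₄, h₅⟩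
          · rw [searchO_succ_of_ne _ h0'] at h₁
            simp at h₁
      · rw [searchO_succ_of_ne _ h0] at h₀
        simp at h₀) n
  simp only [forces_all, forces_imp, forces_eq, forces_or, forces_and] at this
  replace this := this w (Hom.id w) (pair f (pair g (pair f' (pair g' n')))) w (Hom.id w)
  simp only [ev_search, ev_app, ev_con, con_fst_app, con_snd_app, ev_var, Env.cons_here,
      Env.cons_there,
    Env.map_cons, map_id, fst_pair, snd_pair] at this
  exact this ⟨hn, hn', hf, hg, hf', hg'⟩

/-- The first difference does not depend on the bounds, and it depends on the functions only through
their values at the two results. -/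
theorem searchO_unique {f g f' g' : Obj w NN} {b b' : Obj w Ty.nat} (hb : f.app b ≠ g.app b)
    (hb' : f'.app b' ≠ g'.app b') (hf : f.app (searchO f g b) = f'.app (searchO f g b))
    (hg : g.app (searchO f g b) = g'.app (searchO f g b))
    (hf' : f.app (searchO f' g' b') = f'.app (searchO f' g' b'))
    (hg' : g.app (searchO f' g' b') = g'.app (searchO f' g' b')) :
    searchO f g b = searchO f' g' b' :=
  (fixed_unique (searchO_idem _ _ _) (searchO_idem _ _ _) hf hg hf' hg').resolve_right
    (not_or.mpr ⟨searchO_ne hb, searchO_ne hb'⟩)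

/-! ### Apartness of functions from a difference of their values -/

/-- The type of functionals. -/
abbrev Fn : Ty := NN ⇒ Ty.nat

/-- An argument at which `f` and `g` differ, if `Φ f` and `Φ g` differ. -/
def diffT (Φ : Tm Γ Fn.pos) (f g : Tm Γ NN.pos) : Tm Γ Ty.nat :=
  fstT (σ := Ty.nat) (τ := Ty.nat) (appNeg (σ := NN) (τ := Ty.nat) Φ f g zeroT)

/-- The value of `diffT`. -/
def diffO (Φ : Obj w Fn.pos) (f g : Obj w NN.pos) : Obj w Ty.nat :=
  fst (σ := Ty.nat) (τ := Ty.nat) (appN (σ := NN) (τ := Ty.nat) Φ f g zero)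

@[simp] theorem ev_diff (e : Env w Γ) (Φ : Tm Γ Fn.pos) (f g : Tm Γ NN.pos) :
    ev e (diffT Φ f g) = diffO (ev e Φ) (ev e f) (ev e g) := rfl

/-- The underlying function. -/
def fnO (f : Obj w NN.pos) : Obj w NN := fst (σ := NN) (τ := Ty.nat ⇒ Ty.nat ⇒ Ty.nat ⇒ Ty.nat) f

/-- The underlying function. -/
def fnT (f : Tm Γ NN.pos) : Tm Γ NN := fstT (σ := NN) (τ := Ty.nat ⇒ Ty.nat ⇒ Ty.nat ⇒ Ty.nat) f

@[simp] theorem ev_fn (e : Env w Γ) (f : Tm Γ NN.pos) : ev e (fnT f) = fnO (ev e f) := rfl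

/-- The evidence transformation of `Φ` already is a modulus of converse extensionality. The evidence
fed into it is `0`, since at `N` its value is irrelevant. -/
theorem diffO_ne {Φ : Obj w Fn.pos} {f g : Obj w NN.pos} (hΦ : D w Fn Φ) (hf : D w NN f)
    (hg : D w NN g)
    (h : appP (σ := NN) (τ := Ty.nat) Φ f ≠ appP (σ := NN) (τ := Ty.nat) Φ g) :
    (fnO f).app (diffO Φ f g) ≠ (fnO g).app (diffO Φ f g) :=
  (A_nat _ _ _).mp ((A_arr _ _ _).mp
    (hΦ.appN hf hg (z := zero) ((A_nat _ _ _).mpr h))).2.1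

/-- The first argument at which `f` and `g` differ, if `Φ f` and `Φ g` differ. -/
def ceT (Φ : Tm Γ Fn.pos) (f g : Tm Γ NN.pos) : Tm Γ Ty.nat :=
  iteT (neqT (appPos (σ := NN) (τ := Ty.nat) Φ f) (appPos (σ := NN) (τ := Ty.nat) Φ g)) zeroT
    (searchT (fnT f) (fnT g) (diffT Φ f g))

open Classical in
/-- The value of `ceT`. -/
noncomputable def ceO (Φ : Obj w Fn.pos) (f g : Obj w NN.pos) : Obj w Ty.nat :=
  if appP (σ := NN) (τ := Ty.nat) Φ f = appP (σ := NN) (τ := Ty.nat) Φ g then zero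
  else searchO (fnO f) (fnO g) (diffO Φ f g)

theorem ev_ite_neq {σ : Ty} (e : Env w Γ) (s t : Tm Γ Ty.nat) (a b : Tm Γ σ)
    [Decidable (ev e s = ev e t)] :
    ev e (iteT (neqT s t) a b) = if ev e s = ev e t then ev e a else ev e b := by
  split_ifs with h
  · exact ev_ite_of_eq _ _ _ (by rw [ev_neq, neq_eq_zero, h])
  · exact ev_ite_of_ne _ _ _ (by rwa [ev_neq, Ne, neq_eq_zero])

@[simp] theorem ev_ce (e : Env w Γ) (Φ : Tm Γ Fn.pos) (f g : Tm Γ NN.pos) :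
    ev e (ceT Φ f g) = ceO (ev e Φ) (ev e f) (ev e g) := by
  classical
  rw [ceT, ev_ite_neq, ceO]
  simp only [ev_appPos, ev_zero, ev_search, ev_fn, ev_diff]

theorem ceO_ne {Φ : Obj w Fn.pos} {f g : Obj w NN.pos} (hΦ : D w Fn Φ) (hf : D w NN f)
    (hg : D w NN g)
    (h : appP (σ := NN) (τ := Ty.nat) Φ f ≠ appP (σ := NN) (τ := Ty.nat) Φ g) :
    (fnO f).app (ceO Φ f g) ≠ (fnO g).app (ceO Φ f g) := by
  rw [ceO, if_neg h]
  exact searchO_ne (diffO_ne hΦ hf hg h)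

/-- The witness is determined by two values of the functional and by the values of the functions at
the two results. As all of these are numbers, different results can be traced by decidable tests to
one of these data. The default `0` makes the case `Φ f = Φ g` independent of the representation too.
-/
theorem ceO_eq {Φ Φ' : Obj w Fn.pos} {f g f' g' : Obj w NN.pos} (hΦ : D w Fn Φ)
    (hΦ' : D w Fn Φ') (hf : D w NN f) (hg : D w NN g) (hf' : D w NN f') (hg' : D w NN g')
    (h₁ : appP (σ := NN) (τ := Ty.nat) Φ f = appP (σ := NN) (τ := Ty.nat) Φ' f')
    (h₂ : appP (σ := NN) (τ := Ty.nat) Φ g = appP (σ := NN) (τ := Ty.nat) Φ' g')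
    (h₃ : (fnO f).app (ceO Φ f g) = (fnO f').app (ceO Φ f g))
    (h₄ : (fnO g).app (ceO Φ f g) = (fnO g').app (ceO Φ f g))
    (h₅ : (fnO f).app (ceO Φ' f' g') = (fnO f').app (ceO Φ' f' g'))
    (h₆ : (fnO g).app (ceO Φ' f' g') = (fnO g').app (ceO Φ' f' g')) :
    ceO Φ f g = ceO Φ' f' g' := by
  by_cases h : appP (σ := NN) (τ := Ty.nat) Φ f = appP (σ := NN) (τ := Ty.nat) Φ g
  · rw [ceO, ceO, if_pos h, if_pos (by rw [← h₁, ← h₂, h])]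
  · have h' := h
    rw [h₁, h₂] at h'
    rw [ceO, if_neg h] at h₃ h₄
    rw [ceO, if_neg h'] at h₅ h₆
    rw [ceO, ceO, if_neg h, if_neg h']
    exact searchO_unique (diffO_ne hΦ hf hg h) (diffO_ne hΦ' hf' hg' h') h₃ h₄ h₅ h₆

/-- Evidence that `f` and `f'` are apart, if `ceT Φ` differs at `f, g` and at `f', g` with values
`n` and `n'`. -/
def argT (Φ : Tm Γ Fn.pos) (f f' : Tm Γ NN.pos) (n n' : Tm Γ Ty.nat) : Tm Γ NN.neg :=
  pairT (σ := Ty.nat) (τ := Ty.nat)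
    (iteT (neqT (appPos (σ := NN) (τ := Ty.nat) Φ f) (appPos (σ := NN) (τ := Ty.nat) Φ f'))
      (iteT (neqT (fnT f ⬝ n) (fnT f' ⬝ n)) n' n) (diffT Φ f f')) zeroT

/-- Three candidates for a difference of `h` and `h'` are tried: the one supplied by `Ψ` if it
separates them, then `n`, and `n'` as the last resort. The objects are kept apart from the terms by
equations so that they may be given in transported form. -/
theorem A_argT {e : Env w Γ} {Φ : Tm Γ Fn.pos} {f f' : Tm Γ NN.pos} {n n' : Tm Γ Ty.nat}
    {Ψ : Obj w Fn.pos} {h h' : Obj w NN.pos} (hΨ : D w Fn Ψ) (hh : D w NN h) (hh' : D w NN h')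
    (hn : appP (σ := NN) (τ := Ty.nat) Ψ h = appP (σ := NN) (τ := Ty.nat) Ψ h' →
      (fnO h).app (ev e n) = (fnO h').app (ev e n) →
      (fnO h).app (ev e n') ≠ (fnO h').app (ev e n'))
    (eΨ : ev e Φ = Ψ) (eh : ev e f = h) (eh' : ev e f' = h') :
    A w NN h h' (ev e (argT Φ f f' n n')) := by
  classical
  subst eΨ eh eh'
  refine (A_arr _ _ _).mpr ⟨D_nat _, (A_nat _ _ _).mpr ?_, hh, hh'⟩
  rw [argT, ev_pair, fst_pair, ev_ite_neq, ev_ite_neq]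
  change (fnO _).app _ ≠ (fnO _).app _
  split_ifs with h₁ h₂
  · exact hn h₁ h₂
  · exact h₂
  · exact diffO_ne hΨ hh hh' h₁

/-- The witness for converse extensionality. -/
def ceC : Tm [] (Fn ⇒ NN ⇒ NN ⇒ Ty.nat).pos :=
  funT (σ := Fn) (τ := NN ⇒ NN ⇒ Ty.nat)
    (funT (σ := NN) (τ := NN ⇒ Ty.nat)
      (funT (σ := NN) (τ := Ty.nat) (ceT v2 v1 v0) (argT v4 v2 v1 (ceT v4 v3 v2) (ceT v4 v3 v1)))
      (let g : Tm [(NN ⇒ Ty.nat).neg, NN.pos, NN.pos, Fn.pos] NN.pos :=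
        fstT (σ := NN.pos) (τ := Ty.nat) v0;
      argT v3 v2 v1 (ceT v3 v2 g) (ceT v3 v1 g)))
    (let f : Tm [(NN ⇒ NN ⇒ Ty.nat).neg, Fn.pos, Fn.pos] NN.pos :=
        fstT (σ := NN.pos) (τ := Ty.prod NN.pos Ty.nat) v0;
      let g : Tm [(NN ⇒ NN ⇒ Ty.nat).neg, Fn.pos, Fn.pos] NN.pos :=
        fstT (σ := NN.pos) (τ := Ty.nat) (sndT (σ := NN.pos) (τ := Ty.prod NN.pos Ty.nat) v0);
      pairT (σ := NN.pos) (τ := Ty.nat)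
        (iteT (neqT (appPos (σ := NN) (τ := Ty.nat) v2 f) (appPos (σ := NN) (τ := Ty.nat) v1 f))
          g f) zeroT)

theorem ceC_app (Φ : Obj w Fn.pos) (f g : Obj w NN.pos) :
    appP (σ := NN) (τ := Ty.nat) (appP (σ := NN) (τ := NN ⇒ Ty.nat)
      (appP (σ := Fn) (τ := NN ⇒ NN ⇒ Ty.nat) (ev Env.nil ceC) Φ) f) g = ceO Φ f g := by
  rw [ceC, appP_funT, appP_funT, appP_funT, ev_ce]; rfl

/-- In each argument the evidence comes from the contrapositive of `ceO_eq` with the other two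
arguments fixed. If the functionals vary, they must differ at `f` or at `g`, and a test at `f` tells
which. -/
theorem D_ceC (w : World) : D w (Fn ⇒ NN ⇒ NN ⇒ Ty.nat) (ev Env.nil ceC) := by
  classical
  refine D_funT (fun w₁ m₁ Φ hΦ => D_funT (fun w₂ m₂ f hf => D_funT (fun w₃ m₃ g hg => D_nat _)
    fun w₃ m₃ g g' u hg hg' h => ?_) fun w₂ m₂ f f' u hf hf' h => ?_)
    fun w₁ m₁ Φ Φ' u hΦ hΦ' h => ?_
  · replace hΦ := (hΦ.map m₂).map m₃
    replace hf := hf.map m₃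
    rw [A_nat, ev_ce, ev_ce] at h
    refine A_argT hΦ hg hg' (fun h₁ h₂ h₃ => h ?_) rfl rfl rfl
    rw [ev_ce] at h₂ h₃
    exact ceO_eq hΦ hΦ hf hg hf hg' rfl h₁ rfl h₂ rfl h₃
  · replace hΦ := hΦ.map m₂
    obtain ⟨hg, h, -⟩ := (A_arr _ _ _).mp h
    rw [appP_funT, appP_funT, A_nat, ev_ce, ev_ce] at h
    refine A_argT hΦ hf hf' (fun h₁ h₂ h₃ => h ?_) rfl rfl rfl
    rw [ev_ce] at h₂ h₃
    exact ceO_eq hΦ hΦ hf hg hf' hg h₁ rfl h₂ rfl h₃ rfl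
  · obtain ⟨hf, h, -⟩ := (A_arr _ _ _).mp h
    obtain ⟨hg, h, -⟩ := (A_arr _ _ _).mp h
    rw [appP_funT, appP_funT, appP_funT, appP_funT, A_nat, ev_ce, ev_ce] at h
    refine (A_arr _ _ _).mpr ?_
    rw [ev_pair, fst_pair, ev_ite_neq, A_nat]
    split_ifs with h₁
    · refine ⟨hg, fun h₂ => h ?_, hΦ, hΦ'⟩
      exact ceO_eq hΦ hΦ' hf hg hf hg h₁ h₂ rfl rfl rfl rfl
    · exact ⟨hf, h₁, hΦ, hΦ'⟩

end
end EHA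

namespace EHA
open Obj

/-! ## Interpreted equality -/

section
variable {w w' : World} {σ τ : Ty}

/-- The interpretation of equality. -/
def Eqv (w : World) (σ : Ty) (x y : Obj w σ.pos) : Prop :=
  ∀ (w' : World) (m : Hom w w') (z : Obj w' σ.neg), ¬ A w' σ (x.map m) (y.map m) z

theorem Eqv.refl (x : Obj w σ.pos) : Eqv w σ x x := fun _ _ _ h => h.irrefl

theorem Eqv.of_eq {x y : Obj w σ.pos} (h : x = y) : Eqv w σ x y := h ▸ Eqv.refl x

theorem Eqv.symm {x y : Obj w σ.pos} (h : Eqv w σ x y) : Eqv w σ y x :=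
  fun w' m z h' => h w' m z h'.symm

/-- The contrapositive of cotransitivity, which applies only to a middle element in the domain. -/
theorem Eqv.trans {x y v : Obj w σ.pos} (hy : D w σ y) (h : Eqv w σ x y) (h' : Eqv w σ y v) :
    Eqv w σ x v :=
  fun w' m z hz => (hz.cotrans (hy.map m)).elim (h w' m z) (h' w' m z)

theorem Eqv.map {x y : Obj w σ.pos} (h : Eqv w σ x y) (m : Hom w w') :
    Eqv w' σ (x.map m) (y.map m) :=
  fun w₁ m₁ z hz => h w₁ (m.comp m₁) z (by simpa using hz)

/-- Distinct numbers are apart by any evidence, so at `N` interpreted equality is equality. -/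
theorem eqv_nat {x y : Obj w Ty.nat} : Eqv w Ty.nat x y ↔ x = y := by
  refine ⟨fun h => ?_, fun h => Eqv.of_eq (σ := Ty.nat) h⟩
  by_contra hn
  exact h w (Hom.id w) zero ((A_nat _ _ _).mpr (by simpa using hn))

/-- Compare `f x` and `g y` with `f y`: a difference from `f x` is pulled back to the arguments by
`f`, and a difference from `g y` is evidence, located at `y`, against `f = g`. -/
theorem Eqv.appP {f g : Obj w (σ ⇒ τ).pos} {x y : Obj w σ.pos} (hf : D w (σ ⇒ τ) f)
    (hg : D w (σ ⇒ τ) g) (hx : D w σ x) (hy : D w σ y) (h : Eqv w (σ ⇒ τ) f g)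
    (h' : Eqv w σ x y) : Eqv w τ (appP f x) (appP g y) := by
  intro w' m z hz
  rw [map_appP, map_appP] at hz
  rcases hz.cotrans ((hf.map m).appP (hy.map m)) with hz | hz
  · exact h' w' m _ ((hf.map m).appN (hx.map m) (hy.map m) hz)
  · exact h w' m (pair (y.map m) z) ((A_arr _ _ _).mpr
      ⟨by simpa using hy.map m, by simpa using hz, hf.map m, hg.map m⟩)

/-- Evidence that functions are apart contains an argument in the domain at which their values are
apart, so agreement on the domain suffices. -/
theorem Eqv.ext {f g : Obj w (σ ⇒ τ).pos}
    (h : ∀ (w' : World) (m : Hom w w') (x : Obj w' σ.pos), D w' σ x →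
      Eqv w' τ (EHA.appP (f.map m) x) (EHA.appP (g.map m) x)) : Eqv w (σ ⇒ τ) f g := by
  intro w' m z hz
  have hz := (A_arr _ _ _).mp hz
  exact h w' m _ hz.1 w' (Hom.id w') _ (by simpa using hz.2.1)

end

/-! ## Truth of interpreted formulas -/

section
variable {w w' : World} {Γ Γ' : Ctx} {σ τ : Ty} (I : ConInterp)

/-- Extension of a valuation of interpreted variables. -/
def Env.consP (a : Obj w σ.pos) (ρ : Env w (Γ.map Ty.pos)) : Env w ((σ :: Γ).map Ty.pos) :=
  Env.cons a ρ

theorem Env.map_consP (m : Hom w w') (a : Obj w σ.pos) (ρ : Env w (Γ.map Ty.pos)) :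
    (Env.consP a ρ).map m = Env.consP (a.map m) (ρ.map m) := Env.map_cons _ _ _

/-- The value of the interpretation of a term. -/
def evA (ρ : Env w (Γ.map Ty.pos)) (t : Tm Γ σ) : Obj w σ.pos := ev ρ (t.alpha I)

/-- Truth of the interpretation of a formula. -/
def ForcesA (w : World) (ρ : Env w (Γ.map Ty.pos)) (φ : Fm Γ) : Prop := Forces w ρ (φ.alpha I)

theorem map_evA (m : Hom w w') (ρ : Env w (Γ.map Ty.pos)) (t : Tm Γ σ) :
    (evA I ρ t).map m = evA I (ρ.map m) t := map_ev _ _ _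

theorem evA_app (ρ : Env w (Γ.map Ty.pos)) (t : Tm Γ (σ ⇒ τ)) (u : Tm Γ σ) :
    evA I ρ (t ⬝ u) = appP (evA I ρ t) (evA I ρ u) := rfl

theorem evA_con (ρ : Env w (Γ.map Ty.pos)) (c : Con σ) :
    evA I ρ (Tm.con c) = ev Env.nil (I σ c) := ev_conInterp _ _ _

theorem evA_subst {ρ : Env w (Γ'.map Ty.pos)} {ρ' : Env w (Γ.map Ty.pos)} {θ : Sub Γ Γ'}
    (h : ∀ (τ : Ty) (v : Var Γ τ), ρ' _ v.alpha = evA I ρ (θ τ v)) (t : Tm Γ σ) :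
    evA I ρ (t.subst θ) = evA I ρ' t := by
  induction t with
  | var v => exact (h _ v).symm
  | con c => rw [evA_con]; exact evA_con _ _ _
  | app t u iht ihu => rw [evA_app, ← iht, ← ihu]; rfl

theorem evA_wk (a : Obj w τ.pos) (ρ : Env w (Γ.map Ty.pos)) (t : Tm Γ σ) :
    evA I (Env.consP a ρ) t.wk = evA I ρ t := evA_subst I (fun _ _ => rfl) t

theorem forcesA_eq {ρ : Env w (Γ.map Ty.pos)} {s t : Tm Γ σ} :
    ForcesA I w ρ (s ≐ t) ↔ Eqv w σ (evA I ρ s) (evA I ρ t) := by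
  rw [ForcesA, Fm.alpha, forces_imp]
  refine ⟨fun h w' m z hz => forces_bot _ (h w' m (forces_exI z ?_)), fun h w' m hz =>
    forces_exE hz fun w₁ m₁ z hz => ?_⟩
  · rw [forces_apart, ev_wk, ev_wk, ← map_ev, ← map_ev]; exact hz
  · rw [forces_apart, ev_wk, ev_wk, ← Env.map_comp, ← map_ev, ← map_ev] at hz
    exact absurd hz (h _ _ _)

theorem forcesA_and {ρ : Env w (Γ.map Ty.pos)} {φ ψ : Fm Γ} :
    ForcesA I w ρ (φ ⋏ ψ) ↔ ForcesA I w ρ φ ∧ ForcesA I w ρ ψ := forces_and _ _ _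

theorem forcesA_or {ρ : Env w (Γ.map Ty.pos)} {φ ψ : Fm Γ} :
    ForcesA I w ρ (φ ⋎ ψ) ↔ ForcesA I w ρ φ ∨ ForcesA I w ρ ψ := forces_or _ _ _

theorem forcesA_imp {ρ : Env w (Γ.map Ty.pos)} {φ ψ : Fm Γ} :
    ForcesA I w ρ (φ ⟹ ψ) ↔ ∀ (w' : World) (m : Hom w w'),
      ForcesA I w' (ρ.map m) φ → ForcesA I w' (ρ.map m) ψ := forces_imp _ _ _

theorem forcesA_all {ρ : Env w (Γ.map Ty.pos)} {φ : Fm (σ :: Γ)} :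
    ForcesA I w ρ (Fm.all σ φ) ↔ ∀ (w' : World) (m : Hom w w') (a : Obj w' σ.pos), D w' σ a →
      ForcesA I w' (Env.consP a (ρ.map m)) φ := by
  refine (forces_all _ _).trans ⟨fun h w' m a ha => ?_, fun h w' m a => (forces_imp _ _ _).mpr
    fun w₁ m₁ ha => ?_⟩
  · have := (forces_imp _ _ _).mp (h w' m a) w' (Hom.id w')
    rw [Env.map_id] at this
    exact this ((forces_dom _ _).mpr ha)
  · have := h w₁ (m.comp m₁) (a.map m₁) (by simpa using (forces_dom _ _).mp ha)
    rw [Env.map_comp, ← Env.map_consP] at this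
    exact this

theorem forcesA_exI {ρ : Env w (Γ.map Ty.pos)} {φ : Fm (σ :: Γ)} (a : Obj w σ.pos)
    (ha : D w σ a) (h : ForcesA I w (Env.consP a ρ) φ) : ForcesA I w ρ (Fm.ex σ φ) :=
  forces_exI a ((forces_and _ _ _).mpr ⟨(forces_dom _ _).mpr ha, h⟩)

theorem forcesA_exE {ρ : Env w (Γ.map Ty.pos)} {φ : Fm (σ :: Γ)} {ρ' : Env w (Γ'.map Ty.pos)}
    {χ : Fm Γ'} (h : ForcesA I w ρ (Fm.ex σ φ))
    (h' : ∀ (w' : World) (m : Hom w w') (a : Obj w' σ.pos), D w' σ a →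
      ForcesA I w' (Env.consP a (ρ.map m)) φ → ForcesA I w' (ρ'.map m) χ) : ForcesA I w ρ' χ :=
  forces_exE h fun w' m a ha =>
    let hc := (forces_and _ _ _).mp ha
    h' w' m a ((forces_dom _ _).mp hc.1) hc.2

theorem ForcesA.map {ρ : Env w (Γ.map Ty.pos)} {φ : Fm Γ} (h : ForcesA I w ρ φ) (m : Hom w w') :
    ForcesA I w' (ρ.map m) φ := Forces.map h m

/-- The interpretation commutes with substitution up to truth, which is all that soundness needs.
The valuations are related pointwise on interpreted variables, a relation preserved by morphisms and
by passing under a binder. -/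
theorem forcesA_subst (φ : Fm Γ) : ∀ {Γ' : Ctx} {w : World} {ρ : Env w (Γ'.map Ty.pos)}
    {ρ' : Env w (Γ.map Ty.pos)} {θ : Sub Γ Γ'},
    (∀ (τ : Ty) (v : Var Γ τ), ρ' _ v.alpha = evA I ρ (θ τ v)) →
      (ForcesA I w ρ (φ.subst θ) ↔ ForcesA I w ρ' φ) := by
  have hmap : ∀ {Γ Γ' : Ctx} {w w' : World} {ρ : Env w (Γ'.map Ty.pos)}
      {ρ' : Env w (Γ.map Ty.pos)} {θ : Sub Γ Γ'} (m : Hom w w'),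
      (∀ (τ : Ty) (v : Var Γ τ), ρ' _ v.alpha = evA I ρ (θ τ v)) →
      ∀ (τ : Ty) (v : Var Γ τ), ρ'.map m _ v.alpha = evA I (ρ.map m) (θ τ v) := by
    intro Γ Γ' w w' ρ ρ' θ m h τ v
    rw [Env.map_apply, h, map_evA]
  have hcons : ∀ {Γ Γ' : Ctx} {σ : Ty} {w : World} {ρ : Env w (Γ'.map Ty.pos)}
      {ρ' : Env w (Γ.map Ty.pos)} {θ : Sub Γ Γ'} (a : Obj w σ.pos),
      (∀ (τ : Ty) (v : Var Γ τ), ρ' _ v.alpha = evA I ρ (θ τ v)) →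
      ∀ (τ : Ty) (v : Var (σ :: Γ) τ), Env.consP a ρ' _ v.alpha =
        evA I (Env.consP a ρ) (θ.lift τ v) := by
    intro Γ Γ' σ w ρ ρ' θ a h τ v
    cases v with
    | here => rfl
    | there v => exact (h τ v).trans (evA_wk I a ρ (θ τ v)).symm
  induction φ with
  | bot => exact fun _ => Iff.rfl
  | eq s t =>
    intro Γ' w ρ ρ' θ h
    rw [Fm.subst, forcesA_eq, forcesA_eq, evA_subst I h, evA_subst I h]
  | and φ ψ h₁ h₂ =>
    intro Γ' w ρ ρ' θ h
    rw [Fm.subst, forcesA_and, forcesA_and, h₁ h, h₂ h]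
  | or φ ψ h₁ h₂ =>
    intro Γ' w ρ ρ' θ h
    rw [Fm.subst, forcesA_or, forcesA_or, h₁ h, h₂ h]
  | imp φ ψ h₁ h₂ =>
    intro Γ' w ρ ρ' θ h
    rw [Fm.subst, forcesA_imp, forcesA_imp]
    exact forall₂_congr fun w' m => by rw [h₁ (hmap m h), h₂ (hmap m h)]
  | all σ φ ih =>
    intro Γ' w ρ ρ' θ h
    rw [Fm.subst, forcesA_all, forcesA_all]
    exact forall₃_congr fun w' m a => by rw [ih (hcons a (hmap m h))]
  | ex σ φ ih =>
    intro Γ' w ρ ρ' θ h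
    exact ⟨fun h' => forcesA_exE I h' fun w' m a ha hφ =>
        forcesA_exI I a ha ((ih (hcons a (hmap m h))).mp hφ),
      fun h' => forcesA_exE I h' fun w' m a ha hφ =>
        forcesA_exI I a ha ((ih (hcons a (hmap m h))).mpr hφ)⟩

theorem forcesA_wk (a : Obj w σ.pos) (ρ : Env w (Γ.map Ty.pos)) (φ : Fm Γ) :
    ForcesA I w (Env.consP a ρ) φ.wk ↔ ForcesA I w ρ φ := forcesA_subst I φ fun _ _ => rfl

theorem forcesA_inst (ρ : Env w (Γ.map Ty.pos)) (φ : Fm (σ :: Γ)) (t : Tm Γ σ) :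
    ForcesA I w ρ (φ.inst t) ↔ ForcesA I w (Env.consP (evA I ρ t) ρ) φ :=
  forcesA_subst I φ fun _ v => by cases v <;> rfl

/-- Valuations in the domains. -/
def Env.Good (ρ : Env w (Γ.map Ty.pos)) : Prop := ∀ (σ : Ty) (v : Var Γ σ), D w σ (ρ _ v.alpha)

theorem Env.Good.map {ρ : Env w (Γ.map Ty.pos)} (h : ρ.Good) (m : Hom w w') : (ρ.map m).Good :=
  fun σ v => (h σ v).map m

theorem Env.Good.consP {ρ : Env w (Γ.map Ty.pos)} (h : ρ.Good) {a : Obj w σ.pos}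
    (ha : D w σ a) : (Env.consP a ρ).Good := by
  intro τ v
  cases v with
  | here => exact ha
  | there v => exact h τ v

variable {I}

theorem ConInterp.Correct.D_con (hI : I.Correct) (c : Con σ) : D w σ (ev Env.nil (I σ c)) :=
  (forces_dom _ _).mp (forces_of_thm (hI.inDom c) Env.nil)

theorem D_evA (hI : I.Correct) {ρ : Env w (Γ.map Ty.pos)} (hρ : ρ.Good) (t : Tm Γ σ) :
    D w σ (evA I ρ t) := by
  induction t with
  | var v => exact hρ _ v
  | con c => rw [evA_con]; exact hI.D_con c
  | app t u iht ihu => exact iht.appP ihu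

theorem eqv_evA (hI : I.Correct) {ρ ρ' : Env w (Γ.map Ty.pos)} (hρ : ρ.Good) (hρ' : ρ'.Good)
    (h : ∀ (σ : Ty) (v : Var Γ σ), Eqv w σ (ρ _ v.alpha) (ρ' _ v.alpha)) (t : Tm Γ σ) :
    Eqv w σ (evA I ρ t) (evA I ρ' t) := by
  induction t with
  | var v => exact h _ v
  | con c => rw [evA_con, evA_con]; exact Eqv.refl _
  | app t u iht ihu =>
    exact Eqv.appP (D_evA hI hρ t) (D_evA hI hρ' t) (D_evA hI hρ u) (D_evA hI hρ' u) iht ihu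

/-- Leibniz's law for interpreted equality. Equations use its transitivity, hence the assumption
that the valuations stay in the domains; implications use its symmetry. -/
theorem ForcesA.congr (hI : I.Correct) (φ : Fm Γ) : ∀ {w : World} {ρ ρ' : Env w (Γ.map Ty.pos)},
    ρ.Good → ρ'.Good → (∀ (σ : Ty) (v : Var Γ σ), Eqv w σ (ρ _ v.alpha) (ρ' _ v.alpha)) →
      ForcesA I w ρ φ → ForcesA I w ρ' φ := by
  have hcons : ∀ {Γ : Ctx} {σ : Ty} {w : World} {ρ ρ' : Env w (Γ.map Ty.pos)} (a : Obj w σ.pos),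
      (∀ (σ : Ty) (v : Var Γ σ), Eqv w σ (ρ _ v.alpha) (ρ' _ v.alpha)) →
      ∀ (τ : Ty) (v : Var (σ :: Γ) τ), Eqv w τ (Env.consP a ρ _ v.alpha)
        (Env.consP a ρ' _ v.alpha) := by
    intro Γ σ w ρ ρ' a h τ v
    cases v with
    | here => exact Eqv.refl _
    | there v => exact h τ v
  induction φ with
  | bot => exact fun _ _ _ h => h
  | eq s t =>
    intro w ρ ρ' hρ hρ' h h'
    rw [forcesA_eq] at h' ⊢
    exact Eqv.trans (D_evA hI hρ s) (eqv_evA hI hρ hρ' h s).symm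
      (Eqv.trans (D_evA hI hρ t) h' (eqv_evA hI hρ hρ' h t))
  | and φ ψ h₁ h₂ =>
    intro w ρ ρ' hρ hρ' h h'
    rw [forcesA_and] at h' ⊢
    exact ⟨h₁ hρ hρ' h h'.1, h₂ hρ hρ' h h'.2⟩
  | or φ ψ h₁ h₂ =>
    intro w ρ ρ' hρ hρ' h h'
    rw [forcesA_or] at h' ⊢
    exact h'.imp (h₁ hρ hρ' h) (h₂ hρ hρ' h)
  | imp φ ψ h₁ h₂ =>
    intro w ρ ρ' hρ hρ' h h'
    rw [forcesA_imp] at h' ⊢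
    intro w' m hφ
    exact h₂ (hρ.map m) (hρ'.map m) (fun σ v => (h σ v).map m)
      (h' w' m (h₁ (hρ'.map m) (hρ.map m) (fun σ v => ((h σ v).map m).symm) hφ))
  | all σ φ ih =>
    intro w ρ ρ' hρ hρ' h h'
    rw [forcesA_all] at h' ⊢
    intro w' m a ha
    exact ih ((hρ.map m).consP ha) ((hρ'.map m).consP ha)
      (hcons a fun σ v => (h σ v).map m) (h' w' m a ha)
  | ex σ φ ih =>
    intro w ρ ρ' hρ hρ' h h'
    refine forcesA_exE I h' fun w' m a ha hφ => forcesA_exI I a ha ?_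
    exact ih ((hρ.map m).consP ha) ((hρ'.map m).consP ha) (hcons a fun σ v => (h σ v).map m) hφ

/-! ## Soundness -/

theorem Thm.ev_eq {s t : Tm Γ σ} (h : Thm HA (s ≐ t)) (ρ : Env w Γ) : ev ρ s = ev ρ t :=
  (forces_eq _ _ _).mp (forces_of_thm h ρ)

theorem evA_zero (hI : I.Correct) (ρ : Env w (Γ.map Ty.pos)) : evA I ρ zeroT = zero :=
  (ev_conInterp _ _ _).trans ((ev_conInterp (Γ := []) _ Env.nil _).symm.trans
    (Thm.ev_eq (σ := Ty.nat) hI.zero Env.nil))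

theorem evA_succ (hI : I.Correct) (ρ : Env w (Γ.map Ty.pos)) (n : Tm Γ Ty.nat) :
    evA I ρ (succT n) = succ (evA I ρ n) :=
  Thm.ev_eq (σ := Ty.nat) (hI.succ (n.alpha I : Tm _ Ty.nat)) ρ

/-- The equational axioms hold with actual equality of values, by correctness of the assignment.
Only extensionality depends on how apartness is defined at function types. -/
theorem forcesA_HA (hI : I.Correct) {ρ : Env w (Γ.map Ty.pos)} (hρ : ρ.Good) {φ : Fm Γ}
    (h : HA Γ φ) : ForcesA I w ρ φ := by
  cases h with
  | k a b =>
    exact (forcesA_eq I).mpr (Eqv.of_eq (Thm.ev_eq (hI.k _ _) ρ))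
  | s a b c =>
    exact (forcesA_eq I).mpr (Eqv.of_eq (Thm.ev_eq (hI.s _ _ _) ρ))
  | fstPair a b =>
    exact (forcesA_eq I).mpr (Eqv.of_eq (((Thm.ev_eq (hI.fst ((pairT a b).alpha I)) ρ).trans
      (congrArg Obj.fst (Thm.ev_eq (hI.pair (a.alpha I) (b.alpha I)) ρ))).trans (fst_pair _ _)))
  | sndPair a b =>
    exact (forcesA_eq I).mpr (Eqv.of_eq (((Thm.ev_eq (hI.snd ((pairT a b).alpha I)) ρ).trans
      (congrArg Obj.snd (Thm.ev_eq (hI.pair (a.alpha I) (b.alpha I)) ρ))).trans (snd_pair _ _)))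
  | pairEta p =>
    exact (forcesA_eq I).mpr (Eqv.of_eq ((Thm.ev_eq (hI.pair _ _) ρ).trans
      ((congrArg₂ Obj.pair (Thm.ev_eq (hI.fst _) ρ) (Thm.ev_eq (hI.snd _) ρ)).trans
        (pair_fst_snd _))))
  | casesInl f g a =>
    exact (forcesA_eq I).mpr (Eqv.of_eq ((congrArg (appP _) (Thm.ev_eq (hI.inl
        (a.alpha I)) ρ)).trans
      (Thm.ev_eq (hI.casesInl (f.alpha I) (g.alpha I) (a.alpha I)) ρ)))
  | casesInr f g b =>
    exact (forcesA_eq I).mpr (Eqv.of_eq ((congrArg (appP _) (Thm.ev_eq (hI.inr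
        (b.alpha I)) ρ)).trans
      (Thm.ev_eq (hI.casesInr (f.alpha I) (g.alpha I) (b.alpha I)) ρ)))
  | @sumExhaust _ σ τ p =>
    have hp := D_evA hI hρ p
    refine (forcesA_or I).mpr ((sum_cases (evA I ρ p)).imp ?_ ?_)
    · rintro ⟨a, ha⟩
      rw [ha] at hp
      refine forcesA_exI I a ((D_inl _).mp hp) ((forcesA_eq I).mpr (Eqv.of_eq ?_))
      rw [evA_wk, ha]
      exact (Thm.ev_eq (hI.inl (σ := σ) (τ := τ) v0) (Env.consP a ρ)).symm
    · rintro ⟨b, hb⟩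
      rw [hb] at hp
      refine forcesA_exI I b ((D_inr _).mp hp) ((forcesA_eq I).mpr (Eqv.of_eq ?_))
      rw [evA_wk, hb]
      exact (Thm.ev_eq (hI.inr (σ := σ) (τ := τ) v0) (Env.consP b ρ)).symm
  | recZero a f =>
    exact (forcesA_eq I).mpr (Eqv.of_eq ((congrArg (appP (σ := Ty.nat) _) (evA_zero hI ρ)).trans
      (Thm.ev_eq (hI.recZero (a.alpha I) (f.alpha I)) ρ)))
  | recSucc a f n =>
    exact (forcesA_eq I).mpr (Eqv.of_eq ((congrArg (appP (σ := Ty.nat) _)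
      (Thm.ev_eq (σ := Ty.nat) (hI.succ _) ρ)).trans (Thm.ev_eq (hI.recSucc (a.alpha I)
        (f.alpha I) (n.alpha I)) ρ)))
  | succNeZero n =>
    refine (forcesA_imp I).mpr fun w' m h => ?_
    have h := eqv_nat.mp ((forcesA_eq I).mp h)
    rw [evA_succ hI, evA_zero hI] at h
    exact absurd h (succ_ne_zero _)
  | succInj n k =>
    refine (forcesA_imp I).mpr fun w' m h => (forcesA_eq I).mpr (eqv_nat.mpr ?_)
    have h := eqv_nat.mp ((forcesA_eq I).mp h)
    rw [evA_succ hI, evA_succ hI] at h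
    exact succ_inj.mp h
  | induction φ =>
    refine (forcesA_imp I).mpr fun w₁ m₁ h₀ => (forcesA_imp I).mpr fun w₂ m₂ h₁ =>
      (forcesA_all I).mpr fun w₃ m₃ n hn => ?_
    rw [forcesA_inst, evA_zero hI] at h₀
    have h₀ := (h₀.map _ m₂).map _ m₃
    rw [Env.map_consP, Env.map_consP, map_zero, map_zero] at h₀
    -- Induction in `HA` for the interpreted formula itself: relativization is no obstacle, as every
    -- number lies in the domain.
    refine forces_nat_ind (φ.alpha I) h₀ (fun w₄ m₄ k hk => ?_) n
    have h₂ := (forcesA_imp I).mp ((forcesA_all I).mp h₁ w₄ (m₃.comp m₄) k (D_nat k)) w₄ (Hom.id w₄)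
    rw [Env.map_id, Env.map_comp] at h₂
    refine (forcesA_subst I φ fun τ v => ?_).mp (h₂ hk)
    cases v with
    | here =>
      exact (evA_succ hI (Env.consP (σ := Ty.nat) k
        ((((ρ.map m₁).map m₂).map m₃).map m₄)) v0).symm
    | there v => rfl
  | ext f g =>
    refine (forcesA_imp I).mpr fun w₁ m₁ h => (forcesA_eq I).mpr (Eqv.ext fun w₂ m₂ a ha => ?_)
    have h := (forcesA_eq I).mp ((forcesA_all I).mp h w₂ m₂ a ha)
    rw [evA_app, evA_app, evA_wk, evA_wk] at h
    rw [map_evA, map_evA]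
    exact h

/-- Reduces the nested quantifiers and implications to one condition in a single later world. The
point `x` is tied to the value of `X` by an equation, so that this value can be rewritten before it
is used. -/
theorem forcesA_CE₀_of {ρ : Env w (Γ.map Ty.pos)} (X : Obj w (Fn ⇒ NN ⇒ NN ⇒ Ty.nat).pos)
    (hX : D w (Fn ⇒ NN ⇒ NN ⇒ Ty.nat) X)
    (h : ∀ (w' : World) (m : Hom w w') (Φ : Obj w' Fn.pos) (f g : Obj w' NN.pos), D w' Fn Φ →
      D w' NN f → D w' NN g →
      appP (σ := NN) (τ := Ty.nat) Φ f ≠ appP (σ := NN) (τ := Ty.nat) Φ g →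
      ∀ x, x = appP (σ := NN) (τ := Ty.nat) (appP (σ := NN) (τ := NN ⇒ Ty.nat)
        (appP (σ := Fn) (τ := NN ⇒ NN ⇒ Ty.nat) (X.map m) Φ) f) g →
      appP (σ := Ty.nat) (τ := Ty.nat) f x ≠ appP (σ := Ty.nat) (τ := Ty.nat) g x) :
    ForcesA I w ρ CE₀ := by
  refine forcesA_exI I (σ := Fn ⇒ NN ⇒ NN ⇒ Ty.nat) X hX ?_
  refine (forcesA_all I).mpr fun w₁ m₁ Φ hΦ => (forcesA_all I).mpr fun w₂ m₂ f hf =>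
    (forcesA_all I).mpr fun w₃ m₃ g hg => (forcesA_imp I).mpr fun w₄ m₄ h₁ =>
    (forcesA_imp I).mpr fun w₅ m₅ h₂ => ?_
  refine absurd (eqv_nat.mp ((forcesA_eq I).mp h₂)) (h w₅
    ((((m₁.comp m₂).comp m₃).comp m₄).comp m₅) _ _ _
    ((((hΦ.map m₂).map m₃).map m₄).map m₅) (((hf.map m₃).map m₄).map m₅) ((hg.map m₄).map m₅)
    (fun he => forces_bot _ ((forcesA_imp I).mp h₁ w₅ m₅ ((forcesA_eq I).mpr
      (eqv_nat.mpr he)))) _ ?_)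
  rw [map_comp, map_comp, map_comp, map_comp]
  rfl

theorem forcesA_CE₀ (ρ : Env w (Γ.map Ty.pos)) : ForcesA I w ρ CE₀ := by
  refine forcesA_CE₀_of (ev Env.nil ceC) (D_ceC w) fun w' m Φ f g hΦ hf hg h x hx => ?_
  rw [map_ev, Env.map_nil, ceC_app] at hx
  rw [hx]
  exact ceO_ne hΦ hf hg h

/-- Soundness by induction on derivations. Quantifier instances stay in the domains because terms
are built by application from elements of the domains (`D_evA`), and the replacement rule is
Leibniz's law `ForcesA.congr`. -/
theorem forcesA_of_prov (hI : I.Correct) {Δ : List (Fm Γ)} {φ : Fm Γ} (h : Prov HAplusCE₀ Δ φ) :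
    ∀ {w : World} {ρ : Env w (Γ.map Ty.pos)}, ρ.Good → (∀ ψ ∈ Δ, ForcesA I w ρ ψ) →
      ForcesA I w ρ φ := by
  induction h with
  | ax h =>
    intro w ρ hρ _
    rcases h with h | rfl
    · exact forcesA_HA hI hρ h
    · exact forcesA_CE₀ ρ
  | hyp h => exact fun _ hΔ => hΔ _ h
  | botE _ ih => exact fun hρ hΔ => absurd (ih hρ hΔ) (forces_bot _)
  | andI _ _ ih ih' => exact fun hρ hΔ => (forcesA_and I).mpr ⟨ih hρ hΔ, ih' hρ hΔ⟩
  | andE₁ _ ih => exact fun hρ hΔ => ((forcesA_and I).mp (ih hρ hΔ)).1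
  | andE₂ _ ih => exact fun hρ hΔ => ((forcesA_and I).mp (ih hρ hΔ)).2
  | orI₁ _ ih => exact fun hρ hΔ => (forcesA_or I).mpr (.inl (ih hρ hΔ))
  | orI₂ _ ih => exact fun hρ hΔ => (forcesA_or I).mpr (.inr (ih hρ hΔ))
  | orE _ _ _ ih ih₁ ih₂ =>
    exact fun hρ hΔ => ((forcesA_or I).mp (ih hρ hΔ)).elim
      (fun h => ih₁ hρ (List.forall_mem_cons.mpr ⟨h, hΔ⟩))
      (fun h => ih₂ hρ (List.forall_mem_cons.mpr ⟨h, hΔ⟩))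
  | impI _ ih =>
    exact fun hρ hΔ => (forcesA_imp I).mpr fun w' m h => ih (hρ.map m)
      (List.forall_mem_cons.mpr ⟨h, fun ψ hψ => (hΔ ψ hψ).map I m⟩)
  | impE _ _ ih ih' =>
    intro w ρ hρ hΔ
    have := (forcesA_imp I).mp (ih hρ hΔ) w (Hom.id w)
    rw [Env.map_id] at this
    exact this (ih' hρ hΔ)
  | allI _ ih =>
    refine fun hρ hΔ => (forcesA_all I).mpr fun w' m a ha => ih ((hρ.map m).consP ha) ?_
    exact List.forall_mem_map.mpr fun ψ hψ => (forcesA_wk I _ _ _).mpr ((hΔ ψ hψ).map I m)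
  | allE t _ ih =>
    intro w ρ hρ hΔ
    have := (forcesA_all I).mp (ih hρ hΔ) w (Hom.id w) _ (D_evA hI hρ t)
    rw [Env.map_id] at this
    exact (forcesA_inst I _ _ _).mpr this
  | exI t _ ih =>
    exact fun hρ hΔ => forcesA_exI I _ (D_evA hI hρ t) ((forcesA_inst I _ _ _).mp (ih hρ hΔ))
  | exE _ _ ih ih' =>
    refine fun hρ hΔ => forcesA_exE I (ih hρ hΔ) fun w' m a ha h => (forcesA_wk I _ _ _).mp
      (ih' ((hρ.map m).consP ha) (List.forall_mem_cons.mpr ⟨h, ?_⟩))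
    exact List.forall_mem_map.mpr fun ψ hψ => (forcesA_wk I _ _ _).mpr ((hΔ ψ hψ).map I m)
  | eqI t => exact fun _ _ => (forcesA_eq I).mpr (Eqv.refl _)
  | @eqE _ _ _ s t φ _ _ ih ih' =>
    intro w ρ hρ hΔ
    refine (forcesA_inst I _ _ _).mpr (ForcesA.congr hI φ (hρ.consP (D_evA hI hρ s))
      (hρ.consP (D_evA hI hρ t)) (fun τ v => ?_) ((forcesA_inst I _ _ _).mp (ih' hρ hΔ)))
    cases v with
    | here => exact (forcesA_eq I).mp (ih hρ hΔ)
    | there v => exact Eqv.refl _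

end
end EHA


/-- Soundness in every world, followed by completeness for `HA`. A sentence has no free variables,
so the requirement that the valuation lie in the domains is vacuous. -/
theorem mainTheorem10 :
    (∃ I : EHA.ConInterp, I.Correct) ∧
      ∀ I : EHA.ConInterp, I.Correct →
        ∀ φ : EHA.Fm [], EHA.Thm EHA.HAplusCE₀ φ → EHA.Thm EHA.HA (φ.alpha I) :=
  ⟨⟨EHA.stdInterp, EHA.stdInterp_correct⟩, fun _ hI _ h => EHA.thm_of_forces fun _ _ =>
    EHA.forcesA_of_prov hI h (fun _ v => nomatch v) (by simp)⟩
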